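/- **Setting.** Let $A\in\mathbb R^{n\times n}$, $B\in\mathbb R^{n\times m}$, $Q\in\mathbb R^{n\times n}$, $R\in\mathbb R^{m\times m}$, $C_x\in\mathbb R^{p_x\times n}$, $c_x\in\mathbb R^{p_x}$, $C_u\in\mathbb R^{p_u\times m}$, $c_u\in\mathbb R^{p_u}$, $x_{\rm init}\in\mathbb R^n$. The constrained LQR problem is $$\min\ \tfrac12\sum_{i=0}^\infty \big(x_i^\top Qx_i+u_i^\top Ru_i\big)\quad\text{s.t.}\quad x_{i+1}=Ax_i+Bu_i,\ x_0=x_{\rm init},\ C_xx_i\le c_x,\ C_uu_i\le c_u\quad(i\in\mathbb N).$$ Assume that $(A,B)$ is stabilizable, $(A,\sqrt Q)$ is detectable, the optimal value is finite, $\{x: C_xx\le c_x\}$ contains the origin in its interior, $C_u$ has full column rank, $Q\succeq0$ and $R\succ0$. For $0<w<1$ with $w\,\rho(A)^2<1$ ($\rho$ the spectral radius), $\ell^2_w$ is the Hilbert space of sequences with $\sum_i w^i\|z_i\|^2<\infty$ and inner product $\langle z,y\rangle=\sum_i w^iz_i^\top y_i$; $\mathcal H_u,\mathcal H_x,\mathcal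 H_\lambda$ are the spaces $\ell^2_w$ of sequences in $\mathbb R^m$, $\mathbb R^n$, $\mathbb R^{p_u+p_x}$. For $u\in\mathcal H_u$ put $(\mathbf Bu)_i=\sum_{j\le i}A^{i-j}Bu_j$, $(\mathbf Cu)_i=(C_uu_i,\ C_x(\mathbf Bu)_i)$ and $\mathbf c_i=(c_u,\ c_x-C_xA^{i+1}x_{\rm init})$; thus $\mathbf B:\mathcal H_u\to\mathcal H_x$ and $\mathbf C:\mathcal H_u\to\mathcal H_\lambda$ are bounded, $\mathbf c\in\mathcal H_\lambda$, and the state sequence is $\mathbf x=(x_1,x_2,\dots)=(A^{i+1}x_{\rm init})_{i\ge 0}+\mathbf Bu$. Let $f(u)\in[0,\infty]$ be the cost above as a function of $u\in\mathcal H_u$, $f^\star$ its Fenchel conjugate, $h^\star(\lambda)=f^\star(\mathbf C^\star\lambda)-\langle\lambda,\mathbf c\rangle$, and $F=h^\star+\delta_-$, where $\delta_-$ is the indicator function of the nonpositive orthant of $\mathcal H_\lambda$. Let $\mu>0$ be a strong convexity modulus of $f$, let $L>0$ be a Lipschitz constant of the ($\mathcal H_\lambda$-)gradient $\nabla h^\star$,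 and let $a>2$. The AFBS iterates are $\lambda^0=0$, $\alpha^0=0$, $\alpha^k=\frac{k-1}{k+a}$ $(k\ge1)$, $$\hat\lambda^k=\lambda^k+\alpha^k(\lambda^k-\lambda^{k-1}),\qquad \lambda^{k+1}=\min\{\hat\lambda^k-\tfrac1L\nabla h^\star(\hat\lambda^k),0\}.$$ Let $P_{\rm LQ}\succeq0$ solve the discrete algebraic Riccati equation of $(A,B,Q,R)$, let $K$ be the corresponding feedback matrix ($u=Kx$), and let $S$ be a set with $0\in\operatorname{int}S$ contained in the maximal positively invariant set of $x^+=(A+BK)x$ subject to $C_xx\le c_x$, $C_uKx\le c_u$. For $\lambda\in\mathcal H_\lambda$ and $T\in\mathbb N$ let $u(\lambda,T)$, with states $x(\lambda,T)$, be the input sequence whose first $T$ entries minimize $$\tfrac12x_T^\top P_{\rm LQ}x_T+\sum_{i=0}^{T-1}\Big(\tfrac12x_i^\top Qx_i+\tfrac12u_i^\top Ru_i-w^i\lambda_i^\top\begin{bmatrix}C_uu_i-c_u\\ C_xx_{i+1}-c_x\end{bmatrix}\Big)$$ and with $u_i=Kx_i$ for $i\ge T$. Let $T^0=0$ and let $T^{k+1}$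 be the least $T\ge T^k$ for which there is $T^S\ge T$ such that the pair $(\hat x,\hat u)$ given by $(\hat\lambda^k,T^k)$ satisfies $C_x\hat x_{i+1}\lhd c_x$, $C_u\hat u_i\lhd c_u$ for $i=T,\dots,T^S$ and $\hat x_{T^S}\in S$; here $\lhd$ is $\le$, or, if all entries of $c_x$ and $c_u$ are positive, it may also be $<$. Put $u^k=u(\lambda^k,T^k)$, and let $\mathbf x^k$ be its state sequence. **Theorem.** The function $h^\star$ is finite and differentiable on $\mathcal H_\lambda$, the CLQR problem has a unique optimal input sequence $u^\infty$, which lies in $\mathcal H_u$ (with state sequence $\mathbf x^\infty$), the $T^k$ are well defined with $\lambda^k_i=\hat\lambda^k_i=0$ for $i\ge T^k$, the $u^k$ are well defined and lie in $\mathcal H_u$, and: 1. for every minimizer $\lambda^\infty$ of $F$ and every $k\ge0$, $F(\lambda^k)-F(\lambda^\infty)\le\dfrac{a^2L}{2(k+a-1)^2}\|\lambda^0-\lambda^\infty\|^2$; 2. $F$ has a minimizer, and $\lambda^k$ converges weakly in $\mathcal H_\lambda$ to some minimizer of $F$; 3. $u^k\to u^\infty$ strongly in $\mathcal H_u$, and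 for every minimizer $\lambda^\infty$ of $F$ and every $k\ge 0$, $\|u^k-u^\infty\|\le a\sqrt{\dfrac L\mu}\,\dfrac{\|\lambda^0-\lambda^\infty\|}{k+a-1}$; 4. $\mathbf x^k\to\mathbf x^\infty$ strongly in $\mathcal H_x$, and for every minimizer $\lambda^\infty$ of $F$ and every $k\ge 0$, $\|\mathbf x^k-\mathbf x^\infty\|\le a\sqrt{\dfrac{\|\mathbf B\|^2L}\mu}\,\dfrac{\|\lambda^0-\lambda^\infty\|}{k+a-1}$; 5. the sequence $(T^k)$ is bounded. -/

import Mathlib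

open scoped Matrix ENNReal NNReal Topology

/-! ### Weighted `ℓ²` spaces -/

section WeightedL2

variable {E : Type*} [NormedAddCommGroup E] [InnerProductSpace ℝ E]

theorem wl2_norm_add_sq_le {E : Type*} [NormedAddCommGroup E] {w : ℝ} (hw : 0 < w) (i : ℕ) (a b : E) :
    w ^ i * ‖a + b‖ ^ 2 ≤ 2 * (w ^ i * ‖a‖ ^ 2) + 2 * (w ^ i * ‖b‖ ^ 2) := by
  have h1 : ‖a + b‖ ^ 2 ≤ 2 * ‖a‖ ^ 2 + 2 * ‖b‖ ^ 2 := by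
    nlinarith [norm_add_le a b, norm_nonneg (a + b), norm_nonneg a, norm_nonneg b,
      sq_nonneg (‖a‖ - ‖b‖)]
  have h2 : 0 < w ^ i := pow_pos hw i
  nlinarith [mul_le_mul_of_nonneg_left h1 h2.le]

/-- The sequences `z` in `E` with `∑ wⁱ ‖zᵢ‖² < ∞`, as a linear subspace of all sequences. -/
def wl2Submodule (w : ℝ) [hw : Fact (0 < w)] (E : Type*) [NormedAddCommGroup E]
    [InnerProductSpace ℝ E] : Submodule ℝ (ℕ → E) where
  carrier := {z | Summable fun i => w ^ i * ‖z i‖ ^ 2}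
  zero_mem' := by simp
  add_mem' := by
    intro a b ha hb
    refine Summable.of_nonneg_of_le (fun i => ?_) (fun i => wl2_norm_add_sq_le hw.out i (a i) (b i))
      ((Summable.mul_left 2 ha).add (Summable.mul_left 2 hb))
    have := hw.out
    positivity
  smul_mem' := by
    intro c a ha
    have h : (fun i => w ^ i * ‖(c • a) i‖ ^ 2) = fun i => ‖c‖ ^ 2 * (w ^ i * ‖a i‖ ^ 2) := by
      funext i
      simp only [Pi.smul_apply, norm_smul]
      ring
    simp only [Set.mem_ofPred_eq] at ha ⊢
    rw [h]
    exact ha.mul_left _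

/-- The weighted space `ℓ²_w(E)` of sequences `z` in `E` with `∑ wⁱ ‖zᵢ‖² < ∞`. -/
def WL2 (w : ℝ) [Fact (0 < w)] (E : Type*) [NormedAddCommGroup E] [InnerProductSpace ℝ E] :
    Type _ :=
  ↥(wl2Submodule w E)

namespace WL2

variable {w : ℝ} [hw : Fact (0 < w)]

noncomputable instance : AddCommGroup (WL2 w E) := inferInstanceAs (AddCommGroup ↥(wl2Submodule w E))

noncomputable instance : Module ℝ (WL2 w E) := inferInstanceAs (Module ℝ ↥(wl2Submodule w E))

instance : CoeFun (WL2 w E) (fun _ => ℕ → E) := ⟨fun z => Subtype.val z⟩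

/-- A weighted square-summable sequence, as an element of `ℓ²_w(E)`. -/
def mk (z : ℕ → E) (hz : Summable fun i => w ^ i * ‖z i‖ ^ 2) : WL2 w E := ⟨z, hz⟩

@[simp] theorem mk_apply (z : ℕ → E) (hz : Summable fun i => w ^ i * ‖z i‖ ^ 2) (i : ℕ) :
    (mk z hz : WL2 w E) i = z i := rfl

@[simp] theorem add_apply (y z : WL2 w E) (i : ℕ) : (y + z) i = y i + z i := rfl

@[simp] theorem sub_apply (y z : WL2 w E) (i : ℕ) : (y - z) i = y i - z i := rfl

@[simp] theorem smul_apply (c : ℝ) (z : WL2 w E) (i : ℕ) : (c • z) i = c • z i := rfl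

@[simp] theorem zero_apply (i : ℕ) : (0 : WL2 w E) i = 0 := rfl

@[ext] theorem ext {y z : WL2 w E} (h : ∀ i, y i = z i) : y = z := Subtype.ext (funext h)

theorem summable_norm_sq (z : WL2 w E) : Summable fun i => w ^ i * ‖z i‖ ^ 2 := z.2

theorem summable_inner (y z : WL2 w E) : Summable fun i => w ^ i * inner ℝ (y i) (z i) := by
  refine Summable.of_norm_bounded (y.summable_norm_sq.add z.summable_norm_sq) (fun i => ?_)
  have h2 : 0 < w ^ i := pow_pos hw.out i
  rw [norm_mul, Real.norm_of_nonneg h2.le, ← mul_add]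
  refine mul_le_mul_of_nonneg_left ?_ h2.le
  have := norm_inner_le_norm (𝕜 := ℝ) (y i) (z i)
  nlinarith [sq_nonneg (‖y i‖ - ‖z i‖), sq_nonneg (‖y i‖), sq_nonneg (‖z i‖)]

/-- The inner product `⟨y, z⟩ = ∑ wⁱ ⟨yᵢ, zᵢ⟩`. -/
noncomputable abbrev core : InnerProductSpace.Core ℝ (WL2 w E) where
  inner y z := ∑' i, w ^ i * inner ℝ (y i) (z i)
  conj_inner_symm y z := by
    simp [real_inner_comm]
  re_inner_nonneg z := by
    have := hw.out
    refine tsum_nonneg fun i => mul_nonneg (by positivity) ?_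
    exact real_inner_self_nonneg
  add_left x y z := by
    rw [← (summable_inner x z).tsum_add (summable_inner y z)]
    simp [inner_add_left, mul_add]
  smul_left x y r := by
    simp only [smul_apply, real_inner_smul_left, conj_trivial]
    rw [← tsum_mul_left]
    congr 1
    funext i
    ring
  definite z hz := by
    have h0 : ∀ i, 0 ≤ w ^ i * inner ℝ (z i) (z i) := fun i =>
      mul_nonneg (pow_pos hw.out i).le real_inner_self_nonneg
    have h := (hasSum_zero_iff_of_nonneg h0).1 (hz ▸ (summable_inner z z).hasSum)
    ext i
    have hi := congrFun h i
    have := (pow_pos hw.out i).ne'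
    simpa [this] using hi

noncomputable instance : NormedAddCommGroup (WL2 w E) :=
  @InnerProductSpace.Core.toNormedAddCommGroup ℝ (WL2 w E) _ _ _ core

noncomputable instance : InnerProductSpace ℝ (WL2 w E) := InnerProductSpace.ofCore core.toCore

theorem inner_eq (y z : WL2 w E) : inner ℝ y z = ∑' i, w ^ i * inner ℝ (y i) (z i) := rfl

theorem norm_sq_eq (z : WL2 w E) : ‖z‖ ^ 2 = ∑' i, w ^ i * ‖z i‖ ^ 2 := by
  rw [← real_inner_self_eq_norm_sq, inner_eq]
  simp

/-- `z ↦ (√w ⁱ zᵢ)ᵢ` identifies `ℓ²_w(E)` with the unweighted space `ℓ²(E)`. -/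
noncomputable def equivLp : WL2 w E ≃ₗᵢ[ℝ] lp (fun _ : ℕ => E) 2 where
  toFun z := ⟨fun i => (√w) ^ i • z i, by
    refine (memℓp_gen_iff (by norm_num)).2 (z.summable_norm_sq.congr fun i => ?_)
    have h := Real.sqrt_nonneg w
    simp only [norm_smul, norm_pow, Real.norm_of_nonneg h, ENNReal.toReal_ofNat, Real.rpow_two]
    rw [mul_pow, ← pow_mul, mul_comm i 2, pow_mul, Real.sq_sqrt hw.out.le]⟩
  map_add' y z := by
    ext i
    exact smul_add _ _ _
  map_smul' c z := by
    ext i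
    exact smul_comm _ _ _
  invFun v := mk (fun i => ((√w) ^ i)⁻¹ • v i) (by
    have h := (memℓp_gen_iff (by norm_num)).1 v.2
    refine h.congr fun i => ?_
    have h := Real.sqrt_pos.2 hw.out
    simp only [norm_smul, norm_inv, norm_pow, Real.norm_of_nonneg h.le, ENNReal.toReal_ofNat,
      Real.rpow_two]
    rw [mul_pow, inv_pow, ← pow_mul, mul_comm i 2, pow_mul, Real.sq_sqrt hw.out.le, ← mul_assoc,
      mul_inv_cancel₀ (pow_pos hw.out i).ne', one_mul])
  left_inv z := by
    ext i
    have h := (pow_pos (Real.sqrt_pos.2 hw.out) i).ne'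
    simp [smul_smul, h]
  right_inv v := by
    ext i
    have h := (pow_pos (Real.sqrt_pos.2 hw.out) i).ne'
    simp [smul_smul, h]
  norm_map' z := by
    have h : ∀ v : lp (fun _ : ℕ => E) 2, ‖v‖ ^ 2 = ∑' i, ‖v i‖ ^ 2 := fun v => by
      rw [← real_inner_self_eq_norm_sq, lp.inner_eq_tsum]
      simp
    rw [← sq_eq_sq₀ (norm_nonneg _) (norm_nonneg _), h, norm_sq_eq]
    refine tsum_congr fun i => ?_
    have h := Real.sqrt_nonneg w
    simp only [LinearEquiv.coe_mk, LinearMap.coe_mk, AddHom.coe_mk, norm_smul, norm_pow,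
      Real.norm_of_nonneg h]
    rw [mul_pow, ← pow_mul, mul_comm i 2, pow_mul, Real.sq_sqrt hw.out.le]

instance [CompleteSpace E] : CompleteSpace (WL2 w E) :=
  (equivLp (w := w) (E := E)).toIsometryEquiv.completeSpace

variable {F : Type*} [NormedAddCommGroup F] [InnerProductSpace ℝ F]

/-- The block-diagonal operator `diag(M, M, …)`. -/
noncomputable def diag (M : E →L[ℝ] F) : WL2 w E →L[ℝ] WL2 w F :=
  LinearMap.mkContinuousOfExistsBound
    { toFun := fun z => mk (fun i => M (z i)) (by
        refine Summable.of_nonneg_of_le (fun i => ?_) (fun i => ?_)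
          (z.summable_norm_sq.mul_left (‖M‖ ^ 2))
        · have := hw.out
          positivity
        · have h2 : 0 < w ^ i := pow_pos hw.out i
          have h3 := pow_le_pow_left₀ (norm_nonneg _) (M.le_opNorm (z i)) 2
          rw [mul_pow] at h3
          nlinarith [mul_le_mul_of_nonneg_left h3 h2.le])
      map_add' := fun y z => by
        ext i
        simp
      map_smul' := fun c z => by
        ext i
        simp }
    ⟨‖M‖, fun z => by
      refine le_of_sq_le_sq ?_ (by positivity)
      rw [mul_pow, norm_sq_eq, norm_sq_eq, ← tsum_mul_left]
      refine Summable.tsum_le_tsum (fun i => ?_) (summable_norm_sq _)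
        (z.summable_norm_sq.mul_left (‖M‖ ^ 2))
      have h2 : 0 < w ^ i := pow_pos hw.out i
      have h3 := pow_le_pow_left₀ (norm_nonneg _) (M.le_opNorm (z i)) 2
      rw [mul_pow] at h3
      simp only [LinearMap.coe_mk, AddHom.coe_mk, mk_apply]
      nlinarith [mul_le_mul_of_nonneg_left h3 h2.le]⟩

@[simp] theorem diag_apply (M : E →L[ℝ] F) (z : WL2 w E) (i : ℕ) : diag M z i = M (z i) := rfl

/-- The componentwise clipping `min {z, 0}`. -/
noncomputable def clip {ι : Type*} [Fintype ι] (z : WL2 w (EuclideanSpace ℝ ι)) :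
    WL2 w (EuclideanSpace ℝ ι) :=
  mk (fun i => WithLp.toLp 2 fun j => min (z i j) 0) (by
    refine Summable.of_nonneg_of_le (fun i => ?_) (fun i => ?_) z.summable_norm_sq
    · have := hw.out
      positivity
    · refine mul_le_mul_of_nonneg_left ?_ (pow_pos hw.out i).le
      rw [EuclideanSpace.norm_sq_eq, EuclideanSpace.norm_sq_eq]
      refine Finset.sum_le_sum fun j _ => ?_
      simp only [Real.norm_eq_abs, sq_abs]
      rcases le_total (z i j) 0 with h | h
      · simp [h]
      · simp [h])

end WL2

end WeightedL2

/-! ### Matrices acting on Euclidean spaces -/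

section Matrices

/-- The linear map `x ↦ M x` between Euclidean spaces. -/
noncomputable def Matrix.toE {ι κ : Type*} [Fintype ι] [Fintype κ] [DecidableEq κ]
    (M : Matrix ι κ ℝ) : EuclideanSpace ℝ κ →L[ℝ] EuclideanSpace ℝ ι :=
  (Matrix.toEuclideanLin M).toContinuousLinearMap

theorem Matrix.toE_apply {ι κ : Type*} [Fintype ι] [Fintype κ] [DecidableEq κ]
    (M : Matrix ι κ ℝ) (x : EuclideanSpace ℝ κ) (i : ι) : M.toE x i = (M *ᵥ x.ofLp) i := rfl

/-- `z` is a (complex) eigenvalue of the real square matrix `M`. -/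
def Matrix.IsComplexEigenvalue {n : ℕ} (M : Matrix (Fin n) (Fin n) ℝ) (z : ℂ) : Prop :=
  z ∈ spectrum ℂ (M.map (fun t : ℝ => (t : ℂ)))

/-- All eigenvalues lie in the open unit disc. -/
def Matrix.SchurStable {n : ℕ} (M : Matrix (Fin n) (Fin n) ℝ) : Prop :=
  ∀ z, M.IsComplexEigenvalue z → ‖z‖ < 1

/-- `(A, B)` is stabilizable. -/
def Stabilizable {n m : ℕ} (A : Matrix (Fin n) (Fin n) ℝ) (B : Matrix (Fin n) (Fin m) ℝ) : Prop :=
  ∃ K : Matrix (Fin m) (Fin n) ℝ, (A + B * K).SchurStable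

/-- `(A, D)` is detectable. For `Q` positive semidefinite, `(A, √Q)` is detectable if and only if
`(A, Q)` is, because `√Q` and `Q` have the same kernel. -/
def Detectable {n p : ℕ} (A : Matrix (Fin n) (Fin n) ℝ) (D : Matrix (Fin p) (Fin n) ℝ) : Prop :=
  ∃ J : Matrix (Fin n) (Fin p) ℝ, (A + J * D).SchurStable

/-- `w` is an admissible weight for `A`: it lies in `(0, 1)` and `w` times the squared
spectral radius of `A` is less than one. -/
structure AdmissibleWeight {n : ℕ} (A : Matrix (Fin n) (Fin n) ℝ) (w : ℝ) : Prop where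
  pos : 0 < w
  lt_one : w < 1
  spectral : ∀ z, A.IsComplexEigenvalue z → w * ‖z‖ ^ 2 < 1

attribute [local instance] Matrix.linftyOpNormedRing Matrix.linftyOpNormedAlgebra in
theorem AdmissibleWeight.exists_bound {n : ℕ} {A : Matrix (Fin n) (Fin n) ℝ} {w : ℝ}
    (h : AdmissibleWeight A w) :
    ∃ c r : ℝ, 0 ≤ c ∧ 0 ≤ r ∧ r < 1 ∧ ∀ k : ℕ, (√w) ^ k * ‖(A ^ k).toE‖ ≤ c * r ^ k := by
  set s : ℝ := √w with hs
  have hs0 : 0 < s := Real.sqrt_pos.2 h.pos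
  set N : Matrix (Fin n) (Fin n) ℂ := A.map (fun t : ℝ => (t : ℂ)) with hN
  set M : Matrix (Fin n) (Fin n) ℂ := (s : ℂ) • N with hM
  have : CompleteSpace (Matrix (Fin n) (Fin n) ℂ) := FiniteDimensional.complete ℂ _
  have hrad : spectralRadius ℂ M < 1 := by
    rcases (spectrum ℂ M).eq_empty_or_nonempty with he | hne
    · simp [spectralRadius, he]
    · refine spectrum.spectralRadius_lt_of_forall_lt_of_nonempty hne (r := 1) fun k hk => ?_
      have hs' : (s : ℂ) ≠ 0 := by exact_mod_cast hs0.ne'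
      have hk' : (s : ℂ)⁻¹ * k ∈ spectrum ℂ N := by
        have := (spectrum.smul_mem_smul_iff (R := ℂ) (s := (s : ℂ)⁻¹ * k) (a := N)
          (r := Units.mk0 (s : ℂ) hs')).1
        apply this
        rw [Units.smul_def, Units.smul_def, Units.val_mk0, smul_eq_mul, ← mul_assoc,
          mul_inv_cancel₀ hs', one_mul]
        exact hk
      have h1 := h.spectral _ hk'
      rw [norm_mul, norm_inv, Complex.norm_real, Real.norm_of_nonneg hs0.le, mul_pow, inv_pow,
        hs, Real.sq_sqrt h.pos.le, ← mul_assoc, mul_inv_cancel₀ h.pos.ne', one_mul] at h1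
      have h2 : ‖k‖ < 1 := by
        nlinarith [norm_nonneg k]
      exact_mod_cast h2
  obtain ⟨r, hr1, hr2⟩ := ENNReal.lt_iff_exists_nnreal_btwn.1 hrad
  have hr1' : r < 1 := by exact_mod_cast hr2
  have hev := (spectrum.pow_nnnorm_pow_one_div_tendsto_nhds_spectralRadius M).eventually_lt_const hr1
  obtain ⟨k0, hk0⟩ := Filter.eventually_atTop.1 hev
  have hpow : ∀ k, max k0 1 ≤ k → ‖M ^ k‖ ≤ (r : ℝ) ^ k := by
    intro k hk
    have h1 := hk0 k (le_trans (le_max_left _ _) hk)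
    have hkpos : k ≠ 0 := by
      have := le_trans (le_max_right k0 1) hk
      omega
    have h2 : (‖M ^ k‖₊ : ℝ≥0∞) ≤ (r : ℝ≥0∞) ^ k := by
      have h3 := ENNReal.rpow_le_rpow h1.le (z := (k : ℝ)) (by positivity)
      rw [← ENNReal.rpow_mul, one_div, inv_mul_cancel₀ (by exact_mod_cast hkpos),
        ENNReal.rpow_one, ENNReal.rpow_natCast] at h3
      exact h3
    exact_mod_cast h2
  -- passing from the complex matrix to the real operator
  let Φ : Matrix (Fin n) (Fin n) ℂ →ₗ[ℝ]
      (EuclideanSpace ℝ (Fin n) →L[ℝ] EuclideanSpace ℝ (Fin n)) :=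
    { toFun := fun X => (X.map Complex.re).toE
      map_add' := fun X Y => by
        ext x i
        simp [Matrix.toE_apply, Matrix.mulVec, dotProduct, add_mul, Finset.sum_add_distrib]
      map_smul' := fun c X => by
        ext x i
        simp [Matrix.toE_apply, Matrix.mulVec, dotProduct, mul_assoc, Finset.mul_sum] }
  obtain ⟨C, hC0, hC⟩ : ∃ C : ℝ, 0 ≤ C ∧ ∀ X, ‖Φ X‖ ≤ C * ‖X‖ :=
    ⟨_, norm_nonneg _, (LinearMap.toContinuousLinearMap Φ).le_opNorm⟩
  have hΨ : ∀ k, Φ (M ^ k) = s ^ k • (A ^ k).toE := by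
    intro k
    have h1 : M ^ k = (s ^ k : ℝ) • (A ^ k).map (fun t : ℝ => (t : ℂ)) := by
      have h2 : N ^ k = (A ^ k).map (fun t : ℝ => (t : ℂ)) :=
        (map_pow (Complex.ofRealHom.mapMatrix (m := Fin n)) A k).symm
      rw [hM, smul_pow, h2]
      ext i j
      simp
    rw [h1, map_smul]
    congr 1
  have hb : ∀ k, s ^ k * ‖(A ^ k).toE‖ ≤ C * ‖M ^ k‖ := by
    intro k
    have h1 := hC (M ^ k)
    rwa [hΨ, norm_smul, norm_pow, Real.norm_of_nonneg hs0.le] at h1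
  set k1 := max k0 1
  -- enlarging `r` so that it is positive
  set q : ℝ := max (r : ℝ) (1 / 2) with hq
  have hq0 : 0 < q := lt_of_lt_of_le (by norm_num) (le_max_right _ _)
  have hq1 : q < 1 := max_lt (by exact_mod_cast hr1') (by norm_num)
  have hMb : ∀ k, ‖M ^ k‖ ≤ (1 + ∑ j ∈ Finset.range k1, ‖M ^ j‖ / q ^ j) * q ^ k := by
    intro k
    have hnn : ∀ j ∈ Finset.range k1, 0 ≤ ‖M ^ j‖ / q ^ j := fun j _ => by positivity
    rcases lt_or_ge k k1 with hk | hk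
    · have h1 := Finset.single_le_sum hnn (Finset.mem_range.2 hk)
      have h2 : ‖M ^ k‖ = ‖M ^ k‖ / q ^ k * q ^ k := by
        field_simp
      rw [h2]
      refine mul_le_mul_of_nonneg_right ?_ (by positivity)
      linarith
    · have h1 := hpow k hk
      have h2 : (r : ℝ) ^ k ≤ q ^ k := pow_le_pow_left₀ r.2 (le_max_left _ _) k
      have h3 := Finset.sum_nonneg hnn
      have h4 : 0 ≤ q ^ k := by positivity
      nlinarith
  refine ⟨C * (1 + ∑ j ∈ Finset.range k1, ‖M ^ j‖ / q ^ j), q, ?_, hq0.le, hq1, fun k => ?_⟩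
  · have : 0 ≤ ∑ j ∈ Finset.range k1, ‖M ^ j‖ / q ^ j := Finset.sum_nonneg fun j _ => by positivity
    positivity
  · refine (hb k).trans ?_
    rw [mul_assoc]
    exact mul_le_mul_of_nonneg_left (hMb k) hC0

end Matrices

/-! ### The constrained linear quadratic regulation problem -/

/-- The data of a CLQR problem: dynamics `x⁺ = A x + B u`, stage cost `½ (xᵀ Q x + uᵀ R u)`,
constraints `Cx x ≤ cx` and `Cu u ≤ cu`, and the initial state. -/
structure CLQR (n m px pu : ℕ) where
  A : Matrix (Fin n) (Fin n) ℝ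
  B : Matrix (Fin n) (Fin m) ℝ
  Q : Matrix (Fin n) (Fin n) ℝ
  R : Matrix (Fin m) (Fin m) ℝ
  Cx : Matrix (Fin px) (Fin n) ℝ
  cx : Fin px → ℝ
  Cu : Matrix (Fin pu) (Fin m) ℝ
  cu : Fin pu → ℝ
  xinit : EuclideanSpace ℝ (Fin n)

namespace CLQR

variable {n m px pu : ℕ} (P : CLQR n m px pu)

/-- The state trajectory `x₀ = xinit`, `xᵢ₊₁ = A xᵢ + B uᵢ`. -/
noncomputable def traj (u : ℕ → EuclideanSpace ℝ (Fin m)) : ℕ → EuclideanSpace ℝ (Fin n)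
  | 0 => P.xinit
  | i + 1 => P.A.toE (traj u i) + P.B.toE (u i)

/-- The stage cost `½ (xᵀ Q x + uᵀ R u)`. -/
noncomputable def stageCost (x : EuclideanSpace ℝ (Fin n)) (u : EuclideanSpace ℝ (Fin m)) : ℝ :=
  (1 / 2) * (inner ℝ x (P.Q.toE x) + inner ℝ u (P.R.toE u))

/-- The infinite-horizon cost `½ ∑ (xᵢᵀ Q xᵢ + uᵢᵀ R uᵢ) ∈ [0, ∞]` of an input sequence. -/
noncomputable def cost (u : ℕ → EuclideanSpace ℝ (Fin m)) : ℝ≥0∞ :=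
  ∑' i, ENNReal.ofReal (P.stageCost (P.traj u i) (u i))

/-- The input sequence and its state trajectory satisfy all the constraints. -/
def Feasible (u : ℕ → EuclideanSpace ℝ (Fin m)) : Prop :=
  ∀ i, (∀ j, P.Cx.toE (P.traj u i) j ≤ P.cx j) ∧ ∀ j, P.Cu.toE (u i) j ≤ P.cu j

/-- The optimal value of the CLQR problem. -/
noncomputable def value : ℝ≥0∞ :=
  ⨅ u : {u : ℕ → EuclideanSpace ℝ (Fin m) // P.Feasible u}, P.cost u.1

/-- `u` is an optimal input sequence of the CLQR problem. -/
def IsOptimal (u : ℕ → EuclideanSpace ℝ (Fin m)) : Prop :=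
  P.Feasible u ∧ ∀ v, P.Feasible v → P.cost u ≤ P.cost v

/-- The standing assumptions on the problem data. -/
structure StandingAssumption : Prop where
  stabilizable : Stabilizable P.A P.B
  value_finite : P.value ≠ ⊤
  origin_interior :
    (0 : EuclideanSpace ℝ (Fin n)) ∈ interior {x | ∀ j, P.Cx.toE x j ≤ P.cx j}
  rank_Cu : P.Cu.rank = m
  Q_psd : P.Q.PosSemidef
  R_posDef : P.R.PosDef

/-- `Plq` is a positive semidefinite solution of the discrete-time algebraic Riccati equation
and `K` is the corresponding state feedback matrix, `u = K x`. -/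
structure IsLQSolution (Plq : Matrix (Fin n) (Fin n) ℝ) (K : Matrix (Fin m) (Fin n) ℝ) : Prop where
  posSemidef : Plq.PosSemidef
  riccati : Plq = P.Q + P.Aᵀ * Plq * P.A -
    P.Aᵀ * Plq * P.B * (P.R + P.Bᵀ * Plq * P.B)⁻¹ * (P.Bᵀ * Plq * P.A)
  gain : K = -((P.R + P.Bᵀ * Plq * P.B)⁻¹ * (P.Bᵀ * Plq * P.A))

/-- The maximal positively invariant set of `x⁺ = (A + B K) x` subject to `Cx x ≤ cx` and
`Cu K x ≤ cu`. -/
def maxInvariantSet (K : Matrix (Fin m) (Fin n) ℝ) : Set (EuclideanSpace ℝ (Fin n)) :=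
  {x | ∀ i : ℕ, (∀ j, P.Cx.toE (((P.A + P.B * K) ^ i).toE x) j ≤ P.cx j) ∧
    ∀ j, P.Cu.toE (K.toE (((P.A + P.B * K) ^ i).toE x)) j ≤ P.cu j}

/-! ### The operators of the condensed problem -/

section Operators

variable {w : ℝ} [hw0 : Fact (0 < w)]

theorem summable_conv {P : CLQR n m px pu} (hw : AdmissibleWeight P.A w) :
    ∃ c : ℝ, 0 ≤ c ∧ ∀ u : WL2 w (EuclideanSpace ℝ (Fin m)),
      (Summable fun i => w ^ i *
        ‖∑ j ∈ Finset.range (i + 1), (P.A ^ (i - j)).toE (P.B.toE (u j))‖ ^ 2) ∧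
      ∑' i, w ^ i * ‖∑ j ∈ Finset.range (i + 1), (P.A ^ (i - j)).toE (P.B.toE (u j))‖ ^ 2
        ≤ c ^ 2 * ‖u‖ ^ 2 := by
  obtain ⟨c, r, hc, hr, hr1, hb⟩ := hw.exists_bound
  set b := ‖P.B.toE‖ with hbdef
  have hs0 : 0 < √w := Real.sqrt_pos.2 hw.pos
  have hpw : ∀ i : ℕ, w ^ i = ((√w) ^ i) ^ 2 := fun i => by
    rw [← pow_mul, mul_comm i 2, pow_mul, Real.sq_sqrt hw.pos.le]
  have hgeo : Summable fun k : ℕ => ‖r ^ k‖ := by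
    simpa [Real.norm_of_nonneg (pow_nonneg hr _), abs_of_nonneg hr] using
      summable_geometric_of_lt_one hr hr1
  have hS : ∀ i : ℕ, ∑ j ∈ Finset.range (i + 1), r ^ (i - j) ≤ (1 - r)⁻¹ := by
    intro i
    have h1 := Finset.sum_range_reflect (fun k => r ^ k) (i + 1)
    simp only [Nat.add_sub_cancel] at h1
    rw [h1, ← tsum_geometric_of_lt_one hr hr1]
    exact (summable_geometric_of_lt_one hr hr1).sum_le_tsum _ fun k _ => pow_nonneg hr k
  have h1r : 0 < 1 - r := by linarith
  refine ⟨c * b * (1 - r)⁻¹, by positivity, fun u => ?_⟩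
  set f : ℕ → ℝ := fun j => w ^ j * ‖u j‖ ^ 2 with hf
  have hf0 : ∀ j, 0 ≤ f j := fun j => mul_nonneg (pow_nonneg hw.pos.le j) (sq_nonneg _)
  have hfs : Summable fun j => ‖f j‖ := u.summable_norm_sq.norm
  have hprod := tsum_mul_tsum_eq_tsum_sum_range_of_summable_norm hfs hgeo
  have hsum := (summable_norm_sum_mul_range_of_summable_norm hfs hgeo).of_norm
  have hpt : ∀ i, w ^ i *
      ‖∑ j ∈ Finset.range (i + 1), (P.A ^ (i - j)).toE (P.B.toE (u j))‖ ^ 2 ≤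
      (c * b) ^ 2 * (1 - r)⁻¹ * ∑ j ∈ Finset.range (i + 1), f j * r ^ (i - j) := by
    intro i
    have e1 : (√w) ^ i * ‖∑ j ∈ Finset.range (i + 1), (P.A ^ (i - j)).toE (P.B.toE (u j))‖ ≤
        c * b * ∑ j ∈ Finset.range (i + 1), r ^ (i - j) * ((√w) ^ j * ‖u j‖) := by
      refine (mul_le_mul_of_nonneg_left (norm_sum_le _ _) (by positivity)).trans ?_
      rw [Finset.mul_sum, Finset.mul_sum]
      refine Finset.sum_le_sum fun j hj => ?_
      have hji : j ≤ i := by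
        have := Finset.mem_range.1 hj
        omega
      have e2 : ‖(P.A ^ (i - j)).toE (P.B.toE (u j))‖ ≤ ‖(P.A ^ (i - j)).toE‖ * (b * ‖u j‖) :=
        ((P.A ^ (i - j)).toE.le_opNorm _).trans
          (mul_le_mul_of_nonneg_left (P.B.toE.le_opNorm _) (norm_nonneg _))
      have e3 : (√w) ^ i = (√w) ^ (i - j) * (√w) ^ j := by
        rw [← pow_add, Nat.sub_add_cancel hji]
      calc (√w) ^ i * ‖(P.A ^ (i - j)).toE (P.B.toE (u j))‖
          ≤ (√w) ^ i * (‖(P.A ^ (i - j)).toE‖ * (b * ‖u j‖)) :=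
            mul_le_mul_of_nonneg_left e2 (by positivity)
        _ = ((√w) ^ (i - j) * ‖(P.A ^ (i - j)).toE‖) * (b * ((√w) ^ j * ‖u j‖)) := by
            rw [e3]
            ring
        _ ≤ (c * r ^ (i - j)) * (b * ((√w) ^ j * ‖u j‖)) :=
            mul_le_mul_of_nonneg_right (hb _) (by positivity)
        _ = c * b * (r ^ (i - j) * ((√w) ^ j * ‖u j‖)) := by ring
    have e4 : (∑ j ∈ Finset.range (i + 1), r ^ (i - j) * ((√w) ^ j * ‖u j‖)) ^ 2 ≤
        (∑ j ∈ Finset.range (i + 1), r ^ (i - j)) *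
          ∑ j ∈ Finset.range (i + 1), f j * r ^ (i - j) := by
      refine Finset.sum_sq_le_sum_mul_sum_of_sq_le_mul _ (fun j _ => pow_nonneg hr _)
        (fun j _ => mul_nonneg (hf0 j) (pow_nonneg hr _)) fun j _ => le_of_eq ?_
      simp only [hf, hpw j]
      ring
    have e5 : 0 ≤ ∑ j ∈ Finset.range (i + 1), f j * r ^ (i - j) :=
      Finset.sum_nonneg fun j _ => mul_nonneg (hf0 j) (pow_nonneg hr _)
    calc w ^ i * ‖∑ j ∈ Finset.range (i + 1), (P.A ^ (i - j)).toE (P.B.toE (u j))‖ ^ 2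
        = ((√w) ^ i * ‖∑ j ∈ Finset.range (i + 1), (P.A ^ (i - j)).toE (P.B.toE (u j))‖) ^ 2 := by
          rw [hpw i, mul_pow]
      _ ≤ (c * b * ∑ j ∈ Finset.range (i + 1), r ^ (i - j) * ((√w) ^ j * ‖u j‖)) ^ 2 :=
          pow_le_pow_left₀ (by positivity) e1 2
      _ = (c * b) ^ 2 * (∑ j ∈ Finset.range (i + 1), r ^ (i - j) * ((√w) ^ j * ‖u j‖)) ^ 2 := by
          ring
      _ ≤ (c * b) ^ 2 * ((∑ j ∈ Finset.range (i + 1), r ^ (i - j)) *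
          ∑ j ∈ Finset.range (i + 1), f j * r ^ (i - j)) :=
          mul_le_mul_of_nonneg_left e4 (sq_nonneg _)
      _ ≤ (c * b) ^ 2 * ((1 - r)⁻¹ * ∑ j ∈ Finset.range (i + 1), f j * r ^ (i - j)) :=
          mul_le_mul_of_nonneg_left (mul_le_mul_of_nonneg_right (hS i) e5) (sq_nonneg _)
      _ = _ := by ring
  have hs : Summable fun i => w ^ i *
      ‖∑ j ∈ Finset.range (i + 1), (P.A ^ (i - j)).toE (P.B.toE (u j))‖ ^ 2 :=
    Summable.of_nonneg_of_le (fun i => mul_nonneg (pow_nonneg hw.pos.le i) (sq_nonneg _)) hpt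
      (hsum.mul_left _)
  refine ⟨hs, (hs.tsum_le_tsum hpt (hsum.mul_left _)).trans (le_of_eq ?_)⟩
  rw [tsum_mul_left, ← hprod, tsum_geometric_of_lt_one hr hr1, WL2.norm_sq_eq]
  ring

/-- The operator `𝐁`: `(𝐁 u)ᵢ = ∑_{j ≤ i} A^{i-j} B uⱼ`, mapping inputs `(u₀, u₁, …)` to the
forced response in the states `(x₁, x₂, …)`. -/
noncomputable def opB (hw : AdmissibleWeight P.A w) :
    WL2 w (EuclideanSpace ℝ (Fin m)) →L[ℝ] WL2 w (EuclideanSpace ℝ (Fin n)) :=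
  LinearMap.mkContinuousOfExistsBound
    { toFun := fun u =>
        WL2.mk (fun i => ∑ j ∈ Finset.range (i + 1), (P.A ^ (i - j)).toE (P.B.toE (u j)))
          ((summable_conv hw).choose_spec.2 u).1
      map_add' := fun u v => by
        ext i
        simp [Finset.sum_add_distrib]
      map_smul' := fun c u => by
        ext i
        simp [Finset.mul_sum] }
    (by
      obtain ⟨c, hc, h⟩ := summable_conv hw
      refine ⟨c, fun u => le_of_sq_le_sq ?_ (by positivity)⟩
      rw [mul_pow, WL2.norm_sq_eq]
      exact (h u).2)

theorem opB_apply (hw : AdmissibleWeight P.A w) (u : WL2 w (EuclideanSpace ℝ (Fin m))) (i : ℕ) :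
    P.opB hw u i = ∑ j ∈ Finset.range (i + 1), (P.A ^ (i - j)).toE (P.B.toE (u j)) := rfl

/-- The free response `𝐀 xinit = (A xinit, A² xinit, …)`. -/
noncomputable def freeResponse (hw : AdmissibleWeight P.A w) :
    WL2 w (EuclideanSpace ℝ (Fin n)) :=
  WL2.mk (fun i => (P.A ^ (i + 1)).toE P.xinit) (by
    obtain ⟨c, r, hc, hr, hr1, hb⟩ := hw.exists_bound
    have hr2 : r ^ 2 < 1 := by nlinarith
    refine Summable.of_nonneg_of_le
      (fun i => mul_nonneg (pow_nonneg hw.pos.le i) (sq_nonneg _)) (fun i => ?_)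
      ((summable_geometric_of_lt_one (sq_nonneg r) hr2).mul_left
        (w⁻¹ * (c * r * ‖P.xinit‖) ^ 2))
    have hpw : w * w ^ i = ((√w) ^ (i + 1)) ^ 2 := by
      rw [← pow_mul, mul_comm (i + 1) 2, pow_mul, Real.sq_sqrt hw.pos.le, pow_succ]
      ring
    have h1 : (√w) ^ (i + 1) * ‖(P.A ^ (i + 1)).toE P.xinit‖ ≤ c * r ^ (i + 1) * ‖P.xinit‖ := by
      refine (mul_le_mul_of_nonneg_left ((P.A ^ (i + 1)).toE.le_opNorm _) (by positivity)).trans ?_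
      rw [← mul_assoc]
      exact mul_le_mul_of_nonneg_right (hb _) (norm_nonneg _)
    have h2 := pow_le_pow_left₀ (by positivity) h1 2
    rw [mul_pow, ← hpw] at h2
    have h3 := mul_le_mul_of_nonneg_left h2 (inv_nonneg.2 hw.pos.le)
    rw [← mul_assoc, ← mul_assoc, inv_mul_cancel₀ hw.pos.ne', one_mul] at h3
    refine h3.trans (le_of_eq ?_)
    ring)

/-- The state sequence `𝐀 xinit + 𝐁 u = (x₁, x₂, …)` of an input sequence in `ℓ²_w`. -/
noncomputable def stateSeq (hw : AdmissibleWeight P.A w)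
    (u : WL2 w (EuclideanSpace ℝ (Fin m))) : WL2 w (EuclideanSpace ℝ (Fin n)) :=
  P.freeResponse hw + P.opB hw u

theorem stateSeq_apply (hw : AdmissibleWeight P.A w) (u : WL2 w (EuclideanSpace ℝ (Fin m)))
    (i : ℕ) : P.stateSeq hw u i = P.traj u (i + 1) := by
  have hmul : ∀ (k : ℕ) (x : EuclideanSpace ℝ (Fin n)),
      P.A.toE ((P.A ^ k).toE x) = (P.A ^ (k + 1)).toE x := by
    intro k x
    ext j
    rw [Matrix.toE_apply, Matrix.toE_apply, pow_succ', ← Matrix.mulVec_mulVec]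
    rfl
  have hone : ∀ x : EuclideanSpace ℝ (Fin n), (P.A ^ 0).toE x = x := by
    intro x
    ext j
    rw [Matrix.toE_apply, pow_zero, Matrix.one_mulVec]
  induction i with
  | zero =>
    simp only [stateSeq, WL2.add_apply, opB_apply, freeResponse, WL2.mk_apply, traj, zero_add,
      Finset.sum_range_one, Nat.sub_self, hone, pow_one]
  | succ i ih =>
    rw [traj, ← ih]
    simp only [stateSeq, WL2.add_apply, opB_apply, freeResponse, WL2.mk_apply, map_add, map_sum,
      hmul]
    rw [Finset.sum_range_succ _ (i + 1), Nat.sub_self, hone, ← add_assoc]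
    congr 2
    refine Finset.sum_congr rfl fun j hj => ?_
    have := Finset.mem_range.1 hj
    rw [Nat.sub_add_comm (by omega)]

/-- The operator `𝐂`, whose `i`-th block row maps `u` to `(Cu uᵢ, Cx (𝐁 u)ᵢ)`. -/
noncomputable def opC (hw : AdmissibleWeight P.A w) :
    WL2 w (EuclideanSpace ℝ (Fin m)) →L[ℝ] WL2 w (EuclideanSpace ℝ (Fin pu ⊕ Fin px)) :=
  WL2.diag (Matrix.fromRows P.Cu (0 : Matrix (Fin px) (Fin m) ℝ)).toE +
    WL2.diag (Matrix.fromRows (0 : Matrix (Fin pu) (Fin n) ℝ) P.Cx).toE ∘L P.opB hw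

theorem opC_apply_inl (hw : AdmissibleWeight P.A w) (u : WL2 w (EuclideanSpace ℝ (Fin m)))
    (i : ℕ) (j : Fin pu) : P.opC hw u i (Sum.inl j) = P.Cu.toE (u i) j := by
  simp [opC, Matrix.toE_apply, Matrix.fromRows_mulVec]

theorem opC_apply_inr (hw : AdmissibleWeight P.A w) (u : WL2 w (EuclideanSpace ℝ (Fin m)))
    (i : ℕ) (j : Fin px) : P.opC hw u i (Sum.inr j) = P.Cx.toE (P.opB hw u i) j := by
  simp [opC, Matrix.toE_apply, Matrix.fromRows_mulVec]

/-- The right-hand side `𝐜`, with blocks `cᵢ = (cu, cx - Cx A^{i+1} xinit)`. -/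
noncomputable def vecC (hw : AdmissibleWeight P.A w) :
    WL2 w (EuclideanSpace ℝ (Fin pu ⊕ Fin px)) :=
  WL2.mk (fun _ => WithLp.toLp 2 (Sum.elim P.cu P.cx))
      ((summable_geometric_of_lt_one hw.pos.le hw.lt_one).mul_right _) -
    WL2.diag (Matrix.fromRows (0 : Matrix (Fin pu) (Fin n) ℝ) P.Cx).toE (P.freeResponse hw)

/-! ### The dual problem -/

/-- The objective `f` of the condensed primal problem: the cost as a function of the input
sequence in `ℓ²_w`, with values in `[0, ∞]`. -/
noncomputable def objective (u : WL2 w (EuclideanSpace ℝ (Fin m))) : ℝ≥0∞ := P.cost u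

/-- `f` is strongly convex with modulus `μ` on `ℓ²_w`. -/
def IsStrongConvexityModulus (w : ℝ) [Fact (0 < w)] (μ : ℝ) : Prop :=
  StrongConvexOn {u : WL2 w (EuclideanSpace ℝ (Fin m)) | P.objective u ≠ ⊤} μ
    fun u => (P.objective u).toReal

/-- The Fenchel conjugate `f⋆(y) = sup_u (⟨y, u⟩ - f(u))`. -/
noncomputable def conjObjective (y : WL2 w (EuclideanSpace ℝ (Fin m))) : EReal :=
  ⨆ u : WL2 w (EuclideanSpace ℝ (Fin m)), ((inner ℝ y u : ℝ) : EReal) - (P.objective u : EReal)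

/-- `h⋆(λ) = f⋆(𝐂⋆ λ) - ⟨λ, 𝐜⟩` as an extended real number. -/
noncomputable def hStarE (hw : AdmissibleWeight P.A w)
    (l : WL2 w (EuclideanSpace ℝ (Fin pu ⊕ Fin px))) : EReal :=
  P.conjObjective (ContinuousLinearMap.adjoint (P.opC hw) l) -
    ((inner ℝ l (P.vecC hw) : ℝ) : EReal)

/-- `h⋆` as a real-valued function. -/
noncomputable def hStar (hw : AdmissibleWeight P.A w)
    (l : WL2 w (EuclideanSpace ℝ (Fin pu ⊕ Fin px))) : ℝ :=
  (P.hStarE hw l).toReal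

open Classical in
/-- The dual objective `F = h⋆ + δ₋`, with `δ₋` the indicator of the nonpositive orthant. -/
noncomputable def dualObjective (hw : AdmissibleWeight P.A w)
    (l : WL2 w (EuclideanSpace ℝ (Fin pu ⊕ Fin px))) : EReal :=
  if ∀ i j, l i j ≤ 0 then P.hStarE hw l else ⊤

/-- `l` minimizes the dual objective `F`. -/
def IsDualOptimal (hw : AdmissibleWeight P.A w)
    (l : WL2 w (EuclideanSpace ℝ (Fin pu ⊕ Fin px))) : Prop :=
  ∀ l', P.dualObjective hw l ≤ P.dualObjective hw l'

/-! ### The accelerated forward-backward splitting iteration -/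

/-- The extrapolation factors `α⁰ = 0`, `αᵏ = (k - 1) / (k + a)` for `k ≥ 1`. -/
noncomputable def alpha (a : ℝ) (k : ℕ) : ℝ := if k = 0 then 0 else ((k : ℝ) - 1) / (k + a)

/-- The pairs `(λᵏ, λᵏ⁻¹)` of the AFBS iteration
`λ̂ᵏ = λᵏ + αᵏ (λᵏ - λᵏ⁻¹)`, `λᵏ⁺¹ = min {λ̂ᵏ - (1/L) ∇h⋆(λ̂ᵏ), 0}`, started at `λ⁰ = 0`
(with the immaterial convention `λ⁻¹ = 0`). -/
noncomputable def dualPair (hw : AdmissibleWeight P.A w) (a L : ℝ) :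
    ℕ → WL2 w (EuclideanSpace ℝ (Fin pu ⊕ Fin px)) × WL2 w (EuclideanSpace ℝ (Fin pu ⊕ Fin px))
  | 0 => (0, 0)
  | k + 1 =>
    let l := (dualPair hw a L k).1
    let lhat := l + alpha a k • (l - (dualPair hw a L k).2)
    (WL2.clip (lhat - (1 / L) • gradient (P.hStar hw) lhat), l)

/-- The dual iterates `λᵏ`. -/
noncomputable def dualIter (hw : AdmissibleWeight P.A w) (a L : ℝ) (k : ℕ) :
    WL2 w (EuclideanSpace ℝ (Fin pu ⊕ Fin px)) :=
  (P.dualPair hw a L k).1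

/-- The extrapolated dual iterates `λ̂ᵏ`. -/
noncomputable def dualHat (hw : AdmissibleWeight P.A w) (a L : ℝ) (k : ℕ) :
    WL2 w (EuclideanSpace ℝ (Fin pu ⊕ Fin px)) :=
  P.dualIter hw a L k + alpha a k • (P.dualIter hw a L k - (P.dualPair hw a L k).2)

/-! ### Primal sequences and truncation horizons -/

/-- The Lagrangian truncated at the horizon `T`, with terminal cost `½ x_Tᵀ Plq x_T`. The block
`λᵢ` is paired, with weight `wⁱ`, with the constraints `Cu uᵢ ≤ cu` and `Cx xᵢ₊₁ ≤ cx`. -/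
noncomputable def truncLagrangian (Plq : Matrix (Fin n) (Fin n) ℝ)
    (l : WL2 w (EuclideanSpace ℝ (Fin pu ⊕ Fin px))) (T : ℕ)
    (u : ℕ → EuclideanSpace ℝ (Fin m)) : ℝ :=
  (1 / 2) * inner ℝ (P.traj u T) (Plq.toE (P.traj u T)) +
    ∑ i ∈ Finset.range T, (P.stageCost (P.traj u i) (u i) -
      w ^ i * (∑ j, l i (Sum.inl j) * (P.Cu.toE (u i) j - P.cu j) +
        ∑ j, l i (Sum.inr j) * (P.Cx.toE (P.traj u (i + 1)) j - P.cx j)))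

/-- `u` is the input sequence associated with the multiplier `λ` and the horizon `T`: it minimizes
the truncated Lagrangian and follows the LQ feedback from time `T` on, so that
`xᵢ = (A + B K)^{i-T} x_T` for `i > T`. -/
def IsPrimalOf (Plq : Matrix (Fin n) (Fin n) ℝ) (K : Matrix (Fin m) (Fin n) ℝ)
    (l : WL2 w (EuclideanSpace ℝ (Fin pu ⊕ Fin px))) (T : ℕ)
    (u : ℕ → EuclideanSpace ℝ (Fin m)) : Prop :=
  (∀ v, P.truncLagrangian Plq l T u ≤ P.truncLagrangian Plq l T v) ∧
    ∀ i, T ≤ i → u i = K.toE (P.traj u i)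

/-- The candidates for the next horizon: the times `T' ≥ T` for which there is a time `TS ≥ T'`
such that the trajectory associated with `(λ, T)` lies in `S` at time `TS` and satisfies
`Cx xᵢ₊₁ ◁ cx` and `Cu uᵢ ◁ cu` for all `i ∈ {T', …, TS}`, where `◁` is `≤` or `<`. -/
def horizonCandidates (cmp : ℝ → ℝ → Prop) (Plq : Matrix (Fin n) (Fin n) ℝ)
    (K : Matrix (Fin m) (Fin n) ℝ) (S : Set (EuclideanSpace ℝ (Fin n)))
    (l : WL2 w (EuclideanSpace ℝ (Fin pu ⊕ Fin px))) (T : ℕ) : Set ℕ :=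
  {T' | T ≤ T' ∧ ∃ u, P.IsPrimalOf Plq K l T u ∧ ∃ TS, T' ≤ TS ∧ P.traj u TS ∈ S ∧
    ∀ i, T' ≤ i → i ≤ TS → (∀ j, cmp (P.Cx.toE (P.traj u (i + 1)) j) (P.cx j)) ∧
      ∀ j, cmp (P.Cu.toE (u i) j) (P.cu j)}

/-- The truncation horizons: `T⁰ = 0`, and `Tᵏ⁺¹` is the least candidate determined by
`λ̂ᵏ` and `Tᵏ`. -/
noncomputable def horizon (cmp : ℝ → ℝ → Prop) (Plq : Matrix (Fin n) (Fin n) ℝ)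
    (K : Matrix (Fin m) (Fin n) ℝ) (S : Set (EuclideanSpace ℝ (Fin n)))
    (hw : AdmissibleWeight P.A w) (a L : ℝ) : ℕ → ℕ
  | 0 => 0
  | k + 1 => sInf (P.horizonCandidates cmp Plq K S (P.dualHat hw a L k)
      (horizon cmp Plq K S hw a L k))

end Operators

end CLQR

/-!
Completing the square in the Riccati equation turns the cost of a stabilizing input `u` with states
`x` into `½ ‖v‖²` plus a constant, where `v = N (u - K x)` is the scaled deviation from the LQ
feedback. The problem becomes the minimization of `½ ‖v‖²` over square summable `v` subject to
`D v + d ≤ 0`, and `h⋆` becomes `½ ‖D⋆ l‖² + ⟨l, d⟩` up to a constant.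

The optimal states tend to `0`, and from a small state the LQ feedback is feasible forever.
Therefore only finitely many constraints matter at the optimal `v`, and Farkas' lemma yields a
multiplier `l ≤ 0` with `D⋆ l = v`, a minimizer of `F`. The Lyapunov function of accelerated
forward-backward splitting gives the rate for `F` and the convergence of the distances to every
minimizer, whence weak convergence by Opial's lemma.

At the multiplier `l`, the gap `F(λ) - F(l)` is at least `½ ‖D⋆ λ - v‖²`, and `D⋆ λᵏ` is the
deviation of the input `uᵏ`, so the dual rate becomes a strong primal one. Finally, `D⋆ λ̂ᵏ → v`
brings the states of all late iterates near the origin at one common time. From then on the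
constraint residual is nonpositive, the clipping keeps the late entries of the multipliers at zero,
and the horizons stop growing.
-/

/-! ### Perturbed descent sequences -/

section Descent

variable {W p q : ℕ → ℝ}

theorem exists_tendsto_of_succ_le_add (hW : ∀ k, 0 ≤ W k) (hq : ∀ k, 0 ≤ q k) (hqs : Summable q)
    (h : ∀ k, W (k + 1) ≤ W k + q k) : ∃ l, Filter.Tendsto W Filter.atTop (𝓝 l) := by
  have hanti : Antitone fun n => W n - ∑ k ∈ Finset.range n, q k :=
    antitone_nat_of_succ_le fun n => by
      rw [Finset.sum_range_succ]
      linarith [h n]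
  have hbdd : BddBelow (Set.range fun n => W n - ∑ k ∈ Finset.range n, q k) :=
    ⟨-∑' k, q k, Set.forall_mem_range.2 fun n => by
      linarith [hqs.sum_le_tsum (Finset.range n) fun k _ => hq k, hW n]⟩
  have hlim := (tendsto_atTop_ciInf hanti hbdd).add hqs.hasSum.tendsto_sum_nat
  exact ⟨_, hlim.congr fun n => sub_add_cancel _ _⟩

theorem summable_of_succ_add_le_add (hW : ∀ k, 0 ≤ W k) (hp : ∀ k, 0 ≤ p k) (hq : ∀ k, 0 ≤ q k)
    (hqs : Summable q) (h : ∀ k, W (k + 1) + p k ≤ W k + q k) : Summable p := by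
  have htelescope (n : ℕ) :
      W n + ∑ k ∈ Finset.range n, p k ≤ W 0 + ∑ k ∈ Finset.range n, q k := by
    induction n with
    | zero => simp
    | succ n ih =>
      rw [Finset.sum_range_succ, Finset.sum_range_succ]
      linarith [h n]
  refine summable_of_sum_range_le (c := W 0 + ∑' k, q k) hp fun n => ?_
  linarith [htelescope n, hW n, hqs.sum_le_tsum (Finset.range n) fun k _ => hq k]

end Descent

/-! ### Accelerated forward-backward splitting -/

namespace CLQR

theorem alpha_succ (a : ℝ) (k : ℕ) : alpha a (k + 1) = k / (k + 1 + a) := by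
  simp [alpha]

theorem alpha_mem_Icc {a : ℝ} (ha : -1 ≤ a) (k : ℕ) : alpha a k ∈ Set.Icc 0 1 := by
  cases k with
  | zero => simp [alpha]
  | succ k =>
    rw [alpha_succ]
    have hk : (0 : ℝ) ≤ k := k.cast_nonneg
    exact ⟨div_nonneg hk (by linarith), div_le_one_of_le₀ (by linarith) (by linarith)⟩

theorem add_mul_alpha_succ {a : ℝ} (ha : -1 < a) (k : ℕ) :
    ((k : ℝ) + 1 + a) * alpha a (k + 1) = k := by
  have : (0 : ℝ) ≤ k := k.cast_nonneg
  rw [alpha_succ, mul_div_cancel₀]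
  linarith

end CLQR

section Accelerated

variable {E : Type*} [NormedAddCommGroup E] [InnerProductSpace ℝ E]

theorem norm_add_smul_sub_sq (u v : E) (t : ℝ) :
    ‖u + t • (u - v)‖ ^ 2 = (1 + t) * ‖u‖ ^ 2 - t * ‖v‖ ^ 2 + t * (1 + t) * ‖u - v‖ ^ 2 := by
  rw [norm_add_sq_real, real_inner_smul_right, inner_sub_right, real_inner_self_eq_norm_sq,
    norm_smul, mul_pow, Real.norm_eq_abs, sq_abs, norm_sub_sq_real]
  ring

/-- Iterates `x` and extrapolated points `y` of accelerated forward-backward splitting for the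
minimization of `F` on the convex set `C`. The forward-backward step with step size `1 / L` enters
only through its descent inequality, and `x (k - 1)` stands for `x 0` when `k = 0`. -/
structure IsAcceleratedDescent (C : Set E) (F : E → ℝ) (a L : ℝ) (x y : ℕ → E) : Prop where
  convexOn : ConvexOn ℝ C F
  pos : 0 < L
  mem : ∀ k, x k ∈ C
  extrapolate : ∀ k, y k = x k + CLQR.alpha a k • (x k - x (k - 1))
  descent : ∀ k, ∀ z ∈ C,
    F (x (k + 1)) + L / 2 * ‖x (k + 1) - z‖ ^ 2 ≤ F z + L / 2 * ‖y k - z‖ ^ 2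

/-- The Lyapunov function
`(k + a)² (F(xₖ₊₁) - F(s)) + L/2 ‖a (xₖ - s) + (k + a) (xₖ₊₁ - xₖ)‖²` of accelerated
forward-backward splitting, measuring the progress of the iterates towards the minimizer `s`. -/
noncomputable def acceleratedEnergy (F : E → ℝ) (a L : ℝ) (x : ℕ → E) (s : E) (k : ℕ) : ℝ :=
  (k + a) ^ 2 * (F (x (k + 1)) - F s) +
    L / 2 * ‖a • (x k - s) + ((k : ℝ) + a) • (x (k + 1) - x k)‖ ^ 2

namespace IsAcceleratedDescent

variable {C : Set E} {F : E → ℝ} {a L : ℝ} {x y : ℕ → E} {s : E}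

theorem add_smul_alpha (ha : 0 < a) (x : ℕ → E) (k : ℕ) :
    ((k : ℝ) + a) • CLQR.alpha a k • (x k - x (k - 1)) = ((k : ℝ) - 1) • (x k - x (k - 1)) := by
  cases k with
  | zero => simp
  | succ k =>
    rw [smul_smul, Nat.cast_succ, CLQR.add_mul_alpha_succ (by linarith), add_sub_cancel_right]

-- The descent inequality at the convex combination `(k xₖ + a s) / (k + a)`, times `(k + a)²`.
theorem acceleratedEnergy_le (h : IsAcceleratedDescent C F a L x y) (ha : 0 < a) (hs : s ∈ C)
    (k : ℕ) :
    acceleratedEnergy F a L x s k ≤ k * (k + a) * (F (x k) - F s) +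
      L / 2 * ‖a • (x (k - 1) - s) + ((k : ℝ) + a - 1) • (x k - x (k - 1))‖ ^ 2 := by
  set σ : ℝ := (k : ℝ) + a with hσ
  have hσ0 : 0 < σ := by positivity
  set z : E := (k / σ : ℝ) • x k + (a / σ : ℝ) • s with hz
  have hweights : (k / σ : ℝ) + a / σ = 1 := by rw [← add_div, div_self hσ0.ne']
  have hzC : z ∈ C :=
    h.convexOn.1 (h.mem k) hs (by positivity) (by positivity) hweights
  have hFz : F z ≤ (k / σ : ℝ) * F (x k) + (a / σ : ℝ) * F s :=
    h.convexOn.2 (h.mem k) hs (by positivity) (by positivity) hweights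
  have hFσ : σ ^ 2 * ((k / σ : ℝ) * F (x k) + (a / σ : ℝ) * F s) =
      σ ^ 2 * F s + k * σ * (F (x k) - F s) := by
    field_simp
    rw [hσ]
    ring
  have hσz : σ • z = (k : ℝ) • x k + a • s := by
    rw [hz, smul_add, smul_smul, smul_smul, mul_div_cancel₀ _ hσ0.ne', mul_div_cancel₀ _ hσ0.ne']
  have hnext : a • (x k - s) + σ • (x (k + 1) - x k) = σ • (x (k + 1) - z) := by
    rw [smul_sub σ _ z, hσz, hσ]
    module
  have hprev : a • (x (k - 1) - s) + (σ - 1) • (x k - x (k - 1)) = σ • (y k - z) := by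
    rw [smul_sub σ _ z, hσz, h.extrapolate, smul_add, add_smul_alpha ha, hσ]
    module
  have hdescent := mul_le_mul_of_nonneg_left ((h.descent k z hzC).trans (add_le_add_left hFz _))
    (sq_nonneg σ)
  rw [acceleratedEnergy, ← hσ, hnext, hprev, norm_smul, norm_smul, mul_pow, mul_pow,
    Real.norm_of_nonneg hσ0.le]
  linarith

theorem acceleratedEnergy_zero_le (h : IsAcceleratedDescent C F a L x y) (ha : 0 < a)
    (hs : s ∈ C) : acceleratedEnergy F a L x s 0 ≤ a ^ 2 * L / 2 * ‖x 0 - s‖ ^ 2 := by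
  refine (h.acceleratedEnergy_le ha hs 0).trans (le_of_eq ?_)
  rw [Nat.zero_sub, sub_self, smul_zero, add_zero, norm_smul, mul_pow, Real.norm_eq_abs, sq_abs]
  push_cast
  ring

theorem acceleratedEnergy_succ_add_le (h : IsAcceleratedDescent C F a L x y) (ha : 0 < a)
    (hs : s ∈ C) (hmin : IsMinOn F C s) (k : ℕ) :
    acceleratedEnergy F a L x s (k + 1) + (a - 2) * ((k + 1) * (F (x (k + 1)) - F s)) ≤
      acceleratedEnergy F a L x s k := by
  have hgap : 0 ≤ F (x (k + 1)) - F s := sub_nonneg.2 (hmin (h.mem _))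
  have hweights : (k + 1) * (k + 1 + a) + (a - 2) * (k + 1) ≤ (k + a) ^ 2 := by
    nlinarith [sq_nonneg (a - 1)]
  have hstep := h.acceleratedEnergy_le ha hs (k + 1)
  rw [Nat.add_sub_cancel, Nat.cast_succ, add_right_comm _ 1 a, add_sub_cancel_right,
    add_right_comm _ a 1] at hstep
  rw [acceleratedEnergy.eq_def F a L x s k]
  linarith [mul_le_mul_of_nonneg_right hweights hgap]

theorem acceleratedEnergy_nonneg (h : IsAcceleratedDescent C F a L x y) (hmin : IsMinOn F C s)
    (k : ℕ) : 0 ≤ acceleratedEnergy F a L x s k := by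
  have hgap : 0 ≤ F (x (k + 1)) - F s := sub_nonneg.2 (hmin (h.mem _))
  have := h.pos
  unfold acceleratedEnergy
  positivity

theorem acceleratedEnergy_le_zero (h : IsAcceleratedDescent C F a L x y) (ha : 2 ≤ a)
    (hs : s ∈ C) (hmin : IsMinOn F C s) (k : ℕ) :
    acceleratedEnergy F a L x s k ≤ acceleratedEnergy F a L x s 0 :=
  antitone_nat_of_succ_le (f := acceleratedEnergy F a L x s) (fun k => by
    have hgap : 0 ≤ F (x (k + 1)) - F s := sub_nonneg.2 (hmin (h.mem _))
    have : 0 ≤ a - 2 := by linarith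
    have : 0 ≤ (a - 2) * ((k + 1) * (F (x (k + 1)) - F s)) := by positivity
    linarith [h.acceleratedEnergy_succ_add_le (by linarith) hs hmin k]) k.zero_le

theorem apply_succ_sub_le (h : IsAcceleratedDescent C F a L x y) (ha : 2 ≤ a) (hs : s ∈ C)
    (hmin : IsMinOn F C s) (k : ℕ) :
    F (x (k + 1)) - F s ≤ a ^ 2 * L / (2 * (k + a) ^ 2) * ‖x 0 - s‖ ^ 2 := by
  have hbound := (h.acceleratedEnergy_le_zero ha hs hmin k).trans
    (h.acceleratedEnergy_zero_le (by linarith) hs)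
  have hL := h.pos
  rw [div_mul_eq_mul_div, le_div_iff₀ (by positivity)]
  have : 0 ≤ L / 2 * ‖a • (x k - s) + ((k : ℝ) + a) • (x (k + 1) - x k)‖ ^ 2 := by positivity
  unfold acceleratedEnergy at hbound
  linarith

theorem summable_succ_mul_sub (h : IsAcceleratedDescent C F a L x y) (ha : 2 < a) (hs : s ∈ C)
    (hmin : IsMinOn F C s) : Summable fun k : ℕ => ((k : ℝ) + 1) * (F (x (k + 1)) - F s) := by
  have ha' : 0 < a - 2 := sub_pos.2 ha
  refine (summable_mul_left_iff ha'.ne').1 (summable_of_succ_add_le_add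
    (h.acceleratedEnergy_nonneg hmin) (fun k => ?_) (fun _ => le_rfl) summable_zero fun k => ?_)
  · have hgap : 0 ≤ F (x (k + 1)) - F s := sub_nonneg.2 (hmin (h.mem _))
    positivity
  · simpa using h.acceleratedEnergy_succ_add_le (by linarith) hs hmin k

theorem sq_add_mul_succ_le (h : IsAcceleratedDescent C F a L x y) (ha : 0 < a) (k : ℕ) :
    (k + 1 + a) ^ 2 * (F (x (k + 2)) + L / 2 * ‖x (k + 2) - x (k + 1)‖ ^ 2) ≤
      (k + 1 + a) ^ 2 * F (x (k + 1)) + L / 2 * (k ^ 2 * ‖x (k + 1) - x k‖ ^ 2) := by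
  have hmomentum : (k + 1 + a) ^ 2 * ‖CLQR.alpha a (k + 1) • (x (k + 1) - x k)‖ ^ 2 =
      k ^ 2 * ‖x (k + 1) - x k‖ ^ 2 := by
    rw [norm_smul, mul_pow, Real.norm_eq_abs, sq_abs, ← mul_assoc, ← mul_pow,
      CLQR.add_mul_alpha_succ (by linarith)]
  have hdescent := h.descent (k + 1) (x (k + 1)) (h.mem _)
  rw [h.extrapolate, Nat.add_sub_cancel, add_sub_cancel_left] at hdescent
  rw [← hmomentum]
  linarith [mul_le_mul_of_nonneg_left hdescent (sq_nonneg ((k : ℝ) + 1 + a))]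

theorem summable_succ_mul_norm_sub_sq (h : IsAcceleratedDescent C F a L x y) (ha : 2 < a)
    (hs : s ∈ C) (hmin : IsMinOn F C s) :
    Summable fun k : ℕ => ((k : ℝ) + 1) * ‖x (k + 1) - x k‖ ^ 2 := by
  have hL := h.pos
  have hgap (k : ℕ) : 0 ≤ F (x (k + 1)) - F s := sub_nonneg.2 (hmin (h.mem _))
  refine (summable_mul_left_iff (half_pos hL).ne').1 (summable_of_succ_add_le_add
    (W := fun k => (k + a) ^ 2 * (F (x (k + 1)) - F s + L / 2 * ‖x (k + 1) - x k‖ ^ 2))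
    (q := fun k => (3 + 2 * a) * (((k : ℝ) + 1) * (F (x (k + 1)) - F s)))
    (fun k => ?_) (fun k => by positivity) (fun k => ?_)
    ((h.summable_succ_mul_sub ha hs hmin).mul_left _) fun k => ?_)
  · have := hgap k
    positivity
  · have := hgap k
    positivity
  · have hsteps : (k : ℝ) ^ 2 + (k + 1) ≤ (k + a) ^ 2 := by nlinarith
    have hvalues : ((k : ℝ) + 1 + a) ^ 2 ≤ (k + a) ^ 2 + (3 + 2 * a) * (k + 1) := by nlinarith
    push_cast
    linarith [h.sq_add_mul_succ_le (by linarith) k, mul_le_mul_of_nonneg_right hvalues (hgap k),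
      mul_le_mul_of_nonneg_right hsteps
        (by positivity : 0 ≤ L / 2 * ‖x (k + 1) - x k‖ ^ 2)]

theorem norm_succ_sub_sq_le (h : IsAcceleratedDescent C F a L x y) (ha : -1 ≤ a) (hs : s ∈ C)
    (hmin : IsMinOn F C s) (k : ℕ) :
    ‖x (k + 2) - s‖ ^ 2 - ‖x (k + 1) - s‖ ^ 2 ≤
      CLQR.alpha a (k + 1) * (‖x (k + 1) - s‖ ^ 2 - ‖x k - s‖ ^ 2) +
        2 * ‖x (k + 1) - x k‖ ^ 2 := by
  obtain ⟨hα0, hα1⟩ := CLQR.alpha_mem_Icc ha (k + 1)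
  have hy : ‖x (k + 2) - s‖ ^ 2 ≤ ‖y (k + 1) - s‖ ^ 2 := by
    have hFs : F s ≤ F (x (k + 2)) := hmin (h.mem _)
    exact le_of_mul_le_mul_left (by linarith [h.descent (k + 1) s hs]) (half_pos h.pos)
  have hsplit : y (k + 1) - s =
      (x (k + 1) - s) + CLQR.alpha a (k + 1) • ((x (k + 1) - s) - (x k - s)) := by
    rw [h.extrapolate, Nat.add_sub_cancel, sub_sub_sub_cancel_right]
    abel
  rw [hsplit, norm_add_smul_sub_sq, sub_sub_sub_cancel_right] at hy
  have hcoeff : CLQR.alpha a (k + 1) * (1 + CLQR.alpha a (k + 1)) ≤ 2 := by nlinarith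
  linarith [mul_le_mul_of_nonneg_right hcoeff (sq_nonneg ‖x (k + 1) - x k‖)]

theorem summable_posPart_norm_sub_sq (h : IsAcceleratedDescent C F a L x y) (ha : 2 < a)
    (hs : s ∈ C) (hmin : IsMinOn F C s) :
    Summable fun k => (‖x (k + 1) - s‖ ^ 2 - ‖x k - s‖ ^ 2)⁺ := by
  set d : ℕ → ℝ := fun k => (‖x (k + 1) - s‖ ^ 2 - ‖x k - s‖ ^ 2)⁺
  have hd (k : ℕ) : 0 ≤ d k := posPart_nonneg _
  have hstep (k : ℕ) : d (k + 1) ≤ CLQR.alpha a (k + 1) * d k + 2 * ‖x (k + 1) - x k‖ ^ 2 := by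
    have hα := (CLQR.alpha_mem_Icc (by linarith : -1 ≤ a) (k + 1)).1
    have := hd k
    refine sup_le ((h.norm_succ_sub_sq_le (by linarith) hs hmin k).trans ?_) (by positivity)
    gcongr
    exact le_posPart _
  have ha0 : 0 < a := by linarith
  refine (summable_mul_left_iff ha0.ne').1 (summable_of_succ_add_le_add
    (W := fun k => (k + a) * d k)
    (q := fun k => (2 + 2 * a) * (((k : ℝ) + 1) * ‖x (k + 1) - x k‖ ^ 2))
    (fun k => mul_nonneg (by positivity) (hd k)) (fun k => mul_nonneg ha0.le (hd k))
    (fun k => by positivity) ((h.summable_succ_mul_norm_sub_sq ha hs hmin).mul_left _)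
    fun k => ?_)
  have hscaled : (k + 1 + a) * d (k + 1) ≤
      k * d k + (k + 1 + a) * (2 * ‖x (k + 1) - x k‖ ^ 2) := by
    refine (mul_le_mul_of_nonneg_left (hstep k) (by positivity)).trans_eq ?_
    rw [mul_add, ← mul_assoc, CLQR.add_mul_alpha_succ (by linarith)]
  have hcoeff : ((k : ℝ) + 1 + a) * 2 ≤ (2 + 2 * a) * (k + 1) := by nlinarith
  push_cast
  linarith [mul_le_mul_of_nonneg_right hcoeff (sq_nonneg ‖x (k + 1) - x k‖)]

theorem exists_tendsto_norm_sub_sq (h : IsAcceleratedDescent C F a L x y) (ha : 2 < a)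
    (hs : s ∈ C) (hmin : IsMinOn F C s) :
    ∃ l, Filter.Tendsto (fun k => ‖x k - s‖ ^ 2) Filter.atTop (𝓝 l) := by
  refine exists_tendsto_of_succ_le_add (fun k => sq_nonneg _) (fun k => posPart_nonneg _)
    (h.summable_posPart_norm_sub_sq ha hs hmin) fun k => ?_
  linarith [le_posPart (‖x (k + 1) - s‖ ^ 2 - ‖x k - s‖ ^ 2)]

theorem tendsto_apply (h : IsAcceleratedDescent C F a L x y) (ha : 2 < a) (hs : s ∈ C)
    (hmin : IsMinOn F C s) : Filter.Tendsto (fun k => F (x k)) Filter.atTop (𝓝 (F s)) := by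
  rw [← Filter.tendsto_add_atTop_iff_nat 1]
  have hgap (k : ℕ) : 0 ≤ F (x (k + 1)) - F s := sub_nonneg.2 (hmin (h.mem _))
  have hlim := squeeze_zero hgap
    (fun k => le_mul_of_one_le_left (hgap k) (le_add_of_nonneg_left k.cast_nonneg))
    (h.summable_succ_mul_sub ha hs hmin).tendsto_atTop_zero
  simpa using hlim.add_const (F s)

end IsAcceleratedDescent

end Accelerated

/-! ### Weak limits -/

section Weak

variable {E : Type*} [NormedAddCommGroup E] [InnerProductSpace ℝ E] [CompleteSpace E]

theorem exists_forall_tendsto_inner_ultrafilter {ι : Type*} (U : Ultrafilter ι) {x : ι → E}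
    {r : ℝ} (hx : ∀ i, ‖x i‖ ≤ r) :
    ∃ z : E, ∀ y : E, Filter.Tendsto (fun i => (inner ℝ y (x i) : ℝ)) U (𝓝 (inner ℝ y z)) := by
  obtain ⟨φ, -, hφ⟩ := (WeakDual.isCompact_closedBall (0 : StrongDual ℝ E) r).ultrafilter_le_nhds
    (U.map fun i => StrongDual.toWeakDual (InnerProductSpace.toDual ℝ E (x i))) (by
      refine Filter.le_principal_iff.2 (Filter.mem_map.2 (Filter.univ_mem' fun i => ?_))
      simpa using hx i)
  refine ⟨(InnerProductSpace.toDual ℝ E).symm (WeakDual.toStrongDual φ), fun y => ?_⟩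
  rw [real_inner_comm, InnerProductSpace.toDual_symm_apply]
  exact (((WeakDual.eval_continuous y).tendsto φ).comp hφ).congr fun i => real_inner_comm _ _

/-- Opial's lemma, with weak cluster points expressed by ultrafilters. -/
theorem exists_mem_forall_tendsto_inner {x : ℕ → E} {S : Set E} (hS : S.Nonempty)
    (hdist : ∀ s ∈ S, ∃ l, Filter.Tendsto (fun k => ‖x k - s‖ ^ 2) Filter.atTop (𝓝 l))
    (hcluster : ∀ (U : Ultrafilter ℕ) (z : E), (U : Filter ℕ) ≤ Filter.atTop →
      (∀ y : E, Filter.Tendsto (fun k => (inner ℝ y (x k) : ℝ)) U (𝓝 (inner ℝ y z))) → z ∈ S) :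
    ∃ z ∈ S, ∀ y : E,
      Filter.Tendsto (fun k => (inner ℝ y (x k) : ℝ)) Filter.atTop (𝓝 (inner ℝ y z)) := by
  obtain ⟨r, hr⟩ : ∃ r, ∀ k, ‖x k‖ ≤ r := by
    obtain ⟨s, hs⟩ := hS
    obtain ⟨l, hl⟩ := hdist s hs
    obtain ⟨b, hb⟩ := hl.bddAbove_range
    refine ⟨√b + ‖s‖, fun k => ?_⟩
    have hdistb : ‖x k - s‖ ≤ √b := Real.le_sqrt_of_sq_le (hb ⟨k, rfl⟩)
    linarith [norm_le_norm_sub_add (x k) s]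
  choose z hz using fun U : Ultrafilter ℕ => exists_forall_tendsto_inner_ultrafilter U hr
  have hzS (U : Ultrafilter ℕ) (hU : (U : Filter ℕ) ≤ Filter.atTop) : z U ∈ S :=
    hcluster U (z U) hU (hz U)
  -- `⟪z₂ - z₁, x k⟫` converges along the whole sequence, so that it has the same limit along
  -- both ultrafilters.
  have hunique (U₁ U₂ : Ultrafilter ℕ) (h₁ : (U₁ : Filter ℕ) ≤ Filter.atTop)
      (h₂ : (U₂ : Filter ℕ) ≤ Filter.atTop) : z U₁ = z U₂ := by
    obtain ⟨l₁, hl₁⟩ := hdist _ (hzS U₁ h₁)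
    obtain ⟨l₂, hl₂⟩ := hdist _ (hzS U₂ h₂)
    have hlim : Filter.Tendsto (fun k => (inner ℝ (z U₂ - z U₁) (x k) : ℝ)) Filter.atTop
        (𝓝 ((1 / 2) * (l₁ - l₂ - (‖z U₁‖ ^ 2 - ‖z U₂‖ ^ 2)))) := by
      refine (((hl₁.sub hl₂).sub_const _).const_mul (1 / 2)).congr fun k => ?_
      rw [norm_sub_sq_real, norm_sub_sq_real, inner_sub_left, real_inner_comm (x k),
        real_inner_comm (x k)]
      ring
    have hlim₁ := tendsto_nhds_unique (hz U₁ (z U₂ - z U₁)) (hlim.mono_left h₁)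
    have hlim₂ := tendsto_nhds_unique (hz U₂ (z U₂ - z U₁)) (hlim.mono_left h₂)
    have hself : (inner ℝ (z U₂ - z U₁) (z U₂ - z U₁) : ℝ) = 0 := by
      rw [inner_sub_right, hlim₁, hlim₂, sub_self]
    exact (sub_eq_zero.1 (inner_self_eq_zero.1 hself)).symm
  obtain ⟨U₀, hU₀⟩ := Ultrafilter.exists_le (Filter.atTop : Filter ℕ)
  refine ⟨z U₀, hzS U₀ hU₀, fun y => (Filter.tendsto_iff_ultrafilter _ _ _).2 fun U hU => ?_⟩
  exact hunique U U₀ hU hU₀ ▸ hz U y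

end Weak

/-! ### Farkas' lemma -/

section Farkas

variable {𝕜 V ι : Type*} [Field 𝕜] [LinearOrder 𝕜] [IsStrictOrderedRing 𝕜] [AddCommGroup V]
  [Module 𝕜 V]

theorem hull_image_sub_smul_le {C : PointedCone 𝕜 V} {s : Set ι} {g : ι → V} {x : V} {c : ι → 𝕜}
    (hg : ∀ j ∈ s, g j ∈ C) (hx : x ∈ C) (hc : ∀ j ∈ s, c j ≤ 0) :
    PointedCone.hull 𝕜 ((fun j => g j - c j • x) '' s) ≤ C := by
  refine Submodule.span_le.2 (Set.image_subset_iff.2 fun j hj => ?_)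
  simpa [sub_eq_add_neg] using
    add_mem (hg j hj) (PointedCone.smul_mem _ (neg_nonneg.2 (hc j hj)) hx)

theorem mem_hull_image_of_forall_nonpos (s : Finset ι) (g : ι → Module.Dual 𝕜 V)
    (b : Module.Dual 𝕜 V) (h : ∀ v, (∀ j ∈ s, g j v ≤ 0) → b v ≤ 0) :
    b ∈ PointedCone.hull 𝕜 (g '' s) := by
  classical
  induction s using Finset.induction_on generalizing g b with
  | empty =>
    have hb : b = 0 := by
      ext v
      exact le_antisymm (h v (by simp)) (by simpa using h (-v) (by simp))
    exact hb ▸ zero_mem _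
  | insert i s _ ih =>
    have hmono : PointedCone.hull 𝕜 (g '' s) ≤ PointedCone.hull 𝕜 (g '' ↑(insert i s)) :=
      Submodule.span_mono (Set.image_mono (Finset.coe_subset.2 (Finset.subset_insert i s)))
    have hgi : g i ∈ PointedCone.hull 𝕜 (g '' ↑(insert i s)) :=
      Submodule.subset_span (Set.mem_image_of_mem g (Finset.mem_insert_self i s))
    by_cases hb : ∀ v, (∀ j ∈ s, g j v ≤ 0) → b v ≤ 0
    · exact hmono (ih g b hb)
    push Not at hb
    obtain ⟨v₀, hv₀, hbv₀⟩ := hb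
    have hgv₀ : 0 < g i v₀ := by
      contrapose! hbv₀
      exact h v₀ (Finset.forall_mem_insert _ _ _ |>.2 ⟨hbv₀, hv₀⟩)
    -- Project along `v₀` onto the kernel of `g i` to eliminate `g i`.
    have hproj : b - (b v₀ / g i v₀) • g i ∈
        PointedCone.hull 𝕜 ((fun j => g j - (g j v₀ / g i v₀) • g i) '' s) := by
      refine ih _ _ fun v hv => ?_
      have hval (f : Module.Dual 𝕜 V) :
          f (v - (g i v / g i v₀) • v₀) = (f - (f v₀ / g i v₀) • g i) v := by
        simp only [map_sub, map_smul, smul_eq_mul, LinearMap.sub_apply, LinearMap.smul_apply]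
        ring
      rw [← hval]
      refine h _ (Finset.forall_mem_insert _ _ _ |>.2 ⟨?_, fun j hj => ?_⟩)
      · simp [hgv₀.ne']
      · rw [hval]
        exact hv j hj
    have hle : PointedCone.hull 𝕜 ((fun j => g j - (g j v₀ / g i v₀) • g i) '' s) ≤
        PointedCone.hull 𝕜 (g '' ↑(insert i s)) :=
      hull_image_sub_smul_le (fun j hj => hmono (Submodule.subset_span (Set.mem_image_of_mem g hj)))
        hgi fun j hj => div_nonpos_of_nonpos_of_nonneg (hv₀ j hj) hgv₀.le
    have hcoeff : 0 ≤ b v₀ / g i v₀ := by positivity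
    simpa using add_mem (hle hproj) (PointedCone.smul_mem _ hcoeff hgi)

theorem exists_nonneg_eq_sum_smul_of_forall_nonpos (s : Finset ι) (g : ι → Module.Dual 𝕜 V)
    (b : Module.Dual 𝕜 V) (h : ∀ v, (∀ j ∈ s, g j v ≤ 0) → b v ≤ 0) :
    ∃ c : ι → 𝕜, (∀ j, 0 ≤ c j) ∧ b = ∑ j ∈ s, c j • g j := by
  classical
  obtain ⟨c, hc⟩ := (Submodule.mem_span_image_finset_iff_exists_fun _).1
    (mem_hull_image_of_forall_nonpos s g b h)
  refine ⟨fun j => if hj : j ∈ s then c ⟨j, hj⟩ else 0, fun j => ?_, ?_⟩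
  · beta_reduce
    split_ifs with hj
    exacts [(c ⟨j, hj⟩).2, le_rfl]
  · rw [← hc, ← Finset.sum_attach s, Finset.univ_eq_attach]
    exact Finset.sum_congr rfl fun j _ => by simp [j.2]

end Farkas

/-! ### Quadratic forms and stable linear systems -/

section QuadraticForms

variable {ι κ σ : Type*} [Fintype ι] [Fintype κ] [Fintype σ]

theorem mulVec_dotProduct_mulVec (X : Matrix ι κ ℝ) (Y : Matrix ι σ ℝ) (a : κ → ℝ) (b : σ → ℝ) :
    (X *ᵥ a) ⬝ᵥ (Y *ᵥ b) = a ⬝ᵥ (Xᵀ * Y) *ᵥ b := by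
  rw [← Matrix.mulVec_mulVec, Matrix.dotProduct_mulVec a, Matrix.vecMul_transpose]

variable [DecidableEq κ] [DecidableEq σ]

theorem toE_mul (M : Matrix ι κ ℝ) (N : Matrix κ σ ℝ) (x : EuclideanSpace ℝ σ) :
    (M * N).toE x = M.toE (N.toE x) := by
  ext j
  rw [Matrix.toE_apply, Matrix.toE_apply, ← Matrix.mulVec_mulVec]
  rfl

theorem toE_add (M N : Matrix ι κ ℝ) (x : EuclideanSpace ℝ κ) :
    (M + N).toE x = M.toE x + N.toE x := by
  ext j
  simp [Matrix.toE_apply, Matrix.add_mulVec]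

theorem toE_smul (c : ℝ) (M : Matrix ι κ ℝ) (x : EuclideanSpace ℝ κ) :
    (c • M).toE x = c • M.toE x := by
  ext j
  simp [Matrix.toE_apply, Matrix.smul_mulVec]

theorem toE_one (x : EuclideanSpace ℝ κ) : (1 : Matrix κ κ ℝ).toE x = x := by
  ext j
  simp [Matrix.toE_apply]

theorem inner_toE (M : Matrix ι κ ℝ) (x : EuclideanSpace ℝ ι) (y : EuclideanSpace ℝ κ) :
    inner ℝ x (M.toE y) = x.ofLp ⬝ᵥ M *ᵥ y.ofLp := by
  rw [EuclideanSpace.inner_eq_star_dotProduct, dotProduct_comm]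
  rfl

variable {M : Matrix κ κ ℝ}

open scoped MatrixOrder in
theorem exists_eq_transpose_mul_self (hM : M.PosSemidef) :
    ∃ N : Matrix κ κ ℝ, M = Nᵀ * N ∧ ∀ x, ‖N.toE x‖ ^ 2 = inner ℝ x (M.toE x) := by
  obtain ⟨N, rfl⟩ := CStarAlgebra.nonneg_iff_eq_star_mul_self.mp hM.nonneg
  have hN : star N = Nᵀ := by
    rw [Matrix.star_eq_conjTranspose, Matrix.conjTranspose_eq_transpose_of_trivial]
  refine ⟨N, by rw [hN], fun x => ?_⟩
  rw [hN, inner_toE, ← mulVec_dotProduct_mulVec, ← real_inner_self_eq_norm_sq, inner_toE]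
  rfl

theorem inner_toE_nonneg (hM : M.PosSemidef) (x : EuclideanSpace ℝ κ) :
    0 ≤ inner ℝ x (M.toE x) := by
  obtain ⟨N, -, hN⟩ := exists_eq_transpose_mul_self hM
  exact hN x ▸ sq_nonneg _

theorem exists_norm_toE_sq_le (hM : M.PosSemidef) :
    ∃ c : ℝ, 0 ≤ c ∧ ∀ x, ‖M.toE x‖ ^ 2 ≤ c * inner ℝ x (M.toE x) := by
  obtain ⟨N, hMN, hN⟩ := exists_eq_transpose_mul_self hM
  refine ⟨‖Nᵀ.toE‖ ^ 2, sq_nonneg _, fun x => ?_⟩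
  rw [← hN, ← mul_pow, hMN, toE_mul]
  exact pow_le_pow_left₀ (norm_nonneg _) (Nᵀ.toE.le_opNorm _) 2

theorem exists_continuousLinearEquiv_norm_sq_eq (hM : M.PosDef) :
    ∃ e : EuclideanSpace ℝ κ ≃L[ℝ] EuclideanSpace ℝ κ,
      ∀ x, ‖e x‖ ^ 2 = inner ℝ x (M.toE x) := by
  obtain ⟨N, rfl, hN⟩ := exists_eq_transpose_mul_self hM.posSemidef
  have hdet : IsUnit N.det := by
    have := (Matrix.isUnit_iff_isUnit_det _).1 hM.isUnit
    rw [Matrix.det_mul] at this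
    exact isUnit_of_mul_isUnit_right this
  refine ⟨ContinuousLinearEquiv.equivOfInverse N.toE N⁻¹.toE (fun x => ?_) fun x => ?_, hN⟩
  · rw [← toE_mul, Matrix.nonsing_inv_mul _ hdet, toE_one]
  · rw [← toE_mul, Matrix.mul_nonsing_inv _ hdet, toE_one]

theorem exists_mul_norm_sq_le_inner_toE (hM : M.PosDef) :
    ∃ r : ℝ, 0 < r ∧ ∀ x, r * ‖x‖ ^ 2 ≤ inner ℝ x (M.toE x) := by
  obtain ⟨e, he⟩ := exists_continuousLinearEquiv_norm_sq_eq hM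
  refine ⟨(‖(e.symm : EuclideanSpace ℝ κ →L[ℝ] EuclideanSpace ℝ κ)‖ ^ 2 + 1)⁻¹, by positivity,
    fun x => ?_⟩
  have hx := pow_le_pow_left₀ (norm_nonneg _)
    ((e.symm : EuclideanSpace ℝ κ →L[ℝ] EuclideanSpace ℝ κ).le_opNorm (e x)) 2
  rw [ContinuousLinearEquiv.coe_coe, e.symm_apply_apply, mul_pow] at hx
  rw [← he, inv_mul_le_iff₀ (by positivity)]
  linarith [sq_nonneg ‖e x‖]

end QuadraticForms

section SchurStable

variable {n : ℕ} {M : Matrix (Fin n) (Fin n) ℝ}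

theorem admissibleWeight_two_smul (hM : M.SchurStable) :
    AdmissibleWeight ((2 : ℝ) • M) (1 / 4) where
  pos := by norm_num
  lt_one := by norm_num
  spectral z hz := by
    have hmap : ((2 : ℝ) • M).map (fun t : ℝ => (t : ℂ)) =
        Units.mk0 (2 : ℂ) two_ne_zero • M.map (fun t : ℝ => (t : ℂ)) := by
      ext i j
      simp [Units.smul_def]
    have hhalf : M.IsComplexEigenvalue ((2 : ℂ)⁻¹ * z) := by
      refine (spectrum.smul_mem_smul_iff (r := Units.mk0 (2 : ℂ) two_ne_zero)).1 ?_
      rw [← hmap, Units.smul_def, Units.val_mk0, smul_eq_mul,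
        mul_inv_cancel_left₀ two_ne_zero]
      exact hz
    have hlt := hM _ hhalf
    rw [norm_mul, norm_inv, Complex.norm_ofNat] at hlt
    nlinarith [norm_nonneg z]

-- The rescaled states `2ⁱ xᵢ` form a trajectory of `(2 M, 1)`, so the bound for weighted
-- convolutions with the weight `1/4` applies.
theorem summable_norm_sq_of_schurStable (hM : M.SchurStable)
    {x e : ℕ → EuclideanSpace ℝ (Fin n)} (hx : ∀ i, x (i + 1) = M.toE (x i) + e i)
    (he : Summable fun i => ‖e i‖ ^ 2) : Summable fun i => ‖x i‖ ^ 2 := by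
  have : Fact (0 < (1 / 4 : ℝ)) := ⟨by norm_num⟩
  let P : CLQR n n 0 0 :=
    { A := (2 : ℝ) • M, B := 1, Q := 0, R := 0, Cx := 0, cx := 0, Cu := 0, cu := 0, xinit := x 0 }
  have hweight (i : ℕ) (v : EuclideanSpace ℝ (Fin n)) :
      (1 / 4 : ℝ) ^ i * ‖(2 : ℝ) ^ (i + 1) • v‖ ^ 2 = 4 * ‖v‖ ^ 2 := by
    rw [norm_smul, norm_pow, Real.norm_ofNat, mul_pow, ← pow_mul, mul_comm (i + 1), pow_mul,
      pow_succ, ← mul_assoc, ← mul_assoc, ← mul_pow]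
    norm_num
  let u : WL2 (1 / 4) (EuclideanSpace ℝ (Fin n)) :=
    WL2.mk (fun i => (2 : ℝ) ^ (i + 1) • e i) ((he.mul_left 4).congr fun i => (hweight i _).symm)
  have htraj (i : ℕ) : P.traj u i = (2 : ℝ) ^ i • x i := by
    induction i with
    | zero => simp [CLQR.traj, P]
    | succ i ih =>
      have hinput : P.B.toE (u i) = (2 : ℝ) ^ (i + 1) • e i := toE_one _
      rw [CLQR.traj, ih, hinput, hx, smul_add, toE_smul, map_smul,
        pow_succ', mul_smul, mul_smul]
  rw [← summable_nat_add_iff 1, ← summable_mul_left_iff (four_ne_zero (α := ℝ))]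
  refine (P.stateSeq (admissibleWeight_two_smul hM) u).summable_norm_sq.congr fun i => ?_
  rw [P.stateSeq_apply, htraj, hweight]

end SchurStable

/-! ### Detectability -/

section SquareSummable

variable {ι E F : Type*} [NormedAddCommGroup E] [NormedAddCommGroup F]

theorem summable_norm_sub_sq {f g : ι → E} (hf : Summable fun i => ‖f i‖ ^ 2)
    (hg : Summable fun i => ‖g i‖ ^ 2) : Summable fun i => ‖f i - g i‖ ^ 2 :=
  .of_nonneg_of_le (fun _ => sq_nonneg _) (fun _ =>
    (pow_le_pow_left₀ (norm_nonneg _) (norm_sub_le _ _) 2).trans add_sq_le)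
    ((hf.add hg).mul_left 2)

variable [NormedSpace ℝ E] [NormedSpace ℝ F]

theorem summable_norm_apply_sq (M : E →L[ℝ] F) {f : ι → E} (hf : Summable fun i => ‖f i‖ ^ 2) :
    Summable fun i => ‖M (f i)‖ ^ 2 :=
  .of_nonneg_of_le (fun _ => sq_nonneg _) (fun _ =>
    (pow_le_pow_left₀ (norm_nonneg _) (M.le_opNorm _) 2).trans_eq (mul_pow _ _ 2))
    (hf.mul_left (‖M‖ ^ 2))

end SquareSummable

theorem summable_norm_sq_of_detectable {n p : ℕ} {A : Matrix (Fin n) (Fin n) ℝ}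
    {D : Matrix (Fin p) (Fin n) ℝ} (hdet : Detectable A D) {x e : ℕ → EuclideanSpace ℝ (Fin n)}
    (hx : ∀ i, x (i + 1) = A.toE (x i) + e i) (he : Summable fun i => ‖e i‖ ^ 2)
    (hD : Summable fun i => ‖D.toE (x i)‖ ^ 2) : Summable fun i => ‖x i‖ ^ 2 := by
  obtain ⟨J, hJ⟩ := hdet
  refine summable_norm_sq_of_schurStable hJ (fun i => ?_)
    (summable_norm_sub_sq he (summable_norm_apply_sq J.toE hD))
  rw [hx, toE_add, toE_mul]
  abel

namespace CLQR

variable {n m px pu : ℕ} (P : CLQR n m px pu)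

theorem exists_mul_norm_sq_le_stageCost {P : CLQR n m px pu} (hQ : P.Q.PosSemidef)
    (hR : P.R.PosDef) : ∃ r : ℝ, 0 < r ∧ ∀ x u, r * ‖u‖ ^ 2 ≤ P.stageCost x u := by
  obtain ⟨r, hr, hru⟩ := exists_mul_norm_sq_le_inner_toE hR
  refine ⟨r / 2, half_pos hr, fun x u => ?_⟩
  unfold stageCost
  linarith [hru u, inner_toE_nonneg hQ x]

theorem tendsto_traj_of_summable_stageCost {P : CLQR n m px pu} (hQ : P.Q.PosSemidef)
    (hR : P.R.PosDef) (hdet : Detectable P.A P.Q) {u : ℕ → EuclideanSpace ℝ (Fin m)}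
    (hu : Summable fun i => P.stageCost (P.traj u i) (u i)) :
    Filter.Tendsto (P.traj u) Filter.atTop (𝓝 0) := by
  obtain ⟨r, hr, hru⟩ := exists_mul_norm_sq_le_stageCost hQ hR
  obtain ⟨c, hc, hcQ⟩ := exists_norm_toE_sq_le hQ
  have hinput : Summable fun i => ‖u i‖ ^ 2 :=
    (summable_mul_left_iff hr.ne').1 (.of_nonneg_of_le (fun i => by positivity)
      (fun i => hru (P.traj u i) (u i)) hu)
  have houtput : Summable fun i => ‖P.Q.toE (P.traj u i)‖ ^ 2 := by
    refine .of_nonneg_of_le (fun i => sq_nonneg _) (fun i => (hcQ _).trans ?_)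
      (hu.mul_left (c * 2))
    rw [mul_assoc]
    gcongr
    unfold stageCost
    linarith [inner_toE_nonneg hR.posSemidef (u i)]
  have hstate := summable_norm_sq_of_detectable hdet (fun i => rfl)
    (summable_norm_apply_sq P.B.toE hinput) houtput
  exact tendsto_zero_iff_norm_tendsto_zero.2 (by simpa using hstate.tendsto_atTop_zero.sqrt)

/-! ### Completing the square in the Riccati equation -/

/-- The cost-to-go `½ xᵀ Plq x` of the unconstrained LQ regulator. -/
noncomputable def lqCost (Plq : Matrix (Fin n) (Fin n) ℝ) (x : EuclideanSpace ℝ (Fin n)) : ℝ :=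
  (1 / 2) * inner ℝ x (Plq.toE x)

namespace IsLQSolution

variable {P : CLQR n m px pu} {Plq : Matrix (Fin n) (Fin n) ℝ} {K : Matrix (Fin m) (Fin n) ℝ}

theorem posDef_add (h : P.IsLQSolution Plq K) (hR : P.R.PosDef) :
    (P.R + P.Bᵀ * Plq * P.B).PosDef := by
  have := h.posSemidef.conjTranspose_mul_mul_same P.B
  rw [Matrix.conjTranspose_eq_transpose_of_trivial] at this
  exact hR.add_posSemidef this

theorem mul_gain (h : P.IsLQSolution Plq K) (hR : P.R.PosDef) :
    (P.R + P.Bᵀ * Plq * P.B) * K = -(P.Bᵀ * Plq * P.A) := by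
  rw [h.gain, Matrix.mul_neg, Matrix.mul_nonsing_inv_cancel_left _ _
    ((Matrix.isUnit_iff_isUnit_det _).1 (h.posDef_add hR).isUnit)]

theorem gain_transpose_mul (h : P.IsLQSolution Plq K) (hR : P.R.PosDef) :
    Kᵀ * (P.R + P.Bᵀ * Plq * P.B) = -(P.Aᵀ * Plq * P.B) := by
  have hsymm {k : ℕ} {M : Matrix (Fin k) (Fin k) ℝ} (hM : M.IsHermitian) : Mᵀ = M := by
    rw [← Matrix.conjTranspose_eq_transpose_of_trivial]
    exact hM
  have htranspose := congrArg Matrix.transpose (h.mul_gain hR)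
  rw [Matrix.transpose_mul, hsymm (h.posDef_add hR).isHermitian] at htranspose
  rw [htranspose, Matrix.transpose_neg, Matrix.transpose_mul, Matrix.transpose_mul,
    hsymm h.posSemidef.isHermitian, Matrix.transpose_transpose, Matrix.mul_assoc]

theorem eq_add_sub (h : P.IsLQSolution Plq K) (hR : P.R.PosDef) :
    Plq = P.Q + P.Aᵀ * Plq * P.A - Kᵀ * (P.R + P.Bᵀ * Plq * P.B) * K := by
  rw [h.gain_transpose_mul hR, h.gain, Matrix.neg_mul, Matrix.mul_neg, neg_neg,
    ← Matrix.mul_assoc (P.Aᵀ * Plq * P.B)]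
  exact h.riccati

theorem lqCost_add_stageCost (h : P.IsLQSolution Plq K) (hR : P.R.PosDef)
    (x : EuclideanSpace ℝ (Fin n)) (u : EuclideanSpace ℝ (Fin m)) :
    lqCost Plq (P.A.toE x + P.B.toE u) + P.stageCost x u = lqCost Plq x +
      (1 / 2) * inner ℝ (u - K.toE x) ((P.R + P.Bᵀ * Plq * P.B).toE (u - K.toE x)) := by
  set M := P.R + P.Bᵀ * Plq * P.B with hM
  have hstate : x.ofLp ⬝ᵥ Plq *ᵥ x.ofLp = x.ofLp ⬝ᵥ P.Q *ᵥ x.ofLp +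
      x.ofLp ⬝ᵥ (P.Aᵀ * Plq * P.A) *ᵥ x.ofLp - x.ofLp ⬝ᵥ (Kᵀ * M * K) *ᵥ x.ofLp := by
    conv_lhs => rw [h.eq_add_sub hR]
    rw [Matrix.sub_mulVec, Matrix.add_mulVec, dotProduct_sub, dotProduct_add]
  have hinput : u.ofLp ⬝ᵥ M *ᵥ u.ofLp =
      u.ofLp ⬝ᵥ P.R *ᵥ u.ofLp + u.ofLp ⬝ᵥ (P.Bᵀ * Plq * P.B) *ᵥ u.ofLp := by
    rw [hM, Matrix.add_mulVec, dotProduct_add]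
  have hMK : M * K = -(P.Bᵀ * Plq * P.A) := h.mul_gain hR
  have hKM : Kᵀ * M = -(P.Aᵀ * Plq * P.B) := h.gain_transpose_mul hR
  have hKMK : Kᵀ * P.Bᵀ * Plq * P.A = P.Aᵀ * Plq * P.B * K := by
    have := congrArg (· * K) hKM
    simpa only [Matrix.mul_assoc, hMK, Matrix.mul_neg, Matrix.neg_mul, neg_inj] using this
  have hnext : (P.A.toE x + P.B.toE u).ofLp = P.A *ᵥ x.ofLp + P.B *ᵥ u.ofLp := rfl
  have hdev : (u - K.toE x).ofLp = u.ofLp - K *ᵥ x.ofLp := rfl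
  simp only [lqCost, stageCost, inner_toE, hnext, hdev, hstate, Matrix.mulVec_add,
    Matrix.mulVec_sub, add_dotProduct, sub_dotProduct, dotProduct_add, dotProduct_sub,
    Matrix.mulVec_mulVec, mulVec_dotProduct_mulVec, ← Matrix.mul_assoc, hinput, hMK, hKM,
    Matrix.neg_mul, hKMK, Matrix.neg_mulVec, dotProduct_neg]
  ring

end IsLQSolution

/-- `N` is a factor of `R + Bᵀ Plq B`, so that completing the square in the Riccati equation turns
the cost into `½ ∑ ‖N (uᵢ - K xᵢ)‖²`, up to a constant. Besides this identity the structure keeps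
what positivity of the cost and detectability give: the inputs are bounded by the cost, and
finite cost drives the state to the origin. -/
structure FeedbackFactor (Plq : Matrix (Fin n) (Fin n) ℝ) (K : Matrix (Fin m) (Fin n) ℝ)
    (N : EuclideanSpace ℝ (Fin m) ≃L[ℝ] EuclideanSpace ℝ (Fin m)) (r : ℝ) : Prop where
  energy : ∀ x u, lqCost Plq (P.A.toE x + P.B.toE u) + P.stageCost x u =
    lqCost Plq x + (1 / 2) * ‖N (u - K.toE x)‖ ^ 2
  lqCost_nonneg : ∀ x, 0 ≤ lqCost Plq x
  pos : 0 < r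
  coercive : ∀ x u, r * ‖u‖ ^ 2 ≤ P.stageCost x u
  tendsto_traj : ∀ u, Summable (fun i => P.stageCost (P.traj u i) (u i)) →
    Filter.Tendsto (P.traj u) Filter.atTop (𝓝 0)

theorem IsLQSolution.exists_feedbackFactor {P : CLQR n m px pu} {Plq : Matrix (Fin n) (Fin n) ℝ}
    {K : Matrix (Fin m) (Fin n) ℝ} (h : P.IsLQSolution Plq K) (hQ : P.Q.PosSemidef)
    (hR : P.R.PosDef) (hdet : Detectable P.A P.Q) : ∃ N r, P.FeedbackFactor Plq K N r := by
  obtain ⟨N, hN⟩ := exists_continuousLinearEquiv_norm_sq_eq (h.posDef_add hR)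
  obtain ⟨r, hr, hru⟩ := exists_mul_norm_sq_le_stageCost hQ hR
  refine ⟨N, r, fun x u => ?_, fun x => ?_, hr, hru,
    fun u => tendsto_traj_of_summable_stageCost hQ hR hdet⟩
  · rw [hN]
    exact h.lqCost_add_stageCost hR x u
  · have := inner_toE_nonneg h.posSemidef x
    unfold lqCost
    positivity

/-! ### Inputs as deviations from the LQ feedback -/

section Feedback

variable (K : Matrix (Fin m) (Fin n) ℝ)
  (N : EuclideanSpace ℝ (Fin m) ≃L[ℝ] EuclideanSpace ℝ (Fin m))

/-- The states under the input `u = K x + N⁻¹ v`. -/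
noncomputable def feedbackState (x : EuclideanSpace ℝ (Fin n))
    (v : ℕ → EuclideanSpace ℝ (Fin m)) : ℕ → EuclideanSpace ℝ (Fin n)
  | 0 => x
  | i + 1 => P.A.toE (feedbackState x v i) + P.B.toE (K.toE (feedbackState x v i) + N.symm (v i))

/-- The input `u = K x + N⁻¹ v`. -/
noncomputable def feedbackInput (x : EuclideanSpace ℝ (Fin n))
    (v : ℕ → EuclideanSpace ℝ (Fin m)) (i : ℕ) : EuclideanSpace ℝ (Fin m) :=
  K.toE (P.feedbackState K N x v i) + N.symm (v i)

/-- The scaled deviation `N (u - K x)` of an input from the LQ feedback. -/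
noncomputable def feedbackDeviation (u : ℕ → EuclideanSpace ℝ (Fin m)) (i : ℕ) :
    EuclideanSpace ℝ (Fin m) :=
  N (u i - K.toE (P.traj u i))

variable {P K N} {Plq : Matrix (Fin n) (Fin n) ℝ} {r : ℝ} {x y : EuclideanSpace ℝ (Fin n)}
  {v v' : ℕ → EuclideanSpace ℝ (Fin m)} {i : ℕ}

theorem feedbackState_add : P.feedbackState K N (x + y) (v + v') i =
    P.feedbackState K N x v i + P.feedbackState K N y v' i := by
  induction i with
  | zero => rfl
  | succ i ih =>
    simp only [feedbackState, ih, Pi.add_apply, map_add]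
    abel

theorem feedbackState_smul (c : ℝ) :
    P.feedbackState K N (c • x) (c • v) i = c • P.feedbackState K N x v i := by
  induction i with
  | zero => rfl
  | succ i ih => simp only [feedbackState, ih, Pi.smul_apply, map_add, map_smul, smul_add]

theorem feedbackInput_add : P.feedbackInput K N (x + y) (v + v') i =
    P.feedbackInput K N x v i + P.feedbackInput K N y v' i := by
  simp only [feedbackInput, feedbackState_add, Pi.add_apply, map_add]
  abel

theorem feedbackInput_smul (c : ℝ) :
    P.feedbackInput K N (c • x) (c • v) i = c • P.feedbackInput K N x v i := by
  simp only [feedbackInput, feedbackState_smul, Pi.smul_apply, map_smul, smul_add]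

theorem feedbackState_congr (h : ∀ j < i, v j = v' j) :
    P.feedbackState K N x v i = P.feedbackState K N x v' i := by
  induction i with
  | zero => rfl
  | succ i ih =>
    simp only [feedbackState, ih fun j hj => h j (hj.trans i.lt_succ_self), h i i.lt_succ_self]

theorem feedbackInput_congr (h : ∀ j ≤ i, v j = v' j) :
    P.feedbackInput K N x v i = P.feedbackInput K N x v' i := by
  rw [feedbackInput, feedbackInput, feedbackState_congr fun j hj => h j hj.le, h i le_rfl]

theorem feedbackState_add_of_eq_zero {T : ℕ} (h : ∀ i, T ≤ i → v i = 0) (i : ℕ) :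
    P.feedbackState K N x v (T + i) =
      ((P.A + P.B * K) ^ i).toE (P.feedbackState K N x v T) := by
  induction i with
  | zero => rw [add_zero, pow_zero, toE_one]
  | succ i ih =>
    rw [← add_assoc, feedbackState, h _ (Nat.le_add_right _ _), ih, pow_succ', toE_mul,
      toE_add, toE_mul, map_zero, add_zero]

theorem traj_feedbackInput (v : ℕ → EuclideanSpace ℝ (Fin m)) (i : ℕ) :
    P.traj (P.feedbackInput K N P.xinit v) i = P.feedbackState K N P.xinit v i := by
  induction i with
  | zero => rfl
  | succ i ih => rw [traj, feedbackState, ih, feedbackInput]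

theorem feedbackState_feedbackDeviation (u : ℕ → EuclideanSpace ℝ (Fin m)) (i : ℕ) :
    P.feedbackState K N P.xinit (P.feedbackDeviation K N u) i = P.traj u i := by
  induction i with
  | zero => rfl
  | succ i ih =>
    rw [feedbackState, ih, traj, feedbackDeviation, N.symm_apply_apply, add_sub_cancel]

theorem feedbackInput_feedbackDeviation (u : ℕ → EuclideanSpace ℝ (Fin m)) :
    P.feedbackInput K N P.xinit (P.feedbackDeviation K N u) = u := by
  funext i
  rw [feedbackInput, feedbackState_feedbackDeviation, feedbackDeviation, N.symm_apply_apply,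
    add_sub_cancel]

theorem feedbackDeviation_feedbackInput (v : ℕ → EuclideanSpace ℝ (Fin m)) :
    P.feedbackDeviation K N (P.feedbackInput K N P.xinit v) = v := by
  funext i
  rw [feedbackDeviation, traj_feedbackInput, feedbackInput, add_sub_cancel_left,
    N.apply_symm_apply]

theorem tendsto_lqCost {z : ℕ → EuclideanSpace ℝ (Fin n)}
    (hz : Filter.Tendsto z Filter.atTop (𝓝 0)) :
    Filter.Tendsto (fun i => lqCost Plq (z i)) Filter.atTop (𝓝 0) := by
  have hcont : Continuous (lqCost Plq) := by
    unfold lqCost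
    fun_prop
  have hzero : lqCost Plq 0 = 0 := by simp [lqCost]
  exact hzero ▸ (hcont.tendsto 0).comp hz

namespace FeedbackFactor

theorem stageCost_nonneg (h : P.FeedbackFactor Plq K N r) (x : EuclideanSpace ℝ (Fin n))
    (u : EuclideanSpace ℝ (Fin m)) : 0 ≤ P.stageCost x u :=
  (mul_nonneg h.pos.le (sq_nonneg _)).trans (h.coercive x u)

theorem lqCost_add_sum_stageCost (h : P.FeedbackFactor Plq K N r) (x : EuclideanSpace ℝ (Fin n))
    (v : ℕ → EuclideanSpace ℝ (Fin m)) (T : ℕ) :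
    lqCost Plq (P.feedbackState K N x v T) + ∑ i ∈ Finset.range T,
        P.stageCost (P.feedbackState K N x v i) (P.feedbackInput K N x v i) =
      lqCost Plq x + (1 / 2) * ∑ i ∈ Finset.range T, ‖v i‖ ^ 2 := by
  induction T with
  | zero => simp [feedbackState]
  | succ T ih =>
    have hstep := h.energy (P.feedbackState K N x v T) (P.feedbackInput K N x v T)
    have hdev : N (P.feedbackInput K N x v T - K.toE (P.feedbackState K N x v T)) = v T := by
      rw [feedbackInput, add_sub_cancel_left, N.apply_symm_apply]
    rw [hdev] at hstep
    rw [Finset.sum_range_succ, Finset.sum_range_succ, mul_add, feedbackState]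
    rw [feedbackInput] at hstep ⊢
    linarith

theorem sum_stageCost_le (h : P.FeedbackFactor Plq K N r) (x : EuclideanSpace ℝ (Fin n))
    (hv : Summable fun i => ‖v i‖ ^ 2) (T : ℕ) :
    ∑ i ∈ Finset.range T, P.stageCost (P.feedbackState K N x v i) (P.feedbackInput K N x v i) ≤
      lqCost Plq x + (1 / 2) * ∑' i, ‖v i‖ ^ 2 := by
  linarith [h.lqCost_add_sum_stageCost x v T, h.lqCost_nonneg (P.feedbackState K N x v T),
    hv.sum_le_tsum (Finset.range T) fun i _ => sq_nonneg _]

theorem sum_norm_feedbackInput_sq_le (h : P.FeedbackFactor Plq K N r)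
    (x : EuclideanSpace ℝ (Fin n)) (hv : Summable fun i => ‖v i‖ ^ 2) (T : ℕ) :
    ∑ i ∈ Finset.range T, ‖P.feedbackInput K N x v i‖ ^ 2 ≤
      r⁻¹ * (lqCost Plq x + (1 / 2) * ∑' i, ‖v i‖ ^ 2) := by
  rw [le_inv_mul_iff₀ h.pos, Finset.mul_sum]
  exact (Finset.sum_le_sum fun i _ => h.coercive _ _).trans (h.sum_stageCost_le x hv T)

theorem summable_norm_feedbackInput_sq (h : P.FeedbackFactor Plq K N r)
    (x : EuclideanSpace ℝ (Fin n)) (hv : Summable fun i => ‖v i‖ ^ 2) :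
    Summable fun i => ‖P.feedbackInput K N x v i‖ ^ 2 :=
  summable_of_sum_range_le (fun _ => sq_nonneg _) (h.sum_norm_feedbackInput_sq_le x hv)

theorem tsum_norm_feedbackInput_sq_le (h : P.FeedbackFactor Plq K N r)
    (x : EuclideanSpace ℝ (Fin n)) (hv : Summable fun i => ‖v i‖ ^ 2) :
    ∑' i, ‖P.feedbackInput K N x v i‖ ^ 2 ≤
      r⁻¹ * (lqCost Plq x + (1 / 2) * ∑' i, ‖v i‖ ^ 2) :=
  (h.summable_norm_feedbackInput_sq x hv).tsum_le_of_sum_range_le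
    (h.sum_norm_feedbackInput_sq_le x hv)

theorem summable_stageCost_of_cost_ne_top (h : P.FeedbackFactor Plq K N r)
    {u : ℕ → EuclideanSpace ℝ (Fin m)} (hu : P.cost u ≠ ⊤) :
    Summable fun i => P.stageCost (P.traj u i) (u i) :=
  (ENNReal.summable_toReal hu).congr fun _ => ENNReal.toReal_ofReal (h.stageCost_nonneg _ _)

theorem summable_stageCost (h : P.FeedbackFactor Plq K N r) (hv : Summable fun i => ‖v i‖ ^ 2) :
    Summable fun i => P.stageCost (P.feedbackState K N P.xinit v i)
      (P.feedbackInput K N P.xinit v i) :=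
  summable_of_sum_range_le (fun _ => h.stageCost_nonneg _ _) (h.sum_stageCost_le P.xinit hv)

theorem tendsto_feedbackState (h : P.FeedbackFactor Plq K N r)
    (hv : Summable fun i => ‖v i‖ ^ 2) :
    Filter.Tendsto (P.feedbackState K N P.xinit v) Filter.atTop (𝓝 0) := by
  refine (h.tendsto_traj (P.feedbackInput K N P.xinit v) ?_).congr (traj_feedbackInput v)
  simpa only [traj_feedbackInput] using h.summable_stageCost hv

theorem cost_feedbackInput (h : P.FeedbackFactor Plq K N r) (hv : Summable fun i => ‖v i‖ ^ 2) :
    P.cost (P.feedbackInput K N P.xinit v) =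
      ENNReal.ofReal (lqCost Plq P.xinit + (1 / 2) * ∑' i, ‖v i‖ ^ 2) := by
  have hs := h.summable_stageCost hv
  simp only [cost, traj_feedbackInput]
  rw [← ENNReal.ofReal_tsum_of_nonneg (fun i => h.stageCost_nonneg _ _) hs]
  congr 1
  have hcost := (tendsto_lqCost (Plq := Plq) (h.tendsto_feedbackState hv)).add
    hs.hasSum.tendsto_sum_nat
  have hdev := (hv.hasSum.tendsto_sum_nat.const_mul (1 / 2)).const_add (lqCost Plq P.xinit)
  rw [zero_add] at hcost
  exact tendsto_nhds_unique hcost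
    (hdev.congr fun T => (h.lqCost_add_sum_stageCost P.xinit v T).symm)

theorem summable_norm_feedbackDeviation_sq (h : P.FeedbackFactor Plq K N r)
    {u : ℕ → EuclideanSpace ℝ (Fin m)} (hu : P.cost u ≠ ⊤) :
    Summable fun i => ‖P.feedbackDeviation K N u i‖ ^ 2 := by
  have hs := h.summable_stageCost_of_cost_ne_top hu
  obtain ⟨b, hb⟩ := (tendsto_lqCost (Plq := Plq) (h.tendsto_traj u hs)).bddAbove_range
  refine summable_of_sum_range_le
    (c := 2 * (b + ∑' i, P.stageCost (P.traj u i) (u i))) (fun i => sq_nonneg _) fun T => ?_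
  have henergy := h.lqCost_add_sum_stageCost P.xinit (P.feedbackDeviation K N u) T
  simp only [feedbackInput_feedbackDeviation, feedbackState_feedbackDeviation] at henergy
  have hterminal : lqCost Plq (P.traj u T) ≤ b := hb ⟨T, rfl⟩
  linarith [h.lqCost_nonneg P.xinit,
    hs.sum_le_tsum (Finset.range T) fun i _ => h.stageCost_nonneg _ _]

end FeedbackFactor

end Feedback

end CLQR

/-! ### Convex quadratic functions -/

section DualQuadratic

open ContinuousLinearMap (adjoint)

variable {V H : Type*} [NormedAddCommGroup V] [InnerProductSpace ℝ V] [CompleteSpace V]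
  [NormedAddCommGroup H] [InnerProductSpace ℝ H] [CompleteSpace H] (D : V →L[ℝ] H) (d : H)

/-- The convex quadratic function `½ ‖D⋆ l‖² + ⟨l, d⟩`, which is the negated dual function of the
problem of minimizing `½ ‖v‖²` subject to `D v + d ≤ 0`, for multipliers `l ≤ 0`. -/
noncomputable def dualQuadratic (l : H) : ℝ :=
  (1 / 2) * ‖adjoint D l‖ ^ 2 + inner ℝ l d

/-- The gradient `D D⋆ l + d` of `dualQuadratic D d`. -/
noncomputable def dualQuadraticGrad (l : H) : H := D (adjoint D l) + d

theorem dualQuadratic_expand (l l₀ : H) :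
    dualQuadratic D d l = dualQuadratic D d l₀ + inner ℝ (dualQuadraticGrad D d l₀) (l - l₀) +
      (1 / 2) * ‖adjoint D (l - l₀)‖ ^ 2 := by
  obtain ⟨z, rfl⟩ : ∃ z, l = l₀ + z := ⟨l - l₀, by abel⟩
  simp only [dualQuadratic, dualQuadraticGrad, add_sub_cancel_left, map_add, norm_add_sq_real,
    inner_add_left]
  rw [← ContinuousLinearMap.adjoint_inner_right D (adjoint D l₀) z, real_inner_comm z d]
  ring

theorem hasGradientAt_dualQuadratic (l : H) :
    HasGradientAt (dualQuadratic D d) (dualQuadraticGrad D d l) l := by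
  rw [hasGradientAt_iff_hasFDerivAt]
  have hquad := ((adjoint D).hasFDerivAt (x := l)).norm_sq.const_mul (1 / 2)
  have hlin := (hasFDerivAt_id (𝕜 := ℝ) l).inner ℝ (hasFDerivAt_const d l)
  refine (hquad.add hlin).congr_fderiv (ContinuousLinearMap.ext fun z => ?_)
  simp [dualQuadraticGrad, ContinuousLinearMap.adjoint_inner_right,
    real_inner_comm]

theorem convexOn_dualQuadratic {C : Set H} (hC : Convex ℝ C) :
    ConvexOn ℝ C (dualQuadratic D d) := by
  have hquad : ConvexOn ℝ C fun l => (1 / 2 : ℝ) • ‖adjoint D l‖ ^ 2 :=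
    ((((convexOn_univ_norm (E := V)).pow (fun _ _ => norm_nonneg _) 2).comp_linearMap
      (adjoint D).toLinearMap).smul (by norm_num)).subset (Set.subset_univ C) hC
  have hlin : ConvexOn ℝ C fun l => (inner ℝ l d : ℝ) :=
    ((innerₗ H).flip d).convexOn hC
  exact hquad.add hlin

theorem norm_adjoint_sq_le_of_lipschitz {L : ℝ≥0} (h : LipschitzWith L (dualQuadraticGrad D d))
    (l : H) : ‖adjoint D l‖ ^ 2 ≤ L * ‖l‖ ^ 2 := by
  have hgrad := h.norm_sub_le l 0
  simp only [dualQuadraticGrad, map_zero, zero_add, add_sub_cancel_right, sub_zero] at hgrad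
  calc ‖adjoint D l‖ ^ 2 = inner ℝ l (D (adjoint D l)) := by
        rw [← real_inner_self_eq_norm_sq, ContinuousLinearMap.adjoint_inner_left]
    _ ≤ ‖l‖ * ‖D (adjoint D l)‖ := real_inner_le_norm _ _
    _ ≤ ‖l‖ * (L * ‖l‖) := by gcongr
    _ = L * ‖l‖ ^ 2 := by ring

theorem dualQuadratic_add_norm_sub_sq_le {L : ℝ} (hL : 0 < L)
    (h : ∀ l, ‖adjoint D l‖ ^ 2 ≤ L * ‖l‖ ^ 2) {y p z : H}
    (hp : inner ℝ (y - (1 / L) • dualQuadraticGrad D d y - p) (z - p) ≤ 0) :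
    dualQuadratic D d p + L / 2 * ‖p - z‖ ^ 2 ≤ dualQuadratic D d z + L / 2 * ‖y - z‖ ^ 2 := by
  set g := dualQuadraticGrad D d y with hg
  have hproj : L * inner ℝ (y - p) (z - p) ≤ inner ℝ g (z - p) := by
    rw [sub_right_comm, inner_sub_left, real_inner_smul_left, sub_nonpos, one_div] at hp
    exact (le_inv_mul_iff₀ hL).1 hp
  have hupper : dualQuadratic D d p ≤
      dualQuadratic D d y + inner ℝ g (p - y) + L / 2 * ‖p - y‖ ^ 2 := by
    rw [dualQuadratic_expand D d p y]
    linarith [h (p - y)]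
  have hlower : dualQuadratic D d y + inner ℝ g (z - y) ≤ dualQuadratic D d z := by
    rw [dualQuadratic_expand D d z y, ← hg]
    exact le_add_of_nonneg_right (by positivity)
  have hpyth : ‖y - z‖ ^ 2 = ‖p - y‖ ^ 2 - 2 * inner ℝ (y - p) (z - p) + ‖p - z‖ ^ 2 := by
    rw [← sub_sub_sub_cancel_right y z p, norm_sub_sq_real, norm_sub_rev y p, norm_sub_rev z p]
  have hsplit : (inner ℝ g (z - p) : ℝ) = inner ℝ g (z - y) - inner ℝ g (p - y) := by
    rw [← inner_sub_right, sub_sub_sub_cancel_right]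
  rw [hpyth]
  linarith

end DualQuadratic

/-! ### Weighted sequences -/

namespace WL2

variable {w : ℝ} [hw : Fact (0 < w)] {E : Type*} [NormedAddCommGroup E] [InnerProductSpace ℝ E]

/-- Makes the unweighted `ℓ²` available as `WL2 1`. -/
instance : Fact ((0 : ℝ) < 1) := ⟨one_pos⟩

theorem summable_norm_sq_one (v : WL2 1 E) : Summable fun i => ‖v i‖ ^ 2 := by
  simpa using v.summable_norm_sq

theorem norm_sq_eq_one (v : WL2 1 E) : ‖v‖ ^ 2 = ∑' i, ‖v i‖ ^ 2 := by
  simp [norm_sq_eq]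

theorem norm_apply_sq_le (z : WL2 w E) (i : ℕ) : w ^ i * ‖z i‖ ^ 2 ≤ ‖z‖ ^ 2 := by
  rw [norm_sq_eq]
  exact z.summable_norm_sq.le_tsum i fun j _ => mul_nonneg (pow_pos hw.out j).le (sq_nonneg _)

/-- The `i`-th entry of a weighted sequence, as a continuous linear map. -/
noncomputable def eval (i : ℕ) : WL2 w E →L[ℝ] E :=
  LinearMap.mkContinuousOfExistsBound
    { toFun := fun z => z i
      map_add' := fun _ _ => rfl
      map_smul' := fun _ _ => rfl }
    ⟨√((w ^ i)⁻¹), fun z => le_of_sq_le_sq (by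
      have hpow := pow_pos hw.out i
      rw [mul_pow, Real.sq_sqrt (inv_nonneg.2 hpow.le), le_inv_mul_iff₀ hpow]
      exact norm_apply_sq_le z i) (by positivity)⟩

@[simp] theorem eval_apply (i : ℕ) (z : WL2 w E) : eval i z = z i := rfl

section Nonpos

variable {ι : Type*} [Fintype ι]

/-- The nonpositive orthant of `ℓ²_w`, the cone of the admissible multipliers. -/
def nonpos (w : ℝ) [Fact (0 < w)] (ι : Type*) [Fintype ι] : Set (WL2 w (EuclideanSpace ℝ ι)) :=
  {z | ∀ i j, z i j ≤ 0}

theorem convex_nonpos : Convex ℝ (nonpos w ι) := by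
  intro x hx y hy a b ha hb _ i j
  exact add_nonpos (mul_nonpos_of_nonneg_of_nonpos ha (hx i j))
    (mul_nonpos_of_nonneg_of_nonpos hb (hy i j))

theorem isClosed_nonpos : IsClosed (nonpos w ι) := by
  simp only [nonpos, Set.ofPred_forall]
  exact isClosed_iInter fun i => isClosed_iInter fun j =>
    isClosed_le ((EuclideanSpace.proj j).continuous.comp (eval i).continuous) continuous_const

theorem zero_mem_nonpos : (0 : WL2 w (EuclideanSpace ℝ ι)) ∈ nonpos w ι :=
  fun _ _ => le_rfl

theorem inner_nonneg_of_mem_nonpos {y z : WL2 w (EuclideanSpace ℝ ι)} (hy : y ∈ nonpos w ι)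
    (hz : z ∈ nonpos w ι) : (0 : ℝ) ≤ inner ℝ y z := by
  rw [inner_eq]
  refine tsum_nonneg fun i => mul_nonneg (pow_pos hw.out i).le ?_
  rw [PiLp.inner_apply]
  exact Finset.sum_nonneg fun j _ => mul_nonneg_of_nonpos_of_nonpos (hz i j) (hy i j)

theorem clip_apply (z : WL2 w (EuclideanSpace ℝ ι)) (i : ℕ) (j : ι) :
    clip z i j = min (z i j) 0 := rfl

theorem clip_mem_nonpos (z : WL2 w (EuclideanSpace ℝ ι)) : clip z ∈ nonpos w ι :=
  fun _ _ => min_le_right _ _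

theorem inner_sub_clip_nonpos (x : WL2 w (EuclideanSpace ℝ ι))
    {z : WL2 w (EuclideanSpace ℝ ι)} (hz : z ∈ nonpos w ι) :
    inner ℝ (x - clip x) (z - clip x) ≤ 0 := by
  rw [inner_eq]
  refine tsum_nonpos fun i => mul_nonpos_of_nonneg_of_nonpos (pow_pos hw.out i).le ?_
  rw [PiLp.inner_apply]
  refine Finset.sum_nonpos fun j _ => ?_
  simp only [sub_apply, PiLp.sub_apply, clip_apply, RCLike.inner_apply, conj_trivial]
  rcases le_total (x i j) 0 with h | h
  · simp [h]
  · rw [min_eq_right h, sub_zero, sub_zero]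
    exact mul_nonpos_of_nonpos_of_nonneg (hz i j) h

theorem mem_nonpos_of_forall_inner_nonneg {z : WL2 w (EuclideanSpace ℝ ι)}
    (h : ∀ y ∈ nonpos w ι, (0 : ℝ) ≤ inner ℝ z y) : z ∈ nonpos w ι := by
  have hmem : clip z - z ∈ nonpos w ι := fun i j => sub_nonpos.2 (min_le_left _ _)
  have hclip := inner_sub_clip_nonpos z zero_mem_nonpos
  have hself : ‖z - clip z‖ ^ 2 =
      inner ℝ (z - clip z) (0 - clip z) - inner ℝ z (clip z - z) := by
    rw [← real_inner_self_eq_norm_sq]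
    simp only [inner_sub_left, inner_sub_right, inner_zero_right, real_inner_comm z]
    ring
  have hzero : ‖z - clip z‖ ^ 2 = 0 := le_antisymm (by linarith [h _ hmem]) (sq_nonneg _)
  have hz : z = clip z := by simpa [sub_eq_zero] using hzero
  exact hz ▸ clip_mem_nonpos z

end Nonpos

/-- The square summable sequence with the entries `z 0, …, z (T - 1)`, followed by zeros. -/
noncomputable def trunc (T : ℕ) (z : ℕ → E) : WL2 w E :=
  mk (fun i => if i < T then z i else 0) <|
    summable_of_ne_finset_zero (s := Finset.range T) fun i hi => by
      simp [mt Finset.mem_range.2 hi]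

theorem trunc_apply_of_lt {T i : ℕ} (h : i < T) (z : ℕ → E) : (trunc T z : WL2 w E) i = z i :=
  if_pos h

theorem trunc_apply_of_le {T i : ℕ} (h : T ≤ i) (z : ℕ → E) : (trunc T z : WL2 w E) i = 0 :=
  if_neg (not_lt.2 h)

theorem trunc_eq_self {T : ℕ} {z : WL2 w E} (h : ∀ i, T ≤ i → z i = 0) : trunc T z = z := by
  ext i
  rcases lt_or_ge i T with hi | hi
  · rw [trunc_apply_of_lt hi]
  · rw [trunc_apply_of_le hi, h i hi]

theorem inner_eq_sum_of_eq_zero {T : ℕ} {z : WL2 w E} (h : ∀ i, T ≤ i → z i = 0) (y : WL2 w E) :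
    (inner ℝ z y : ℝ) = ∑ i ∈ Finset.range T, w ^ i * inner ℝ (z i) (y i) := by
  rw [inner_eq, tsum_eq_sum (s := Finset.range T)]
  intro i hi
  rw [h i (not_lt.1 (mt Finset.mem_range.2 hi)), inner_zero_left, mul_zero]

theorem norm_trunc_sq (T : ℕ) (z : ℕ → E) :
    ‖(trunc T z : WL2 w E)‖ ^ 2 = ∑ i ∈ Finset.range T, w ^ i * ‖z i‖ ^ 2 := by
  rw [← real_inner_self_eq_norm_sq, inner_eq_sum_of_eq_zero fun i hi => trunc_apply_of_le hi z]
  refine Finset.sum_congr rfl fun i hi => ?_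
  rw [trunc_apply_of_lt (Finset.mem_range.1 hi), real_inner_self_eq_norm_sq]

theorem inner_trunc_sub_trunc (T : ℕ) (y : ℕ → E) (z : WL2 w E) :
    (inner ℝ (trunc T y) (z - trunc T z) : ℝ) = 0 := by
  rw [inner_eq_sum_of_eq_zero fun i hi => trunc_apply_of_le hi y]
  refine Finset.sum_eq_zero fun i hi => ?_
  rw [sub_apply, trunc_apply_of_lt (Finset.mem_range.1 hi) z, sub_self, inner_zero_right, mul_zero]

theorem adjoint_apply_eq_zero {w' : ℝ} [Fact (0 < w')] [CompleteSpace E] {F : Type*}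
    [NormedAddCommGroup F] [InnerProductSpace ℝ F] [CompleteSpace F] {D : WL2 w E →L[ℝ] WL2 w' F}
    (hD : ∀ v i, (∀ j ≤ i, v j = 0) → D v i = 0) {l : WL2 w' F} {T : ℕ}
    (hl : ∀ i, T ≤ i → l i = 0) (i : ℕ) (hi : T ≤ i) :
    ContinuousLinearMap.adjoint D l i = 0 := by
  set z := ContinuousLinearMap.adjoint D l with hz
  have horth : (inner ℝ z (z - trunc T z) : ℝ) = 0 := by
    rw [hz, ContinuousLinearMap.adjoint_inner_left, inner_eq_sum_of_eq_zero hl]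
    refine Finset.sum_eq_zero fun i hi => ?_
    rw [hD _ i fun j hj => ?_, inner_zero_right, mul_zero]
    rw [sub_apply, trunc_apply_of_lt (hj.trans_lt (Finset.mem_range.1 hi)), sub_self]
  have hself : z - trunc T z = 0 := by
    rw [← inner_self_eq_zero (𝕜 := ℝ), inner_sub_left, horth, inner_trunc_sub_trunc, sub_zero]
  rw [sub_eq_zero.1 hself, trunc_apply_of_le hi]

end WL2

namespace AdmissibleWeight

variable {n : ℕ} {A : Matrix (Fin n) (Fin n) ℝ} {w : ℝ} {E : Type*} [NormedAddCommGroup E]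

theorem pow_mul_norm_sq_le (hw : AdmissibleWeight A w) (z : E) (i : ℕ) :
    w ^ i * ‖z‖ ^ 2 ≤ ‖z‖ ^ 2 :=
  mul_le_of_le_one_left (sq_nonneg _) (pow_le_one₀ hw.pos.le hw.lt_one.le)

theorem summable_pow_mul_norm_sq (hw : AdmissibleWeight A w) {z : ℕ → E}
    (hz : Summable fun i => ‖z i‖ ^ 2) : Summable fun i => w ^ i * ‖z i‖ ^ 2 :=
  hz.of_nonneg_of_le (fun i => mul_nonneg (pow_nonneg hw.pos.le i) (sq_nonneg _))
    fun i => hw.pow_mul_norm_sq_le (z i) i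

end AdmissibleWeight

namespace CLQR

variable {n m px pu : ℕ} {P : CLQR n m px pu}

/-! ### The condensed problem in the deviations from the LQ feedback -/

section Condensed

open ContinuousLinearMap (adjoint)

variable {K : Matrix (Fin m) (Fin n) ℝ}
  {N : EuclideanSpace ℝ (Fin m) ≃L[ℝ] EuclideanSpace ℝ (Fin m)}
  {Plq : Matrix (Fin n) (Fin n) ℝ} {r : ℝ} {w : ℝ} [Fact (0 < w)]

/-- The blocks `(Cu uᵢ - cu, Cx xᵢ₊₁ - cx)` of `𝐂 u - 𝐜`, for an arbitrary input sequence `u`. -/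
noncomputable def residual (P : CLQR n m px pu) (u : ℕ → EuclideanSpace ℝ (Fin m)) (i : ℕ) :
    EuclideanSpace ℝ (Fin pu ⊕ Fin px) :=
  WithLp.toLp 2 (Sum.elim (fun j => P.Cu.toE (u i) j - P.cu j)
    fun j => P.Cx.toE (P.traj u (i + 1)) j - P.cx j)

theorem opC_sub_vecC (hw : AdmissibleWeight P.A w) (u : WL2 w (EuclideanSpace ℝ (Fin m)))
    (i : ℕ) : (P.opC hw u - P.vecC hw) i = P.residual u i := by
  ext j
  rcases j with j | j
  · rw [WL2.sub_apply, PiLp.sub_apply, opC_apply_inl]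
    simp [vecC, residual, Matrix.toE_apply, Matrix.fromRows_mulVec]
  · have hfree : (Matrix.fromRows (0 : Matrix (Fin pu) (Fin n) ℝ) P.Cx).toE (P.freeResponse hw i)
        (Sum.inr j) = P.Cx.toE (P.freeResponse hw i) j := by
      simp [Matrix.toE_apply, Matrix.fromRows_mulVec]
    rw [WL2.sub_apply, PiLp.sub_apply, opC_apply_inr]
    simp only [residual, Sum.elim_inr, ← P.stateSeq_apply hw u i, stateSeq, WL2.add_apply,
      map_add, PiLp.add_apply, vecC, WL2.sub_apply, PiLp.sub_apply, WL2.mk_apply, WL2.diag_apply,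
      hfree]
    ring

theorem residual_feedbackInput_congr {v v' : ℕ → EuclideanSpace ℝ (Fin m)} {i : ℕ}
    (hv : ∀ j ≤ i, v j = v' j) :
    P.residual (P.feedbackInput K N P.xinit v) i =
      P.residual (P.feedbackInput K N P.xinit v') i := by
  simp only [residual, traj_feedbackInput, feedbackInput_congr hv,
    feedbackState_congr fun j (hj : j < i + 1) => hv j (Nat.lt_succ_iff.1 hj)]

theorem feasible_iff {u : ℕ → EuclideanSpace ℝ (Fin m)} :
    P.Feasible u ↔ (∀ j, P.Cx.toE P.xinit j ≤ P.cx j) ∧ ∀ i j, P.residual u i j ≤ 0 := by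
  constructor
  · intro h
    refine ⟨(h 0).1, fun i j => ?_⟩
    rcases j with j | j
    · exact sub_nonpos.2 ((h i).2 j)
    · exact sub_nonpos.2 ((h (i + 1)).1 j)
  · rintro ⟨h0, h⟩ i
    refine ⟨fun j => ?_, fun j => sub_nonpos.1 (h i (Sum.inl j))⟩
    cases i with
    | zero => exact h0 j
    | succ i => exact sub_nonpos.1 (h i (Sum.inr j))

theorem residual_nonpos_of_mem_maxInvariantSet {v : ℕ → EuclideanSpace ℝ (Fin m)} {T : ℕ}
    (hv : ∀ i, T ≤ i → v i = 0)
    (hT : P.feedbackState K N P.xinit v T ∈ P.maxInvariantSet K) (i : ℕ) (hi : T ≤ i)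
    (j : Fin pu ⊕ Fin px) : P.residual (P.feedbackInput K N P.xinit v) i j ≤ 0 := by
  obtain ⟨k, rfl⟩ := Nat.exists_eq_add_of_le hi
  rcases j with j | j <;> refine sub_nonpos.2 ?_
  · rw [feedbackInput, hv _ hi, map_zero, add_zero, feedbackState_add_of_eq_zero hv]
    exact (hT k).2 j
  · rw [traj_feedbackInput, add_assoc, feedbackState_add_of_eq_zero hv]
    exact (hT (k + 1)).1 j

theorem IsStrongConvexityModulus.midpoint_le {μ : ℝ}
    (h : P.IsStrongConvexityModulus w μ) {x y : WL2 w (EuclideanSpace ℝ (Fin m))}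
    (hx : P.objective x ≠ ⊤) (hy : P.objective y ≠ ⊤) :
    (P.objective ((1 / 2 : ℝ) • x + (1 / 2 : ℝ) • y)).toReal + μ / 8 * ‖x - y‖ ^ 2 ≤
      (1 / 2) * (P.objective x).toReal + (1 / 2) * (P.objective y).toReal := by
  have hconvex := h.2 hx hy one_half_pos.le one_half_pos.le (add_halves 1)
  simp only [smul_eq_mul] at hconvex
  linarith

namespace FeedbackFactor

/-- The continuous linear map from square summable deviations to the inputs which they induce in
`ℓ²_w` when the initial state is zero. -/
noncomputable def inputOp (h : P.FeedbackFactor Plq K N r) (hw : AdmissibleWeight P.A w) :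
    WL2 1 (EuclideanSpace ℝ (Fin m)) →L[ℝ] WL2 w (EuclideanSpace ℝ (Fin m)) :=
  LinearMap.mkContinuousOfExistsBound
    { toFun := fun v => WL2.mk (P.feedbackInput K N 0 v)
        (hw.summable_pow_mul_norm_sq (h.summable_norm_feedbackInput_sq 0 v.summable_norm_sq_one))
      map_add' := fun v v' => WL2.ext fun i => by
        have hadd := feedbackInput_add (P := P) (K := K) (N := N) (x := 0) (y := 0) (v := v)
          (v' := v') (i := i)
        rw [add_zero] at hadd
        exact hadd
      map_smul' := fun c v => WL2.ext fun i => by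
        have hsmul := feedbackInput_smul (P := P) (K := K) (N := N) (x := 0) (v := v) (i := i) c
        rw [smul_zero] at hsmul
        exact hsmul }
    ⟨√(r⁻¹ * (1 / 2)), fun v => by
      have hr := h.pos
      have hs := h.summable_norm_feedbackInput_sq 0 v.summable_norm_sq_one
      refine le_of_sq_le_sq ?_ (by positivity)
      rw [mul_pow, Real.sq_sqrt (by positivity), WL2.norm_sq_eq, WL2.norm_sq_eq_one]
      calc ∑' i, w ^ i * ‖P.feedbackInput K N 0 v i‖ ^ 2
          ≤ ∑' i, ‖P.feedbackInput K N 0 v i‖ ^ 2 :=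
            (hw.summable_pow_mul_norm_sq hs).tsum_le_tsum
              (fun i => hw.pow_mul_norm_sq_le _ i) hs
        _ ≤ r⁻¹ * (lqCost Plq 0 + (1 / 2) * ∑' i, ‖v i‖ ^ 2) :=
            h.tsum_norm_feedbackInput_sq_le 0 v.summable_norm_sq_one
        _ = r⁻¹ * (1 / 2) * ∑' i, ‖v i‖ ^ 2 := by simp [lqCost, mul_assoc]⟩

/-- The input sequence of the LQ feedback, as an element of `ℓ²_w`. -/
noncomputable def lqInput (h : P.FeedbackFactor Plq K N r) (hw : AdmissibleWeight P.A w) :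
    WL2 w (EuclideanSpace ℝ (Fin m)) :=
  WL2.mk (P.feedbackInput K N P.xinit 0) (hw.summable_pow_mul_norm_sq
    (h.summable_norm_feedbackInput_sq P.xinit (v := 0) (by simp [summable_zero])))

/-- The deviation of an input of finite cost from the LQ feedback, as a square summable
sequence. -/
noncomputable def deviation (h : P.FeedbackFactor Plq K N r) {u : ℕ → EuclideanSpace ℝ (Fin m)}
    (hu : P.cost u ≠ ⊤) : WL2 1 (EuclideanSpace ℝ (Fin m)) :=
  WL2.mk (P.feedbackDeviation K N u) (by simpa using h.summable_norm_feedbackDeviation_sq hu)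

theorem feedbackInput_deviation (h : P.FeedbackFactor Plq K N r)
    {u : ℕ → EuclideanSpace ℝ (Fin m)} (hu : P.cost u ≠ ⊤) :
    P.feedbackInput K N P.xinit (h.deviation hu) = u :=
  feedbackInput_feedbackDeviation u

theorem lqCost_add_nonneg (h : P.FeedbackFactor Plq K N r)
    (v : WL2 1 (EuclideanSpace ℝ (Fin m))) : 0 ≤ lqCost Plq P.xinit + (1 / 2) * ‖v‖ ^ 2 := by
  have := h.lqCost_nonneg P.xinit
  positivity

variable (h : P.FeedbackFactor Plq K N r) (hw : AdmissibleWeight P.A w)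

theorem lqInput_add_inputOp (v : WL2 1 (EuclideanSpace ℝ (Fin m))) :
    ((h.lqInput hw + h.inputOp hw v : WL2 w (EuclideanSpace ℝ (Fin m))) :
      ℕ → EuclideanSpace ℝ (Fin m)) = P.feedbackInput K N P.xinit v := by
  funext i
  have hadd := feedbackInput_add (P := P) (K := K) (N := N) (x := P.xinit) (y := 0) (v := 0)
    (v' := v) (i := i)
  rw [add_zero, zero_add] at hadd
  exact hadd.symm

theorem objective_add_inputOp (v : WL2 1 (EuclideanSpace ℝ (Fin m))) :
    P.objective (h.lqInput hw + h.inputOp hw v) =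
      ENNReal.ofReal (lqCost Plq P.xinit + (1 / 2) * ‖v‖ ^ 2) := by
  rw [objective, h.lqInput_add_inputOp, h.cost_feedbackInput v.summable_norm_sq_one,
    WL2.norm_sq_eq_one]

theorem toReal_objective_add_inputOp (v : WL2 1 (EuclideanSpace ℝ (Fin m))) :
    (P.objective (h.lqInput hw + h.inputOp hw v)).toReal =
      lqCost Plq P.xinit + (1 / 2) * ‖v‖ ^ 2 := by
  rw [h.objective_add_inputOp, ENNReal.toReal_ofReal (h.lqCost_add_nonneg v)]

theorem exists_eq_lqInput_add_inputOp {u : WL2 w (EuclideanSpace ℝ (Fin m))}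
    (hu : P.objective u ≠ ⊤) : ∃ v, u = h.lqInput hw + h.inputOp hw v :=
  ⟨h.deviation hu, WL2.ext fun i => (congrFun ((h.lqInput_add_inputOp hw _).trans
    (h.feedbackInput_deviation hu)) i).symm⟩

theorem norm_inputOp_sq_le {μ : ℝ} (hmod : P.IsStrongConvexityModulus w μ)
    (v : WL2 1 (EuclideanSpace ℝ (Fin m))) : μ * ‖h.inputOp hw v‖ ^ 2 ≤ ‖v‖ ^ 2 := by
  have hfin (v) : P.objective (h.lqInput hw + h.inputOp hw v) ≠ ⊤ := by
    rw [h.objective_add_inputOp]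
    exact ENNReal.ofReal_ne_top
  have hmid : (1 / 2 : ℝ) • (h.lqInput hw + h.inputOp hw v) +
      (1 / 2 : ℝ) • (h.lqInput hw + h.inputOp hw 0) =
      h.lqInput hw + h.inputOp hw ((1 / 2 : ℝ) • v) := by
    rw [map_zero, map_smul]
    module
  have hle := hmod.midpoint_le (hfin v) (hfin 0)
  rw [hmid, add_sub_add_left_eq_sub, h.toReal_objective_add_inputOp,
    h.toReal_objective_add_inputOp, h.toReal_objective_add_inputOp, map_zero, sub_zero, norm_smul,
    norm_zero, mul_pow] at hle
  norm_num at hle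
  linarith

/-- The constraint operator in terms of the deviations. -/
noncomputable def constraintOp :
    WL2 1 (EuclideanSpace ℝ (Fin m)) →L[ℝ] WL2 w (EuclideanSpace ℝ (Fin pu ⊕ Fin px)) :=
  P.opC hw ∘L h.inputOp hw

/-- The residual of the constraints under the LQ feedback. -/
noncomputable def constraintVec : WL2 w (EuclideanSpace ℝ (Fin pu ⊕ Fin px)) :=
  P.opC hw (h.lqInput hw) - P.vecC hw

theorem constraintOp_add_constraintVec_apply (v : WL2 1 (EuclideanSpace ℝ (Fin m))) (i : ℕ) :
    (h.constraintOp hw v + h.constraintVec hw) i =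
      P.residual (P.feedbackInput K N P.xinit v) i := by
  have heq : h.constraintOp hw v + h.constraintVec hw =
      P.opC hw (h.lqInput hw + h.inputOp hw v) - P.vecC hw := by
    rw [map_add, constraintOp, constraintVec, ContinuousLinearMap.comp_apply]
    abel
  rw [heq, opC_sub_vecC hw, h.lqInput_add_inputOp hw]

theorem constraintOp_apply_eq_zero {v : WL2 1 (EuclideanSpace ℝ (Fin m))} {i : ℕ}
    (hv : ∀ j ≤ i, v j = 0) : h.constraintOp hw v i = 0 := by
  have heq := h.constraintOp_add_constraintVec_apply hw v i
  rw [residual_feedbackInput_congr (v' := (0 : WL2 1 (EuclideanSpace ℝ (Fin m)))) hv,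
    ← h.constraintOp_add_constraintVec_apply hw] at heq
  simpa using heq

theorem adjoint_constraintOp_apply_eq_zero {l : WL2 w (EuclideanSpace ℝ (Fin pu ⊕ Fin px))}
    {T : ℕ} (hl : ∀ i, T ≤ i → l i = 0) (i : ℕ) (hi : T ≤ i) :
    adjoint (h.constraintOp hw) l i = 0 :=
  WL2.adjoint_apply_eq_zero (fun _ _ => h.constraintOp_apply_eq_zero hw) hl i hi

theorem inner_adjoint_sub_objective (l : WL2 w (EuclideanSpace ℝ (Fin pu ⊕ Fin px)))
    (v : WL2 1 (EuclideanSpace ℝ (Fin m))) :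
    ((inner ℝ (adjoint (P.opC hw) l) (h.lqInput hw + h.inputOp hw v) : ℝ) : EReal) -
      (P.objective (h.lqInput hw + h.inputOp hw v) : EReal) =
      (((1 / 2) * ‖adjoint (h.constraintOp hw) l‖ ^ 2 + inner ℝ l (P.opC hw (h.lqInput hw)) -
        lqCost Plq P.xinit - (1 / 2) * ‖v - adjoint (h.constraintOp hw) l‖ ^ 2 : ℝ) : EReal) := by
  rw [h.objective_add_inputOp, EReal.coe_ennreal_ofReal, max_eq_left (h.lqCost_add_nonneg v),
    ← EReal.coe_sub, ContinuousLinearMap.adjoint_inner_left, map_add, inner_add_right,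
    norm_sub_sq_real, ContinuousLinearMap.adjoint_inner_right, constraintOp,
    ContinuousLinearMap.comp_apply, real_inner_comm l]
  congr 1
  ring

theorem conjObjective_adjoint (l : WL2 w (EuclideanSpace ℝ (Fin pu ⊕ Fin px))) :
    P.conjObjective (adjoint (P.opC hw) l) =
      (((1 / 2) * ‖adjoint (h.constraintOp hw) l‖ ^ 2 +
        inner ℝ l (P.opC hw (h.lqInput hw)) - lqCost Plq P.xinit : ℝ) : EReal) := by
  refine le_antisymm (iSup_le fun u => ?_) ?_
  · by_cases hu : P.objective u = ⊤
    · rw [hu, EReal.coe_ennreal_top, EReal.sub_top]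
      exact bot_le
    · obtain ⟨v, rfl⟩ := h.exists_eq_lqInput_add_inputOp hw hu
      rw [h.inner_adjoint_sub_objective]
      exact EReal.coe_le_coe (sub_le_self _ (by positivity))
  · refine le_iSup_of_le (h.lqInput hw + h.inputOp hw (adjoint (h.constraintOp hw) l)) ?_
    rw [h.inner_adjoint_sub_objective, sub_self, norm_zero]
    norm_num

theorem hStarE_eq (l : WL2 w (EuclideanSpace ℝ (Fin pu ⊕ Fin px))) :
    P.hStarE hw l =
      ((dualQuadratic (h.constraintOp hw) (h.constraintVec hw) l - lqCost Plq P.xinit : ℝ) :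
        EReal) := by
  rw [hStarE, h.conjObjective_adjoint hw, ← EReal.coe_sub, dualQuadratic, constraintVec,
    inner_sub_right]
  congr 1
  ring

theorem hStar_eq : P.hStar hw = fun l =>
    dualQuadratic (h.constraintOp hw) (h.constraintVec hw) l - lqCost Plq P.xinit := by
  funext l
  rw [hStar, h.hStarE_eq hw, EReal.toReal_coe]

theorem hasGradientAt_hStar (l : WL2 w (EuclideanSpace ℝ (Fin pu ⊕ Fin px))) :
    HasGradientAt (P.hStar hw) (dualQuadraticGrad (h.constraintOp hw) (h.constraintVec hw) l)
      l := by
  rw [h.hStar_eq hw, hasGradientAt_iff_hasFDerivAt]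
  exact (hasGradientAt_dualQuadratic _ _ l).hasFDerivAt.sub_const _

theorem gradient_hStar : gradient (P.hStar hw) =
    dualQuadraticGrad (h.constraintOp hw) (h.constraintVec hw) :=
  funext fun l => (h.hasGradientAt_hStar hw l).gradient

/-! ### Minimizers of the truncated Lagrangian -/

theorem inner_constraint_eq_sum {l : WL2 w (EuclideanSpace ℝ (Fin pu ⊕ Fin px))} {T : ℕ}
    (hl : ∀ i, T ≤ i → l i = 0) (u : ℕ → EuclideanSpace ℝ (Fin m)) :
    (inner ℝ l (h.constraintOp hw (WL2.trunc T (P.feedbackDeviation K N u)) +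
      h.constraintVec hw) : ℝ) =
      ∑ i ∈ Finset.range T, w ^ i * (∑ j, l i (Sum.inl j) * (P.Cu.toE (u i) j - P.cu j) +
        ∑ j, l i (Sum.inr j) * (P.Cx.toE (P.traj u (i + 1)) j - P.cx j)) := by
  rw [WL2.inner_eq_sum_of_eq_zero hl]
  refine Finset.sum_congr rfl fun i hi => ?_
  have htrunc : ∀ j ≤ i, (WL2.trunc T (P.feedbackDeviation K N u) : WL2 1 _) j =
      P.feedbackDeviation K N u j :=
    fun j hj => WL2.trunc_apply_of_lt (hj.trans_lt (Finset.mem_range.1 hi)) _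
  rw [h.constraintOp_add_constraintVec_apply, residual_feedbackInput_congr htrunc,
    feedbackInput_feedbackDeviation, PiLp.inner_apply, Fintype.sum_sum_type]
  simp [residual, mul_comm]

theorem truncLagrangian_eq {l : WL2 w (EuclideanSpace ℝ (Fin pu ⊕ Fin px))} {T : ℕ}
    (hl : ∀ i, T ≤ i → l i = 0) (u : ℕ → EuclideanSpace ℝ (Fin m)) :
    P.truncLagrangian Plq l T u = lqCost Plq P.xinit -
      dualQuadratic (h.constraintOp hw) (h.constraintVec hw) l +
      (1 / 2) * ‖WL2.trunc T (P.feedbackDeviation K N u) -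
        adjoint (h.constraintOp hw) l‖ ^ 2 := by
  have henergy := h.lqCost_add_sum_stageCost P.xinit (P.feedbackDeviation K N u) T
  simp only [feedbackInput_feedbackDeviation, feedbackState_feedbackDeviation, lqCost] at henergy
  rw [truncLagrangian, Finset.sum_sub_distrib, ← h.inner_constraint_eq_sum hw hl, norm_sub_sq_real,
    WL2.norm_trunc_sq, ContinuousLinearMap.adjoint_inner_right, real_inner_comm l,
    inner_add_right, dualQuadratic]
  simp only [lqCost, one_pow, one_mul]
  linarith

theorem isPrimalOf_iff {l : WL2 w (EuclideanSpace ℝ (Fin pu ⊕ Fin px))} {T : ℕ}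
    (hl : ∀ i, T ≤ i → l i = 0) (u : ℕ → EuclideanSpace ℝ (Fin m)) :
    P.IsPrimalOf Plq K l T u ↔
      u = P.feedbackInput K N P.xinit (adjoint (h.constraintOp hw) l) := by
  set z := adjoint (h.constraintOp hw) l with hz
  have hz0 : ∀ i, T ≤ i → z i = 0 := h.adjoint_constraintOp_apply_eq_zero hw hl
  have hztrunc : (WL2.trunc T z : WL2 1 _) - z = 0 := sub_eq_zero.2 (WL2.trunc_eq_self hz0)
  have hval : P.truncLagrangian Plq l T (P.feedbackInput K N P.xinit z) = lqCost Plq P.xinit -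
      dualQuadratic (h.constraintOp hw) (h.constraintVec hw) l := by
    rw [h.truncLagrangian_eq hw hl, feedbackDeviation_feedbackInput, hztrunc, norm_zero]
    ring
  constructor
  · rintro ⟨hmin, htail⟩
    have hle := hmin (P.feedbackInput K N P.xinit z)
    rw [hval, h.truncLagrangian_eq hw hl, ← hz] at hle
    have hnorm : ‖WL2.trunc T (P.feedbackDeviation K N u) - z‖ ^ 2 = 0 :=
      le_antisymm (by linarith) (sq_nonneg _)
    have hdev : WL2.trunc T (P.feedbackDeviation K N u) = z := by
      simpa [sub_eq_zero] using hnorm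
    rw [← feedbackInput_feedbackDeviation (K := K) (N := N) u]
    congr 1
    funext i
    rcases lt_or_ge i T with hi | hi
    · rw [← hdev, WL2.trunc_apply_of_lt hi]
    · rw [hz0 i hi, feedbackDeviation, ← htail i hi, sub_self, map_zero]
  · rintro rfl
    refine ⟨fun u => ?_, fun i hi => ?_⟩
    · rw [hval, h.truncLagrangian_eq hw hl]
      exact le_add_of_nonneg_right (by positivity)
    · rw [traj_feedbackInput, feedbackInput, hz0 i hi, map_zero, add_zero]

end FeedbackFactor

end Condensed

end CLQR

/-! ### Least-norm points and their multipliers -/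

section LeastNorm

open ContinuousLinearMap (adjoint)

variable {V : Type*} [NormedAddCommGroup V] [InnerProductSpace ℝ V]

/-- `v` is the point of smallest norm of the convex set `S`, described by the variational
inequality. -/
structure IsLeastNormIn (S : Set V) (v : V) : Prop where
  mem : v ∈ S
  inner_nonneg : ∀ v' ∈ S, 0 ≤ inner ℝ v (v' - v)

theorem exists_isLeastNormIn [CompleteSpace V] {S : Set V} (hne : S.Nonempty)
    (hclosed : IsClosed S) (hconv : Convex ℝ S) : ∃ v, IsLeastNormIn S v := by
  obtain ⟨v, hvS, hv⟩ := exists_norm_eq_iInf_of_complete_convex hne hclosed.isComplete hconv 0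
  refine ⟨v, hvS, fun v' hv' => ?_⟩
  simpa [inner_neg_left] using (norm_eq_iInf_iff_real_inner_le_zero hconv hvS).1 hv v' hv'

theorem IsLeastNormIn.norm_sq_add_norm_sub_sq_le {S : Set V} {v v' : V} (hv : IsLeastNormIn S v)
    (hv' : v' ∈ S) : ‖v‖ ^ 2 + ‖v' - v‖ ^ 2 ≤ ‖v'‖ ^ 2 := by
  have hexpand := norm_add_sq_real v (v' - v)
  rw [add_sub_cancel] at hexpand
  linarith [hv.inner_nonneg v' hv']

variable [CompleteSpace V] {w : ℝ} [Fact (0 < w)] {ι : Type*} [Fintype ι]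
  {D : V →L[ℝ] WL2 w (EuclideanSpace ℝ ι)} {d : WL2 w (EuclideanSpace ℝ ι)} {v : V}

/-- A Lagrange multiplier at the solution `v` of the problem of minimizing `½ ‖v‖²` subject to
`D v + d ≤ 0`, with the sign convention that multipliers are nonpositive. -/
structure IsMultiplier (D : V →L[ℝ] WL2 w (EuclideanSpace ℝ ι))
    (d : WL2 w (EuclideanSpace ℝ ι)) (v : V) (l : WL2 w (EuclideanSpace ℝ ι)) : Prop where
  nonpos : l ∈ WL2.nonpos w ι
  adjoint_eq : adjoint D l = v
  complementary : (inner ℝ l (D v + d) : ℝ) = 0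

theorem IsMultiplier.dualQuadratic_add_le {l₀ l : WL2 w (EuclideanSpace ℝ ι)}
    (hl₀ : IsMultiplier D d v l₀) (hv : D v + d ∈ WL2.nonpos w ι) (hl : l ∈ WL2.nonpos w ι) :
    dualQuadratic D d l₀ + (1 / 2) * ‖adjoint D l - v‖ ^ 2 ≤ dualQuadratic D d l := by
  rw [dualQuadratic_expand _ _ l l₀, map_sub, hl₀.adjoint_eq, dualQuadraticGrad, hl₀.adjoint_eq,
    inner_sub_right, real_inner_comm l₀, hl₀.complementary]
  linarith [WL2.inner_nonneg_of_mem_nonpos hv hl]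

theorem IsMultiplier.isMinOn {l : WL2 w (EuclideanSpace ℝ ι)} (hl : IsMultiplier D d v l)
    (hv : D v + d ∈ WL2.nonpos w ι) : IsMinOn (dualQuadratic D d) (WL2.nonpos w ι) l :=
  fun l' hl' => (le_add_of_nonneg_right (by positivity)).trans (hl.dualQuadratic_add_le hv hl')

theorem IsMultiplier.dualQuadratic_eq {l : WL2 w (EuclideanSpace ℝ ι)}
    (hl : IsMultiplier D d v l) : dualQuadratic D d l = -(1 / 2) * ‖v‖ ^ 2 := by
  have hcompl := hl.complementary
  rw [inner_add_right, ← ContinuousLinearMap.adjoint_inner_left, hl.adjoint_eq,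
    real_inner_self_eq_norm_sq] at hcompl
  rw [dualQuadratic, hl.adjoint_eq]
  linarith

theorem IsMultiplier.tendsto_adjoint {α : Type*} {F : Filter α}
    {x : α → WL2 w (EuclideanSpace ℝ ι)} {l₀ : WL2 w (EuclideanSpace ℝ ι)}
    (hl₀ : IsMultiplier D d v l₀) (hv : D v + d ∈ WL2.nonpos w ι)
    (hx : ∀ k, x k ∈ WL2.nonpos w ι)
    (hlim : Filter.Tendsto (fun k => dualQuadratic D d (x k)) F (𝓝 (dualQuadratic D d l₀))) :
    Filter.Tendsto (fun k => adjoint D (x k)) F (𝓝 v) := by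
  have hgap : Filter.Tendsto
      (fun k => 2 * (dualQuadratic D d (x k) - dualQuadratic D d l₀)) F (𝓝 0) := by
    simpa using (hlim.sub_const (dualQuadratic D d l₀)).const_mul 2
  have hsq : Filter.Tendsto (fun k => ‖adjoint D (x k) - v‖ ^ 2) F (𝓝 0) :=
    squeeze_zero (fun _ => sq_nonneg _)
      (fun k => by linarith [hl₀.dualQuadratic_add_le hv (hx k)]) hgap
  rw [tendsto_iff_norm_sub_tendsto_zero]
  simpa using hsq.sqrt

theorem IsMultiplier.of_dualQuadratic_le {l₀ l : WL2 w (EuclideanSpace ℝ ι)}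
    (hl₀ : IsMultiplier D d v l₀) (hv : D v + d ∈ WL2.nonpos w ι) (hl : l ∈ WL2.nonpos w ι)
    (hle : dualQuadratic D d l ≤ dualQuadratic D d l₀) : IsMultiplier D d v l := by
  have hdist := hl₀.dualQuadratic_add_le hv hl
  have hsq : ‖adjoint D l - v‖ ^ 2 = 0 := le_antisymm (by linarith) (sq_nonneg _)
  have hadj : adjoint D l = v := by simpa [sub_eq_zero] using hsq
  refine ⟨hl, hadj, le_antisymm ?_ (WL2.inner_nonneg_of_mem_nonpos hl hv)⟩
  rw [hl₀.dualQuadratic_eq, dualQuadratic, hadj] at hle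
  rw [inner_add_right, ← ContinuousLinearMap.adjoint_inner_left, hadj, real_inner_self_eq_norm_sq]
  linarith

theorem IsMultiplier.of_tendsto_inner {α : Type*} {F : Filter α} [F.NeBot]
    {x : α → WL2 w (EuclideanSpace ℝ ι)} {l₀ l : WL2 w (EuclideanSpace ℝ ι)}
    (hl₀ : IsMultiplier D d v l₀) (hv : D v + d ∈ WL2.nonpos w ι)
    (hx : ∀ k, x k ∈ WL2.nonpos w ι)
    (hlim : Filter.Tendsto (fun k => dualQuadratic D d (x k)) F (𝓝 (dualQuadratic D d l₀)))
    (hweak : ∀ y, Filter.Tendsto (fun k => (inner ℝ y (x k) : ℝ)) F (𝓝 (inner ℝ y l))) :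
    IsMultiplier D d v l := by
  have hl : l ∈ WL2.nonpos w ι := WL2.mem_nonpos_of_forall_inner_nonneg fun y hy => by
    rw [real_inner_comm]
    exact ge_of_tendsto (hweak y) (.of_forall fun k => WL2.inner_nonneg_of_mem_nonpos hy (hx k))
  have hlin : Filter.Tendsto
      (fun k => dualQuadratic D d l + inner ℝ (dualQuadraticGrad D d l) (x k - l)) F
      (𝓝 (dualQuadratic D d l)) := by
    simpa [inner_sub_right] using ((hweak (dualQuadraticGrad D d l)).sub_const
      (inner ℝ (dualQuadraticGrad D d l) l)).const_add (dualQuadratic D d l)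
  refine hl₀.of_dualQuadratic_le hv hl (le_of_tendsto_of_tendsto hlin hlim (.of_forall fun k => ?_))
  simp only [dualQuadratic_expand D d (x k) l]
  exact le_add_of_nonneg_right (by positivity)

theorem exists_isMultiplier_of_forall_active (s : Finset (ℕ × ι))
    (hs : ∀ p ∈ s, (D v + d) p.1 p.2 = 0)
    (hv : ∀ e, (∀ p ∈ s, D e p.1 p.2 ≤ 0) → (0 : ℝ) ≤ inner ℝ v e) :
    ∃ l, IsMultiplier D d v l := by
  let coord (p : ℕ × ι) : WL2 w (EuclideanSpace ℝ ι) →L[ℝ] ℝ :=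
    EuclideanSpace.proj p.2 ∘L WL2.eval p.1
  obtain ⟨c, hc, hsum⟩ := exists_nonneg_eq_sum_smul_of_forall_nonpos s
    (fun p => (coord p ∘L D).toLinearMap) (-(innerSL ℝ v).toLinearMap)
    fun e he => neg_nonpos.2 (hv e he)
  let l := (InnerProductSpace.toDual ℝ _).symm (-∑ p ∈ s, c p • coord p)
  have hinner (z) : (inner ℝ l z : ℝ) = -∑ p ∈ s, c p * z p.1 p.2 := by
    rw [InnerProductSpace.toDual_symm_apply]
    simp [coord]
  refine ⟨l, WL2.mem_nonpos_of_forall_inner_nonneg fun y hy => ?_, ?_, ?_⟩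
  · rw [hinner, neg_nonneg]
    exact Finset.sum_nonpos fun p _ => mul_nonpos_of_nonneg_of_nonpos (hc p) (hy _ _)
  · refine ext_inner_right ℝ fun e => ?_
    have heq := LinearMap.congr_fun hsum e
    simp only [LinearMap.neg_apply, LinearMap.sum_apply, LinearMap.smul_apply, smul_eq_mul] at heq
    rw [ContinuousLinearMap.adjoint_inner_left, hinner, neg_eq_iff_eq_neg]
    exact heq.symm
  · rw [hinner, Finset.sum_eq_zero fun p hp => ?_, neg_zero]
    rw [hs p hp, mul_zero]

end LeastNorm

theorem eventually_add_mul_nonpos {a b : ℝ} (ha : a ≤ 0) (hb : a = 0 → b ≤ 0) :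
    ∀ᶠ t : ℝ in 𝓝[>] 0, a + t * b ≤ 0 := by
  rcases ha.eq_or_lt with h0 | h0
  · filter_upwards [self_mem_nhdsWithin] with t ht
    rw [h0, zero_add]
    exact mul_nonpos_of_nonneg_of_nonpos (le_of_lt ht) (hb h0)
  · have hlim : Filter.Tendsto (fun t : ℝ => a + t * b) (𝓝[>] 0) (𝓝 (a + 0 * b)) :=
      (Continuous.tendsto (by fun_prop) 0).mono_left nhdsWithin_le_nhds
    rw [zero_mul, add_zero] at hlim
    exact (hlim.eventually_lt_const h0).mono fun t ht => ht.le

namespace CLQR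

variable {n m px pu : ℕ} {P : CLQR n m px pu}

/-! ### The optimal primal-dual pair -/

section Optimal

variable {K : Matrix (Fin m) (Fin n) ℝ}
  {N : EuclideanSpace ℝ (Fin m) ≃L[ℝ] EuclideanSpace ℝ (Fin m)}
  {Plq : Matrix (Fin n) (Fin n) ℝ} {r : ℝ} {w : ℝ} [Fact (0 < w)]

theorem exists_feasible_of_value_ne_top (hval : P.value ≠ ⊤) :
    ∃ u, P.Feasible u ∧ P.cost u ≠ ⊤ := by
  by_contra! hcon
  exact hval (iInf_eq_top.2 fun u => hcon u.1 u.2)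

namespace FeedbackFactor

/-- The deviations whose inputs and states satisfy the constraints, except possibly the state
constraint at time `0`. -/
def feasibleSet (h : P.FeedbackFactor Plq K N r) (hw : AdmissibleWeight P.A w) :
    Set (WL2 1 (EuclideanSpace ℝ (Fin m))) :=
  {v | h.constraintOp hw v + h.constraintVec hw ∈ WL2.nonpos w (Fin pu ⊕ Fin px)}

variable {h : P.FeedbackFactor Plq K N r} {hw : AdmissibleWeight P.A w}
  {v : WL2 1 (EuclideanSpace ℝ (Fin m))}

theorem mem_feasibleSet_iff :
    v ∈ h.feasibleSet hw ↔ ∀ i j, P.residual (P.feedbackInput K N P.xinit v) i j ≤ 0 := by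
  simp only [feasibleSet, WL2.nonpos, Set.mem_ofPred_eq, h.constraintOp_add_constraintVec_apply]

theorem feasible_feedbackInput_iff (h0 : ∀ j, P.Cx.toE P.xinit j ≤ P.cx j) :
    P.Feasible (P.feedbackInput K N P.xinit v) ↔ v ∈ h.feasibleSet hw := by
  rw [feasible_iff, mem_feasibleSet_iff, and_iff_right h0]

theorem isClosed_feasibleSet : IsClosed (h.feasibleSet hw) :=
  WL2.isClosed_nonpos.preimage (by fun_prop)

theorem convex_feasibleSet : Convex ℝ (h.feasibleSet hw) :=
  (WL2.convex_nonpos.translate_preimage_left _).linear_preimage (h.constraintOp hw).toLinearMap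

theorem exists_isLeastNormIn_feasibleSet (h : P.FeedbackFactor Plq K N r)
    (hw : AdmissibleWeight P.A w) {u : ℕ → EuclideanSpace ℝ (Fin m)} (hu : P.Feasible u)
    (hcost : P.cost u ≠ ⊤) : ∃ v, IsLeastNormIn (h.feasibleSet hw) v := by
  refine exists_isLeastNormIn ⟨h.deviation hcost, ?_⟩ isClosed_feasibleSet convex_feasibleSet
  rw [mem_feasibleSet_iff, h.feedbackInput_deviation]
  exact (feasible_iff.1 hu).2

theorem cost_feedbackInput_le_iff {v' : WL2 1 (EuclideanSpace ℝ (Fin m))}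
    (h : P.FeedbackFactor Plq K N r) :
    P.cost (P.feedbackInput K N P.xinit v) ≤ P.cost (P.feedbackInput K N P.xinit v') ↔
      ‖v‖ ^ 2 ≤ ‖v'‖ ^ 2 := by
  rw [h.cost_feedbackInput v.summable_norm_sq_one, h.cost_feedbackInput v'.summable_norm_sq_one,
    ← WL2.norm_sq_eq_one, ← WL2.norm_sq_eq_one,
    ENNReal.ofReal_le_ofReal_iff (h.lqCost_add_nonneg _)]
  constructor <;> intro <;> linarith

theorem isOptimal_iff (hv : IsLeastNormIn (h.feasibleSet hw) v)
    (h0 : ∀ j, P.Cx.toE P.xinit j ≤ P.cx j) (u : ℕ → EuclideanSpace ℝ (Fin m)) :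
    P.IsOptimal u ↔ u = P.feedbackInput K N P.xinit v := by
  have hfeas := (feasible_feedbackInput_iff h0).2 hv.mem
  have hfin : P.cost (P.feedbackInput K N P.xinit v) ≠ ⊤ := by
    rw [h.cost_feedbackInput v.summable_norm_sq_one]
    exact ENNReal.ofReal_ne_top
  constructor
  · rintro ⟨hu, hmin⟩
    obtain ⟨v', rfl⟩ : ∃ v' : WL2 1 (EuclideanSpace ℝ (Fin m)),
        P.feedbackInput K N P.xinit v' = u :=
      ⟨_, h.feedbackInput_deviation (ne_top_of_le_ne_top hfin (hmin _ hfeas))⟩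
    have hle := (cost_feedbackInput_le_iff h).1 (hmin _ hfeas)
    have hdist := hv.norm_sq_add_norm_sub_sq_le ((feasible_feedbackInput_iff h0).1 hu)
    have hzero : ‖v' - v‖ ^ 2 = 0 := le_antisymm (by linarith) (sq_nonneg _)
    have heq : v' = v := by simpa [sub_eq_zero] using hzero
    rw [heq]
  · rintro rfl
    refine ⟨hfeas, fun u hu => ?_⟩
    rcases eq_or_ne (P.cost u) ⊤ with htop | htop
    · exact htop ▸ le_top
    · rw [← h.feedbackInput_deviation htop] at hu ⊢
      have hdist := hv.norm_sq_add_norm_sub_sq_le ((feasible_feedbackInput_iff h0).1 hu)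
      exact (cost_feedbackInput_le_iff h).2 (by linarith [sq_nonneg ‖h.deviation htop - v‖])

/-- Once the state lies in the invariant set, the LQ feedback remains feasible, so that deviating
from it is of no use. -/
theorem apply_eq_zero_of_isLeastNormIn (hv : IsLeastNormIn (h.feasibleSet hw) v) {T : ℕ}
    (hT : P.feedbackState K N P.xinit v T ∈ P.maxInvariantSet K) (i : ℕ) (hi : T ≤ i) :
    v i = 0 := by
  have hstate : P.feedbackState K N P.xinit (WL2.trunc T v : WL2 1 _) T =
      P.feedbackState K N P.xinit v T :=
    feedbackState_congr fun j hj => WL2.trunc_apply_of_lt hj v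
  have hmem : WL2.trunc T v ∈ h.feasibleSet hw := by
    refine mem_feasibleSet_iff.2 fun i j => ?_
    rcases lt_or_ge i T with hi | hi
    · rw [residual_feedbackInput_congr fun k hk => WL2.trunc_apply_of_lt (hk.trans_lt hi) v]
      exact mem_feasibleSet_iff.1 hv.mem i j
    · exact residual_nonpos_of_mem_maxInvariantSet
        (fun k hk => WL2.trunc_apply_of_le hk v) (hstate ▸ hT) i hi j
  have hself : ‖v - WL2.trunc T v‖ ^ 2 = -(inner ℝ v (WL2.trunc T v - v) : ℝ) := by
    rw [← real_inner_self_eq_norm_sq, inner_sub_left, WL2.inner_trunc_sub_trunc, sub_zero,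
      ← inner_neg_right, neg_sub]
  have hzero : ‖v - WL2.trunc T v‖ ^ 2 = 0 :=
    le_antisymm (by linarith [hv.inner_nonneg _ hmem]) (sq_nonneg _)
  have heq : v = WL2.trunc T v := by simpa [sub_eq_zero] using hzero
  rw [heq, WL2.trunc_apply_of_le hi]

theorem eventually_feedbackState_add_smul_mem {T : ℕ}
    {e : WL2 1 (EuclideanSpace ℝ (Fin m))} {W : Set (EuclideanSpace ℝ (Fin n))}
    (hT : P.feedbackState K N P.xinit v T ∈ interior W) :
    ∀ᶠ t : ℝ in 𝓝[>] 0, P.feedbackState K N P.xinit (v + t • e) T ∈ W := by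
  have hline (t : ℝ) : P.feedbackState K N P.xinit (v + t • e) T =
      P.feedbackState K N P.xinit v T + t • P.feedbackState K N 0 e T := by
    rw [← feedbackState_smul, ← feedbackState_add, smul_zero, add_zero]
  have hlim : Filter.Tendsto (fun t : ℝ => P.feedbackState K N P.xinit (v + t • e) T) (𝓝[>] 0)
      (𝓝 (P.feedbackState K N P.xinit v T + (0 : ℝ) • P.feedbackState K N 0 e T)) := by
    simp only [hline]
    exact (Continuous.tendsto (by fun_prop) 0).mono_left nhdsWithin_le_nhds
  rw [zero_smul, add_zero] at hlim
  exact hlim.eventually_mem (mem_interior_iff_mem_nhds.1 hT)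

theorem eventually_add_smul_mem_feasibleSet (hv : v ∈ h.feasibleSet hw) {T : ℕ}
    (hvT : ∀ i, T ≤ i → v i = 0)
    (hT : P.feedbackState K N P.xinit v T ∈ interior (P.maxInvariantSet K))
    {e : WL2 1 (EuclideanSpace ℝ (Fin m))} (heT : ∀ i, T ≤ i → e i = 0)
    (he : ∀ i < T, ∀ j, (h.constraintOp hw v + h.constraintVec hw) i j = 0 →
      h.constraintOp hw e i j ≤ 0) :
    ∀ᶠ t : ℝ in 𝓝[>] 0, v + t • e ∈ h.feasibleSet hw := by
  have hline (t : ℝ) (i j) : (h.constraintOp hw (v + t • e) + h.constraintVec hw) i j =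
      (h.constraintOp hw v + h.constraintVec hw) i j + t * h.constraintOp hw e i j := by
    rw [map_add, map_smul]
    simp only [WL2.add_apply, WL2.smul_apply, PiLp.add_apply, PiLp.smul_apply, smul_eq_mul]
    ring
  have hbefore : ∀ᶠ t : ℝ in 𝓝[>] 0, ∀ i ∈ Finset.range T, ∀ j,
      (h.constraintOp hw (v + t • e) + h.constraintVec hw) i j ≤ 0 := by
    simp only [hline]
    exact (Filter.eventually_all_finset _).2 fun i hi => Filter.eventually_all.2 fun j =>
      eventually_add_mul_nonpos (hv i j) (he i (Finset.mem_range.1 hi) j)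
  filter_upwards [hbefore, eventually_feedbackState_add_smul_mem hT] with t hbefore hmem i j
  rcases lt_or_ge i T with hi | hi
  · exact hbefore i (Finset.mem_range.2 hi) j
  · rw [h.constraintOp_add_constraintVec_apply]
    refine residual_nonpos_of_mem_maxInvariantSet (fun k hk => ?_) hmem i hi j
    simp [hvT k hk, heT k hk]

/-- A multiplier exists because only finitely many constraints matter at `v`: the optimal state
enters the interior of the invariant set in finite time. -/
theorem exists_isMultiplier (hv : IsLeastNormIn (h.feasibleSet hw) v)
    (hint : (0 : EuclideanSpace ℝ (Fin n)) ∈ interior (P.maxInvariantSet K)) :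
    ∃ l, IsMultiplier (h.constraintOp hw) (h.constraintVec hw) v l := by
  classical
  obtain ⟨T, hT⟩ := ((h.tendsto_feedbackState v.summable_norm_sq_one).eventually_mem
    (isOpen_interior.mem_nhds hint)).exists
  have hvT : ∀ i, T ≤ i → v i = 0 := apply_eq_zero_of_isLeastNormIn hv (interior_subset hT)
  refine exists_isMultiplier_of_forall_active
    {p ∈ Finset.range T ×ˢ Finset.univ | (h.constraintOp hw v + h.constraintVec hw) p.1 p.2 = 0}
    (fun p hp => (Finset.mem_filter.1 hp).2) fun e he => ?_
  have hlocal {i : ℕ} (hi : i < T) :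
      h.constraintOp hw (WL2.trunc T e) i = h.constraintOp hw e i := by
    rw [← sub_eq_zero, ← WL2.sub_apply, ← map_sub]
    refine h.constraintOp_apply_eq_zero hw fun j hj => ?_
    rw [WL2.sub_apply, WL2.trunc_apply_of_lt (hj.trans_lt hi), sub_self]
  have hactive : ∀ i < T, ∀ j, (h.constraintOp hw v + h.constraintVec hw) i j = 0 →
      h.constraintOp hw (WL2.trunc T e) i j ≤ 0 := fun i hi j hij => by
    rw [hlocal hi]
    exact he (i, j) (Finset.mem_filter.2
      ⟨Finset.mem_product.2 ⟨Finset.mem_range.2 hi, Finset.mem_univ j⟩, hij⟩)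
  obtain ⟨t, hmem, ht⟩ := ((eventually_add_smul_mem_feasibleSet hv.mem hvT hT
    (fun i hi => WL2.trunc_apply_of_le hi e) hactive).and self_mem_nhdsWithin).exists
  have hnonneg := hv.inner_nonneg _ hmem
  rw [add_sub_cancel_left, inner_smul_right] at hnonneg
  have horth := WL2.inner_trunc_sub_trunc T v e
  rw [WL2.trunc_eq_self hvT, inner_sub_right, sub_eq_zero] at horth
  exact horth ▸ nonneg_of_mul_nonneg_right hnonneg ht

end FeedbackFactor

end Optimal

end CLQR

/-! ### The dual iteration and its horizons -/

theorem bddAbove_range_of_eventually_succ_le_sup {α : Type*} [SemilatticeSup α] {T : ℕ → α} {b : α}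
    (h : ∀ᶠ k in Filter.atTop, T (k + 1) ≤ T k ⊔ b) : BddAbove (Set.range T) := by
  obtain ⟨k₀, hk₀⟩ := Filter.eventually_atTop.1 h
  have hbound : ∀ k ≥ k₀, T k ≤ T k₀ ⊔ b := fun k hk => by
    induction k, hk using Nat.le_induction with
    | base => exact le_sup_left
    | succ k hk ih => exact (hk₀ k hk).trans (sup_le ih le_sup_right)
  have : Nonempty α := ⟨b⟩
  exact Filter.IsBoundedUnder.bddAbove_range ⟨_, Filter.eventually_map.2
    (Filter.eventually_atTop.2 ⟨k₀, hbound⟩)⟩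

namespace CLQR

variable {n m px pu : ℕ} {P : CLQR n m px pu}

section Horizon

open ContinuousLinearMap (adjoint)

variable {K : Matrix (Fin m) (Fin n) ℝ}
  {N : EuclideanSpace ℝ (Fin m) ≃L[ℝ] EuclideanSpace ℝ (Fin m)}
  {Plq : Matrix (Fin n) (Fin n) ℝ} {r : ℝ} {w : ℝ} [Fact (0 < w)]
  {S : Set (EuclideanSpace ℝ (Fin n))} {cmp : ℝ → ℝ → Prop}

/-- The states in `S` at which the LQ feedback satisfies the constraints on the current input and
the next state, with the inequality `cmp`. -/
def terminalSet (P : CLQR n m px pu) (cmp : ℝ → ℝ → Prop) (K : Matrix (Fin m) (Fin n) ℝ)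
    (S : Set (EuclideanSpace ℝ (Fin n))) : Set (EuclideanSpace ℝ (Fin n)) :=
  {x | x ∈ S ∧ (∀ j, cmp (P.Cx.toE (P.A.toE x + P.B.toE (K.toE x)) j) (P.cx j)) ∧
    ∀ j, cmp (P.Cu.toE (K.toE x) j) (P.cu j)}

theorem terminalSet_mem_nhds_zero (hS : S ⊆ P.maxInvariantSet K)
    (hS0 : (0 : EuclideanSpace ℝ (Fin n)) ∈ interior S)
    (hcmp : cmp = (· ≤ ·) ∨ (cmp = (· < ·) ∧ (∀ j, 0 < P.cx j) ∧ ∀ j, 0 < P.cu j)) :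
    P.terminalSet cmp K S ∈ 𝓝 0 := by
  rw [mem_interior_iff_mem_nhds] at hS0
  rcases hcmp with rfl | ⟨rfl, hcx, hcu⟩
  · filter_upwards [hS0] with x hx
    refine ⟨hx, ?_, ?_⟩
    · simpa [toE_add, toE_mul] using (hS hx 1).1
    · simpa [toE_one] using (hS hx 0).2
  · have hstate (j) : ∀ᶠ x in 𝓝 (0 : EuclideanSpace ℝ (Fin n)),
        P.Cx.toE (P.A.toE x + P.B.toE (K.toE x)) j < P.cx j :=
      Filter.Tendsto.eventually_lt_const (by simpa using hcx j)
        (Continuous.tendsto (by fun_prop) 0)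
    have hinput (j) : ∀ᶠ x in 𝓝 (0 : EuclideanSpace ℝ (Fin n)), P.Cu.toE (K.toE x) j < P.cu j :=
      Filter.Tendsto.eventually_lt_const (by simpa using hcu j)
        (Continuous.tendsto (by fun_prop) 0)
    filter_upwards [hS0, Filter.eventually_all.2 hstate, Filter.eventually_all.2 hinput]
      with x hx hxstate hxinput using ⟨hx, hxstate, hxinput⟩

theorem exists_clm_eq_feedbackState (i : ℕ) :
    ∃ g : WL2 1 (EuclideanSpace ℝ (Fin m)) →L[ℝ] EuclideanSpace ℝ (Fin n),
      ∀ v : WL2 1 (EuclideanSpace ℝ (Fin m)), g v = P.feedbackState K N 0 v i := by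
  induction i with
  | zero => exact ⟨0, fun v => rfl⟩
  | succ i ih =>
    obtain ⟨g, hg⟩ := ih
    exact ⟨P.A.toE ∘L g + P.B.toE ∘L (K.toE ∘L g + N.symm ∘L WL2.eval i),
      fun v => by simp [hg, feedbackState]⟩

namespace FeedbackFactor

theorem exists_norm_feedbackState_le (h : P.FeedbackFactor Plq K N r) :
    ∃ κ : ℝ, ∀ (v : WL2 1 (EuclideanSpace ℝ (Fin m))) (i : ℕ),
      ‖P.feedbackState K N 0 v i‖ ≤ κ * ‖v‖ := by
  choose g hg using exists_clm_eq_feedbackState (P := P) (K := K) (N := N)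
  obtain ⟨κ, hκ⟩ := banach_steinhaus (g := g) fun v => by
    have hlim := (h.tendsto_feedbackState v.summable_norm_sq_one).sub
      (h.tendsto_feedbackState (0 : WL2 1 (EuclideanSpace ℝ (Fin m))).summable_norm_sq_one)
    have hdiff (i) : P.feedbackState K N P.xinit v i -
        P.feedbackState K N P.xinit (0 : WL2 1 (EuclideanSpace ℝ (Fin m))) i =
          P.feedbackState K N 0 v i := by
      rw [sub_eq_iff_eq_add', ← feedbackState_add, add_zero]
      exact congrArg (P.feedbackState K N P.xinit · i) (zero_add (v : ℕ → _)).symm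
    obtain ⟨b, hb⟩ := (hlim.congr hdiff).norm.bddAbove_range
    exact ⟨b, fun i => hg i v ▸ hb ⟨i, rfl⟩⟩
  exact ⟨κ, fun v i => hg i v ▸ (g i).le_of_opNorm_le (hκ i) v⟩

theorem exists_eventually_forall_feedbackState_mem (h : P.FeedbackFactor Plq K N r)
    (v : WL2 1 (EuclideanSpace ℝ (Fin m))) {W : Set (EuclideanSpace ℝ (Fin n))} (hW : W ∈ 𝓝 0) :
    ∃ T : ℕ, ∀ᶠ v' : WL2 1 (EuclideanSpace ℝ (Fin m)) in 𝓝 v,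
      ∀ i, T ≤ i → P.feedbackState K N P.xinit v' i ∈ W := by
  obtain ⟨ε, hε, hball⟩ := Metric.mem_nhds_iff.1 hW
  obtain ⟨κ, hκ⟩ := h.exists_norm_feedbackState_le
  have hstate := (h.tendsto_feedbackState v.summable_norm_sq_one).norm
  rw [norm_zero] at hstate
  obtain ⟨T, hT⟩ := Filter.eventually_atTop.1 (hstate.eventually_lt_const (half_pos hε))
  have hnear : ∀ᶠ v' in 𝓝 v, κ * ‖v' - v‖ < ε / 2 :=
    Filter.Tendsto.eventually_lt_const (by simpa using half_pos hε)
      (Continuous.tendsto (by fun_prop) v)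
  refine ⟨T, hnear.mono fun v' hv' i hi => hball (mem_ball_zero_iff.2 ?_)⟩
  have hsplit : P.feedbackState K N P.xinit v' i =
      P.feedbackState K N P.xinit v i + P.feedbackState K N 0 ↑(v' - v) i := by
    rw [← feedbackState_add, add_zero]
    exact congrArg (P.feedbackState K N P.xinit · i) (add_sub_cancel (v : ℕ → _) v').symm
  calc ‖P.feedbackState K N P.xinit v' i‖
      ≤ ‖P.feedbackState K N P.xinit v i‖ + ‖P.feedbackState K N 0 ↑(v' - v) i‖ :=
        hsplit ▸ norm_add_le _ _
    _ < ε := by linarith [hT i hi, hκ (v' - v) i]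

variable {hw : AdmissibleWeight P.A w} {h : P.FeedbackFactor Plq K N r}
  {l : WL2 w (EuclideanSpace ℝ (Fin pu ⊕ Fin px))} {T T' : ℕ}

theorem mem_horizonCandidates (hl : ∀ i, T ≤ i → l i = 0) (hTT' : T ≤ T')
    (hT' : P.feedbackState K N P.xinit (adjoint (h.constraintOp hw) l) T' ∈
      P.terminalSet cmp K S) :
    T' ∈ P.horizonCandidates cmp Plq K S l T := by
  obtain ⟨hmem, hstate, hinput⟩ := hT'
  refine ⟨hTT', _, (h.isPrimalOf_iff hw hl _).2 rfl, T', le_rfl, ?_, fun i hi hi' => ?_⟩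
  · rwa [traj_feedbackInput]
  · obtain rfl : i = T' := le_antisymm hi' hi
    rw [traj_feedbackInput, feedbackState, feedbackInput,
      h.adjoint_constraintOp_apply_eq_zero hw hl i hTT', map_zero, add_zero]
    exact ⟨hstate, hinput⟩

theorem horizonCandidates_nonempty (h : P.FeedbackFactor Plq K N r) (hw : AdmissibleWeight P.A w)
    (hterm : P.terminalSet cmp K S ∈ 𝓝 0) (hl : ∀ i, T ≤ i → l i = 0) :
    (P.horizonCandidates cmp Plq K S l T).Nonempty := by
  obtain ⟨T', hTT', hT'⟩ := ((Filter.eventually_ge_atTop T).and ((h.tendsto_feedbackState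
    (adjoint (h.constraintOp hw) l).summable_norm_sq_one).eventually_mem hterm)).exists
  exact ⟨T', mem_horizonCandidates hl hTT' hT'⟩

theorem dualQuadraticGrad_apply_nonpos (hS : S ⊆ P.maxInvariantSet K)
    (hcmp : ∀ x y, cmp x y → x ≤ y) (hl : ∀ i, T ≤ i → l i = 0)
    (hT' : T' ∈ P.horizonCandidates cmp Plq K S l T) (i : ℕ) (hi : T' ≤ i)
    (j : Fin pu ⊕ Fin px) :
    dualQuadraticGrad (h.constraintOp hw) (h.constraintVec hw) l i j ≤ 0 := by
  obtain ⟨hTT', u, hu, TS, hTS, hmem, hcons⟩ := hT'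
  rw [h.isPrimalOf_iff hw hl] at hu
  rw [dualQuadraticGrad, h.constraintOp_add_constraintVec_apply, ← hu]
  rcases le_or_gt i TS with hiS | hiS
  · rcases j with j | j
    · exact sub_nonpos.2 (hcmp _ _ ((hcons i hi hiS).2 j))
    · exact sub_nonpos.2 (hcmp _ _ ((hcons i hi hiS).1 j))
  · subst hu
    rw [traj_feedbackInput] at hmem
    refine residual_nonpos_of_mem_maxInvariantSet (fun k hk => ?_) (hS hmem) i hiS.le j
    exact h.adjoint_constraintOp_apply_eq_zero hw hl k ((hTT'.trans hTS).trans hk)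

variable {a : ℝ} {L : ℝ≥0}

theorem dualIter_succ_apply_eq_zero (h : P.FeedbackFactor Plq K N r)
    (hS : S ⊆ P.maxInvariantSet K) (hcmp : ∀ x y, cmp x y → x ≤ y) {k : ℕ}
    (hl : ∀ i, T ≤ i → P.dualHat hw a L k i = 0)
    (hT' : T' ∈ P.horizonCandidates cmp Plq K S (P.dualHat hw a L k) T) (i : ℕ) (hi : T' ≤ i) :
    P.dualIter hw a L (k + 1) i = 0 := by
  ext j
  have hgrad := dualQuadraticGrad_apply_nonpos (h := h) (hw := hw) hS hcmp hl hT' i hi j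
  change min ((P.dualHat hw a L k - (1 / (L : ℝ)) • gradient (P.hStar hw) (P.dualHat hw a L k)) i j)
    0 = 0
  rw [h.gradient_hStar hw, WL2.sub_apply, WL2.smul_apply, hl i (hT'.1.trans hi), zero_sub]
  refine min_eq_right (neg_nonneg.2 (mul_nonpos_of_nonneg_of_nonpos (by positivity) hgrad))

theorem dualIter_apply_eq_zero (h : P.FeedbackFactor Plq K N r)
    (hS : S ⊆ P.maxInvariantSet K) (hcmp : ∀ x y, cmp x y → x ≤ y)
    (hterm : P.terminalSet cmp K S ∈ 𝓝 0) (k : ℕ) :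
    ∀ i, P.horizon cmp Plq K S hw a L k ≤ i →
      P.dualIter hw a L k i = 0 ∧ P.dualHat hw a L k i = 0 := by
  have hhat {k i} (hiter : P.dualIter hw a L k i = 0) (hpred : (P.dualPair hw a L k).2 i = 0) :
      P.dualHat hw a L k i = 0 := by
    rw [dualHat, WL2.add_apply, WL2.smul_apply, WL2.sub_apply, hiter, hpred, sub_self, smul_zero,
      add_zero]
  induction k with
  | zero => exact fun i _ => ⟨rfl, hhat rfl rfl⟩
  | succ k ih =>
    intro i hi
    have hl : ∀ i, P.horizon cmp Plq K S hw a L k ≤ i → P.dualHat hw a L k i = 0 :=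
      fun i hi => (ih i hi).2
    have hmem : P.horizon cmp Plq K S hw a L (k + 1) ∈ _ :=
      Nat.sInf_mem (h.horizonCandidates_nonempty hw hterm hl)
    have hzero := h.dualIter_succ_apply_eq_zero hS hcmp hl hmem i hi
    exact ⟨hzero, hhat hzero (ih i (hmem.1.trans hi)).1⟩

theorem bddAbove_range_horizon (h : P.FeedbackFactor Plq K N r)
    (hS : S ⊆ P.maxInvariantSet K) (hcmp : ∀ x y, cmp x y → x ≤ y)
    (hterm : P.terminalSet cmp K S ∈ 𝓝 0) {v : WL2 1 (EuclideanSpace ℝ (Fin m))}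
    (hlim : Filter.Tendsto (fun k => adjoint (h.constraintOp hw) (P.dualHat hw a L k))
      Filter.atTop (𝓝 v)) :
    BddAbove (Set.range (P.horizon cmp Plq K S hw a L)) := by
  obtain ⟨T, hT⟩ := h.exists_eventually_forall_feedbackState_mem v hterm
  refine bddAbove_range_of_eventually_succ_le_sup (b := T) ?_
  filter_upwards [hlim.eventually hT] with k hk
  exact Nat.sInf_le (mem_horizonCandidates
    (fun i hi => (h.dualIter_apply_eq_zero hS hcmp hterm k i hi).2) le_sup_left
    (hk _ le_sup_right))

end FeedbackFactor

end Horizon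

end CLQR

/-! ### Convergence -/

namespace CLQR

variable {n m px pu : ℕ} {P : CLQR n m px pu}

section Convergence

open ContinuousLinearMap (adjoint)

variable {K : Matrix (Fin m) (Fin n) ℝ}
  {N : EuclideanSpace ℝ (Fin m) ≃L[ℝ] EuclideanSpace ℝ (Fin m)}
  {Plq : Matrix (Fin n) (Fin n) ℝ} {r : ℝ} {w : ℝ} [Fact (0 < w)]
  {hw : AdmissibleWeight P.A w} {a : ℝ} {L : ℝ≥0}
  {l : WL2 w (EuclideanSpace ℝ (Fin pu ⊕ Fin px))}

theorem dualIter_mem_nonpos (k : ℕ) : P.dualIter hw a L k ∈ WL2.nonpos w (Fin pu ⊕ Fin px) := by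
  cases k with
  | zero => exact WL2.zero_mem_nonpos
  | succ k => exact WL2.clip_mem_nonpos _

theorem dualHat_eq (k : ℕ) : P.dualHat hw a L k = P.dualIter hw a L k +
    alpha a k • (P.dualIter hw a L k - P.dualIter hw a L (k - 1)) := by
  cases k <;> rfl

theorem dualObjective_eq_top (hl : l ∉ WL2.nonpos w (Fin pu ⊕ Fin px)) :
    P.dualObjective hw l = ⊤ :=
  if_neg hl

theorem stateSeq_sub_stateSeq (u u' : WL2 w (EuclideanSpace ℝ (Fin m))) :
    P.stateSeq hw u - P.stateSeq hw u' = P.opB hw (u - u') := by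
  rw [stateSeq, stateSeq, add_sub_add_left_eq_sub, map_sub]

theorem continuous_stateSeq : Continuous (P.stateSeq hw) :=
  (P.opB hw).continuous.const_add _

namespace FeedbackFactor

theorem dualObjective_eq (h : P.FeedbackFactor Plq K N r)
    (hl : l ∈ WL2.nonpos w (Fin pu ⊕ Fin px)) :
    P.dualObjective hw l = ((dualQuadratic (h.constraintOp hw) (h.constraintVec hw) l -
      lqCost Plq P.xinit : ℝ) : EReal) :=
  (if_pos hl).trans (h.hStarE_eq hw l)

variable {h : P.FeedbackFactor Plq K N r} {v : WL2 1 (EuclideanSpace ℝ (Fin m))}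
  {l₀ : WL2 w (EuclideanSpace ℝ (Fin pu ⊕ Fin px))}

theorem isDualOptimal_iff_isMultiplier
    (hl₀ : IsMultiplier (h.constraintOp hw) (h.constraintVec hw) v l₀)
    (hv : v ∈ h.feasibleSet hw) :
    P.IsDualOptimal hw l ↔ IsMultiplier (h.constraintOp hw) (h.constraintVec hw) v l := by
  refine ⟨fun hopt => ?_, fun hl z => ?_⟩
  · have hle := hopt l₀
    rw [h.dualObjective_eq hl₀.nonpos] at hle
    have hl : l ∈ WL2.nonpos w (Fin pu ⊕ Fin px) := by
      by_contra hcon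
      rw [dualObjective_eq_top hcon] at hle
      exact EReal.coe_ne_top _ (top_le_iff.1 hle)
    rw [h.dualObjective_eq hl, EReal.coe_le_coe_iff, sub_le_sub_iff_right] at hle
    exact hl₀.of_dualQuadratic_le hv hl hle
  · by_cases hz : z ∈ WL2.nonpos w (Fin pu ⊕ Fin px)
    · rw [h.dualObjective_eq hl.nonpos, h.dualObjective_eq hz, EReal.coe_le_coe_iff,
        sub_le_sub_iff_right]
      exact hl.isMinOn hv hz
    · exact le_top.trans_eq (dualObjective_eq_top hz).symm

theorem isAcceleratedDescent (h : P.FeedbackFactor Plq K N r) (hL : 0 < L)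
    (hLip : LipschitzWith L (gradient (P.hStar hw))) :
    IsAcceleratedDescent (WL2.nonpos w (Fin pu ⊕ Fin px))
      (dualQuadratic (h.constraintOp hw) (h.constraintVec hw)) a L
      (P.dualIter hw a L) (P.dualHat hw a L) where
  convexOn := convexOn_dualQuadratic _ _ WL2.convex_nonpos
  pos := hL
  mem := dualIter_mem_nonpos
  extrapolate := dualHat_eq
  descent k z hz := by
    rw [h.gradient_hStar hw] at hLip
    refine dualQuadratic_add_norm_sub_sq_le _ _ hL (norm_adjoint_sq_le_of_lipschitz _ _ hLip) ?_
    rw [← h.gradient_hStar hw]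
    exact WL2.inner_sub_clip_nonpos _ hz

theorem dualQuadratic_dualIter_sub_le (ha : 2 ≤ a) (hL : 0 < L)
    (hLip : LipschitzWith L (gradient (P.hStar hw)))
    (hl : IsMultiplier (h.constraintOp hw) (h.constraintVec hw) v l)
    (hv : v ∈ h.feasibleSet hw) (k : ℕ) :
    dualQuadratic (h.constraintOp hw) (h.constraintVec hw) (P.dualIter hw a L k) -
        dualQuadratic (h.constraintOp hw) (h.constraintVec hw) l ≤
      a ^ 2 * L / (2 * (k + a - 1) ^ 2) * ‖P.dualIter hw a L 0 - l‖ ^ 2 := by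
  cases k with
  | zero =>
    have h0 : P.dualIter hw a L 0 = 0 := rfl
    have hφ0 : dualQuadratic (h.constraintOp hw) (h.constraintVec hw) 0 = 0 := by
      simp [dualQuadratic]
    have hbound := norm_adjoint_sq_le_of_lipschitz _ _ (h.gradient_hStar hw ▸ hLip) l
    have hcoef : (L : ℝ) / 2 ≤ a ^ 2 * L / (2 * (((0 : ℕ) : ℝ) + a - 1) ^ 2) := by
      have : 0 < a - 1 := by linarith
      have hsq : (a - 1) ^ 2 ≤ a ^ 2 := by nlinarith
      rw [Nat.cast_zero, zero_add, div_le_div_iff₀ two_pos (by positivity)]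
      nlinarith [mul_le_mul_of_nonneg_left hsq L.2]
    rw [h0, hφ0, hl.dualQuadratic_eq, ← hl.adjoint_eq, zero_sub, zero_sub, norm_neg]
    linarith [mul_le_mul_of_nonneg_right hcoef (sq_nonneg ‖l‖)]
  | succ k =>
    have hrate := (h.isAcceleratedDescent hL hLip).apply_succ_sub_le ha hl.nonpos (hl.isMinOn hv) k
    rwa [Nat.cast_succ, add_right_comm, add_sub_cancel_right]

theorem dualObjective_dualIter_le (ha : 2 ≤ a) (hL : 0 < L)
    (hLip : LipschitzWith L (gradient (P.hStar hw)))
    (hl : IsMultiplier (h.constraintOp hw) (h.constraintVec hw) v l)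
    (hv : v ∈ h.feasibleSet hw) (k : ℕ) :
    P.dualObjective hw (P.dualIter hw a L k) ≤ P.dualObjective hw l +
      ((a ^ 2 * L / (2 * (k + a - 1) ^ 2) * ‖P.dualIter hw a L 0 - l‖ ^ 2 : ℝ) : EReal) := by
  rw [h.dualObjective_eq (dualIter_mem_nonpos k), h.dualObjective_eq hl.nonpos, ← EReal.coe_add,
    EReal.coe_le_coe_iff]
  linarith [dualQuadratic_dualIter_sub_le ha hL hLip hl hv k]

theorem tendsto_adjoint_dualIter (ha : 2 < a) (hL : 0 < L)
    (hLip : LipschitzWith L (gradient (P.hStar hw)))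
    (hl : IsMultiplier (h.constraintOp hw) (h.constraintVec hw) v l)
    (hv : v ∈ h.feasibleSet hw) :
    Filter.Tendsto (fun k => adjoint (h.constraintOp hw) (P.dualIter hw a L k))
      Filter.atTop (𝓝 v) :=
  hl.tendsto_adjoint hv dualIter_mem_nonpos
    ((h.isAcceleratedDescent hL hLip).tendsto_apply ha hl.nonpos (hl.isMinOn hv))

theorem tendsto_adjoint_dualHat (ha : -1 ≤ a)
    (hlim : Filter.Tendsto (fun k => adjoint (h.constraintOp hw) (P.dualIter hw a L k))
      Filter.atTop (𝓝 v)) :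
    Filter.Tendsto (fun k => adjoint (h.constraintOp hw) (P.dualHat hw a L k))
      Filter.atTop (𝓝 v) := by
  have hstep := hlim.sub (hlim.comp (Filter.tendsto_sub_atTop_nat 1))
  rw [sub_self] at hstep
  have hα : Filter.IsBoundedUnder (· ≤ ·) Filter.atTop fun k => ‖alpha a k‖ :=
    Filter.isBoundedUnder_of ⟨1, fun k => by
      obtain ⟨hα0, hα1⟩ := alpha_mem_Icc ha k
      rwa [Real.norm_of_nonneg hα0]⟩
  have hsum := hlim.add (hα.smul_tendsto_zero hstep)
  rw [add_zero] at hsum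
  refine hsum.congr fun k => ?_
  rw [dualHat_eq, map_add, map_smul, map_sub, Function.comp_apply]

theorem exists_isMultiplier_forall_tendsto_inner (ha : 2 < a) (hL : 0 < L)
    (hLip : LipschitzWith L (gradient (P.hStar hw)))
    (hl : IsMultiplier (h.constraintOp hw) (h.constraintVec hw) v l)
    (hv : v ∈ h.feasibleSet hw) :
    ∃ z, IsMultiplier (h.constraintOp hw) (h.constraintVec hw) v z ∧ ∀ y, Filter.Tendsto
      (fun k => (inner ℝ y (P.dualIter hw a L k) : ℝ)) Filter.atTop (𝓝 (inner ℝ y z)) := by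
  have hdesc := h.isAcceleratedDescent (a := a) hL hLip
  exact exists_mem_forall_tendsto_inner
    (S := {z | IsMultiplier (h.constraintOp hw) (h.constraintVec hw) v z}) ⟨l, hl⟩
    (fun s hs => hdesc.exists_tendsto_norm_sub_sq ha hs.nonpos (hs.isMinOn hv))
    fun U z hU hz => hl.of_tendsto_inner hv dualIter_mem_nonpos
      ((hdesc.tendsto_apply ha hl.nonpos (hl.isMinOn hv)).mono_left hU) hz

theorem norm_lqInput_add_inputOp_sub_le (ha : 2 ≤ a) (hL : 0 < L)
    (hLip : LipschitzWith L (gradient (P.hStar hw))) {μ : ℝ} (hμ : 0 < μ)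
    (hmod : P.IsStrongConvexityModulus w μ)
    (hl : IsMultiplier (h.constraintOp hw) (h.constraintVec hw) v l)
    (hv : v ∈ h.feasibleSet hw) (k : ℕ) :
    ‖h.lqInput hw + h.inputOp hw (adjoint (h.constraintOp hw) (P.dualIter hw a L k)) -
        (h.lqInput hw + h.inputOp hw v)‖ ≤
      a * √(L / μ) * (‖P.dualIter hw a L 0 - l‖ / (k + a - 1)) := by
  rw [add_sub_add_left_eq_sub, ← map_sub]
  have : (0 : ℝ) ≤ k := k.cast_nonneg
  have hka : 0 < (k : ℝ) + a - 1 := by linarith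
  refine le_of_sq_le_sq ?_ (by positivity)
  rw [mul_pow, mul_pow, Real.sq_sqrt (by positivity), div_pow]
  calc ‖h.inputOp hw (adjoint (h.constraintOp hw) (P.dualIter hw a L k) - v)‖ ^ 2
      ≤ μ⁻¹ * ‖adjoint (h.constraintOp hw) (P.dualIter hw a L k) - v‖ ^ 2 :=
        (le_inv_mul_iff₀ hμ).2 (h.norm_inputOp_sq_le hw hmod _)
    _ ≤ μ⁻¹ * (2 * (a ^ 2 * L / (2 * (k + a - 1) ^ 2) * ‖P.dualIter hw a L 0 - l‖ ^ 2)) := by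
        gcongr
        linarith [dualQuadratic_dualIter_sub_le ha hL hLip hl hv k,
          hl.dualQuadratic_add_le hv (dualIter_mem_nonpos (hw := hw) (a := a) (L := L) k)]
    _ = a ^ 2 * (L / μ) * (‖P.dualIter hw a L 0 - l‖ ^ 2 / (k + a - 1) ^ 2) := by field_simp

end FeedbackFactor

theorem norm_stateSeq_sub_stateSeq_le {u u' : WL2 w (EuclideanSpace ℝ (Fin m))} {μ b : ℝ}
    (hu : ‖u - u'‖ ≤ a * √(L / μ) * b) :
    ‖P.stateSeq hw u - P.stateSeq hw u'‖ ≤ a * √(‖P.opB hw‖ ^ 2 * L / μ) * b := by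
  rw [stateSeq_sub_stateSeq]
  calc ‖P.opB hw (u - u')‖ ≤ ‖P.opB hw‖ * (a * √(L / μ) * b) := (P.opB hw).le_opNorm_of_le hu
    _ = a * √(‖P.opB hw‖ ^ 2 * L / μ) * b := by
      rw [mul_div_assoc, Real.sqrt_mul (sq_nonneg _), Real.sqrt_sq (norm_nonneg (P.opB hw))]
      ring

end Convergence

end CLQR

open CLQR CLQR.FeedbackFactor in
theorem theorem1_general {n m px pu : ℕ} (P : CLQR n m px pu) (hval : P.value ≠ ⊤)
    (hQ : P.Q.PosSemidef) (hR : P.R.PosDef) (hdet : Detectable P.A P.Q)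
    (Plq : Matrix (Fin n) (Fin n) ℝ) (K : Matrix (Fin m) (Fin n) ℝ) (hLQ : P.IsLQSolution Plq K)
    (S : Set (EuclideanSpace ℝ (Fin n))) (hS : S ⊆ P.maxInvariantSet K)
    (hS0 : (0 : EuclideanSpace ℝ (Fin n)) ∈ interior S)
    (cmp : ℝ → ℝ → Prop)
    (hcmp : cmp = (· ≤ ·) ∨ (cmp = (· < ·) ∧ (∀ j, 0 < P.cx j) ∧ ∀ j, 0 < P.cu j))
    (w : ℝ) [Fact (0 < w)] (hw : AdmissibleWeight P.A w) (a : ℝ) (ha : 2 < a)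
    (L : ℝ≥0) (hL : 0 < L) (hLip : LipschitzWith L (gradient (P.hStar hw)))
    (μ : ℝ) (hμ : 0 < μ) (hmod : P.IsStrongConvexityModulus w μ) :
    (∀ l, P.hStarE hw l ≠ ⊤ ∧ P.hStarE hw l ≠ ⊥) ∧ Differentiable ℝ (P.hStar hw) ∧
    (∀ lInf, P.IsDualOptimal hw lInf → ∀ k : ℕ,
      P.dualObjective hw (P.dualIter hw a L k) ≤ P.dualObjective hw lInf +
        ((a ^ 2 * L / (2 * (k + a - 1) ^ 2) * ‖P.dualIter hw a L 0 - lInf‖ ^ 2 : ℝ) : EReal)) ∧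
    (∃ lInf, P.IsDualOptimal hw lInf ∧ ∀ y, Filter.Tendsto
      (fun k => (inner ℝ y (P.dualIter hw a L k) : ℝ)) Filter.atTop (𝓝 (inner ℝ y lInf))) ∧
    (∃ (uSeq : ℕ → WL2 w (EuclideanSpace ℝ (Fin m))) (uInf : WL2 w (EuclideanSpace ℝ (Fin m))),
      (∀ (k : ℕ) (v : ℕ → EuclideanSpace ℝ (Fin m)),
        P.IsPrimalOf Plq K (P.dualIter hw a L k) (P.horizon cmp Plq K S hw a L k) v ↔
          v = uSeq k) ∧
      (∀ v : ℕ → EuclideanSpace ℝ (Fin m), P.IsOptimal v ↔ v = uInf) ∧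
      Filter.Tendsto uSeq Filter.atTop (𝓝 uInf) ∧
      Filter.Tendsto (fun k => P.stateSeq hw (uSeq k)) Filter.atTop (𝓝 (P.stateSeq hw uInf)) ∧
      ∀ lInf, P.IsDualOptimal hw lInf → ∀ k : ℕ,
        ‖uSeq k - uInf‖ ≤
          a * √(L / μ) * (‖P.dualIter hw a L 0 - lInf‖ / (k + a - 1)) ∧
        ‖P.stateSeq hw (uSeq k) - P.stateSeq hw uInf‖ ≤
          a * √(‖P.opB hw‖ ^ 2 * L / μ) * (‖P.dualIter hw a L 0 - lInf‖ / (k + a - 1))) ∧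
    (∀ k, (P.horizonCandidates cmp Plq K S (P.dualHat hw a L k)
        (P.horizon cmp Plq K S hw a L k)).Nonempty) ∧
      (∀ k i, P.horizon cmp Plq K S hw a L k ≤ i →
        P.dualIter hw a L k i = 0 ∧ P.dualHat hw a L k i = 0) ∧
      BddAbove (Set.range (P.horizon cmp Plq K S hw a L)) := by
  obtain ⟨N, r, h⟩ := hLQ.exists_feedbackFactor hQ hR hdet
  obtain ⟨u, hu, hcost⟩ := exists_feasible_of_value_ne_top hval
  obtain ⟨v, hv⟩ := h.exists_isLeastNormIn_feasibleSet hw hu hcost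
  obtain ⟨l, hl⟩ := exists_isMultiplier hv (interior_mono hS hS0)
  have hopt {l'} : P.IsDualOptimal hw l' ↔ IsMultiplier _ _ v l' :=
    isDualOptimal_iff_isMultiplier hl hv.mem
  have hle : ∀ x y, cmp x y → x ≤ y := by
    rcases hcmp with rfl | ⟨rfl, -⟩
    exacts [fun _ _ => id, fun _ _ => le_of_lt]
  have hterm := terminalSet_mem_nhds_zero hS hS0 hcmp
  have hzero := h.dualIter_apply_eq_zero (hw := hw) (a := a) (L := L) hS hle hterm
  have hadj := tendsto_adjoint_dualIter ha hL hLip hl hv.mem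
  have hinput : Filter.Tendsto (fun k => h.lqInput hw + h.inputOp hw
      (ContinuousLinearMap.adjoint (h.constraintOp hw) (P.dualIter hw a L k)))
      Filter.atTop (𝓝 (h.lqInput hw + h.inputOp hw v)) :=
    (((h.inputOp hw).continuous.tendsto v).comp hadj).const_add _
  refine ⟨fun l' => h.hStarE_eq hw l' ▸ ⟨EReal.coe_ne_top _, EReal.coe_ne_bot _⟩,
    fun l' => (h.hasGradientAt_hStar hw l').differentiableAt,
    fun l' hl' => dualObjective_dualIter_le ha.le hL hLip (hopt.1 hl') hv.mem,
    by simpa only [hopt] using exists_isMultiplier_forall_tendsto_inner ha hL hLip hl hv.mem,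
    ⟨_, _, fun k u' => ?_, fun u' => ?_, hinput, (continuous_stateSeq.tendsto _).comp hinput,
      fun l' hl' k => ?_⟩,
    fun k => h.horizonCandidates_nonempty hw hterm fun i hi => (hzero k i hi).2, hzero,
    h.bddAbove_range_horizon hS hle hterm (tendsto_adjoint_dualHat (by linarith) hadj)⟩
  · rw [h.lqInput_add_inputOp]
    exact h.isPrimalOf_iff hw (fun i hi => (hzero k i hi).1) u'
  · rw [h.lqInput_add_inputOp]
    exact isOptimal_iff hv (feasible_iff.1 hu).1 u'
  · have hrate := norm_lqInput_add_inputOp_sub_le ha.le hL hLip hμ hmod (hopt.1 hl') hv.mem k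
    exact ⟨hrate, norm_stateSeq_sub_stateSeq_le hrate⟩

theorem theorem1 {n m px pu : ℕ} (P : CLQR n m px pu)
    -- the standing assumptions
    (hP : P.StandingAssumption) (hdet : Detectable P.A P.Q)
    -- the unconstrained LQ controller
    (Plq : Matrix (Fin n) (Fin n) ℝ) (K : Matrix (Fin m) (Fin n) ℝ) (hLQ : P.IsLQSolution Plq K)
    -- the target set
    (S : Set (EuclideanSpace ℝ (Fin n))) (hS : S ⊆ P.maxInvariantSet K)
    (hS0 : (0 : EuclideanSpace ℝ (Fin n)) ∈ interior S)
    -- the inequality used in the determination of the horizons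
    (cmp : ℝ → ℝ → Prop)
    (hcmp : cmp = (· ≤ ·) ∨ (cmp = (· < ·) ∧ (∀ j, 0 < P.cx j) ∧ ∀ j, 0 < P.cu j))
    -- the weight, the parameters of the iteration, and the strong convexity modulus
    (w : ℝ) [Fact (0 < w)] (hw : AdmissibleWeight P.A w) (a : ℝ) (ha : 2 < a)
    (L : ℝ≥0) (hL : 0 < L) (hLip : LipschitzWith L (gradient (P.hStar hw)))
    (μ : ℝ) (hμ : 0 < μ) (hmod : P.IsStrongConvexityModulus w μ) :
    -- `h⋆` is finite and differentiable everywhere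
    (∀ l, P.hStarE hw l ≠ ⊤ ∧ P.hStarE hw l ≠ ⊥) ∧ Differentiable ℝ (P.hStar hw) ∧
    -- (i)
    (∀ lInf, P.IsDualOptimal hw lInf → ∀ k : ℕ,
      P.dualObjective hw (P.dualIter hw a L k) ≤ P.dualObjective hw lInf +
        ((a ^ 2 * L / (2 * (k + a - 1) ^ 2) * ‖P.dualIter hw a L 0 - lInf‖ ^ 2 : ℝ) : EReal)) ∧
    -- (ii)
    (∃ lInf, P.IsDualOptimal hw lInf ∧ ∀ y, Filter.Tendsto
      (fun k => (inner ℝ y (P.dualIter hw a L k) : ℝ)) Filter.atTop (𝓝 (inner ℝ y lInf))) ∧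
    -- (iii) and (iv)
    (∃ (uSeq : ℕ → WL2 w (EuclideanSpace ℝ (Fin m))) (uInf : WL2 w (EuclideanSpace ℝ (Fin m))),
      (∀ (k : ℕ) (v : ℕ → EuclideanSpace ℝ (Fin m)),
        P.IsPrimalOf Plq K (P.dualIter hw a L k) (P.horizon cmp Plq K S hw a L k) v ↔
          v = uSeq k) ∧
      (∀ v : ℕ → EuclideanSpace ℝ (Fin m), P.IsOptimal v ↔ v = uInf) ∧
      Filter.Tendsto uSeq Filter.atTop (𝓝 uInf) ∧
      Filter.Tendsto (fun k => P.stateSeq hw (uSeq k)) Filter.atTop (𝓝 (P.stateSeq hw uInf)) ∧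
      ∀ lInf, P.IsDualOptimal hw lInf → ∀ k : ℕ,
        ‖uSeq k - uInf‖ ≤
          a * √(L / μ) * (‖P.dualIter hw a L 0 - lInf‖ / (k + a - 1)) ∧
        ‖P.stateSeq hw (uSeq k) - P.stateSeq hw uInf‖ ≤
          a * √(‖P.opB hw‖ ^ 2 * L / μ) * (‖P.dualIter hw a L 0 - lInf‖ / (k + a - 1))) ∧
    -- (v)
    (∀ k, (P.horizonCandidates cmp Plq K S (P.dualHat hw a L k)
        (P.horizon cmp Plq K S hw a L k)).Nonempty) ∧
      (∀ k i, P.horizon cmp Plq K S hw a L k ≤ i →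
        P.dualIter hw a L k i = 0 ∧ P.dualHat hw a L k i = 0) ∧
      BddAbove (Set.range (P.horizon cmp Plq K S hw a L)) :=
  theorem1_general P hP.value_finite hP.Q_psd hP.R_posDef hdet Plq K hLQ S hS hS0 cmp hcmp w hw a ha
    L hL hLip μ hμ hmod
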